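/- **Node-Weighted Correlation Clustering.** Given a graph $G=(V,E)$ with $n=|V|\ge 1$ nodes and $m=|E|$ edges and positive integer node weights $(\omega_u)_{u\in V}$, the cost of a clustering (partition) $C$ of $V$ is $\sum_{uv\in E\triangle E_C}\omega_u\omega_v$, where $E_C$ is the set of pairs of distinct nodes lying in the same cluster of $C$. Let $\mathrm{OPT}$ be the minimum cost. The weights are polynomially bounded: $\omega_u\le (n+1)^d$ for a constant $d$. The *weighted randomized PIVOT procedure* repeats the following until all nodes are clustered: among the set $S$ of unclustered nodes, sample a pivot $u\in S$ with probability $\omega_u/\sum_{v\in S}\omega_v$, and make $u$ together with its neighbors in $S$ a new cluster. **Theorem.** There is a randomized word RAM program $P$ (unit-cost word arithmetic, memory access and uniformly random words) such that for every constant $d$ there is a constant $\kappa$, and for every constant $c$ a constant $K$ (depending on $d$ and $c$ only), with the following property. For every graph $G$ with $n \ge 1$ nodes and $m$ edges, given by adjacency lists in any order, all integer weights $1\le\omega_u\le (n+1)^d$ and every word length $w$ with $2^w \ge (n+1)^{\kappa}$, the program $P$ halts with probability $1$ and outputs a clustering of $V$ such that 1. the output has exactly the distribution of the clustering computed by the weighted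 randomized PIVOT procedure; 2. the expected cost of the output is at most $3\cdot\mathrm{OPT}$; 3. with probability at least $1-n^{-c}$, $P$ halts within $K\cdot(n+m)$ steps. -/

import Mathlib

open scoped ENNReal symmDiff

/-! ## A randomized word RAM

Words are the natural numbers below `2 ^ w`. A program is a finite text that does not depend on the
input or on `w`. It works on registers and on a random access memory, all of which hold words; every
elementary instruction (and every piece of control flow) takes one step. -/

namespace WordRAM

/-- The binary arithmetic operations on words. -/
inductive Op where
  | add | sub | mul | div | mod

/-- Arithmetic modulo `2 ^ w`; `div` and `mod` are those of the natural numbers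
(`a / 0 = 0`, `a % 0 = a`). -/
def Op.eval (w : ℕ) : Op → ℕ → ℕ → ℕ
  | .add, a, b => (a + b) % 2 ^ w
  | .sub, a, b => (a + (2 ^ w - b)) % 2 ^ w
  | .mul, a, b => (a * b) % 2 ^ w
  | .div, a, b => a / b
  | .mod, a, b => a % b

/-- Comparisons of words. -/
inductive Cmp where
  | eq | ne | lt | le

def Cmp.eval : Cmp → ℕ → ℕ → Bool
  | .eq, a, b => decide (a = b)
  | .ne, a, b => decide (a ≠ b)
  | .lt, a, b => decide (a < b)
  | .le, a, b => decide (a ≤ b)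

/-- Programs. The natural numbers named `x`, `y`, `z` are names of registers. -/
inductive Prog where
  /-- do nothing -/
  | skip
  /-- `x := k` -/
  | const (x k : ℕ)
  /-- `x := y` -/
  | copy (x y : ℕ)
  /-- `x := y o z` -/
  | op (x : ℕ) (o : Op) (y z : ℕ)
  /-- `x := memory[y]` -/
  | load (x y : ℕ)
  /-- `memory[x] := y` -/
  | store (x y : ℕ)
  /-- `x :=` a fresh uniformly random word -/
  | rand (x : ℕ)
  /-- `p; q` -/
  | seq (p q : Prog)
  /-- `if y t z then p else q` -/
  | branch (t : Cmp) (y z : ℕ) (p q : Prog)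
  /-- `while y t z do p` -/
  | loop (t : Cmp) (y z : ℕ) (p : Prog)

/-- The contents of the registers and of the memory. -/
structure State where
  reg : ℕ → ℕ
  mem : ℕ → ℕ

def State.setReg (s : State) (x a : ℕ) : State := { s with reg := Function.update s.reg x a }

def State.setMem (s : State) (i a : ℕ) : State := { s with mem := Function.update s.mem i a }

/-- A configuration: the program parts that are still to be executed, in this order, and the
current state. The machine has halted when nothing is left to be executed. -/
structure Config where
  todo : List Prog
  state : State

/-- A uniformly random word. -/
noncomputable def randomWord (w : ℕ) : PMF ℕ :=
  PMF.uniformOfFinset (Finset.range (2 ^ w)) ⟨0, Finset.mem_range.2 (Nat.two_pow_pos w)⟩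

/-- One step of the machine with words of `w` bits; a halted machine stays as it is. -/
noncomputable def step (w : ℕ) : Config → PMF Config
  | ⟨[], s⟩ => PMF.pure ⟨[], s⟩
  | ⟨.skip :: l, s⟩ => PMF.pure ⟨l, s⟩
  | ⟨.const x k :: l, s⟩ => PMF.pure ⟨l, s.setReg x (k % 2 ^ w)⟩
  | ⟨.copy x y :: l, s⟩ => PMF.pure ⟨l, s.setReg x (s.reg y)⟩
  | ⟨.op x o y z :: l, s⟩ => PMF.pure ⟨l, s.setReg x (o.eval w (s.reg y) (s.reg z))⟩
  | ⟨.load x y :: l, s⟩ => PMF.pure ⟨l, s.setReg x (s.mem (s.reg y))⟩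
  | ⟨.store x y :: l, s⟩ => PMF.pure ⟨l, s.setMem (s.reg x) (s.reg y)⟩
  | ⟨.rand x :: l, s⟩ => (randomWord w).map fun a => ⟨l, s.setReg x a⟩
  | ⟨.seq p q :: l, s⟩ => PMF.pure ⟨p :: q :: l, s⟩
  | ⟨.branch t y z p q :: l, s⟩ =>
      PMF.pure ⟨(if t.eval (s.reg y) (s.reg z) then p else q) :: l, s⟩
  | ⟨.loop t y z p :: l, s⟩ =>
      PMF.pure ⟨if t.eval (s.reg y) (s.reg z) then p :: .loop t y z p :: l else l, s⟩

/-- The distribution of the configuration after `T` steps. -/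
noncomputable def run (w : ℕ) : ℕ → Config → PMF Config
  | 0, c => PMF.pure c
  | T + 1, c => (step w c).bind (run w T)

/-- The start of program `p`: the words of the input stand in the memory from address `0` on,
all other memory cells and all registers are `0`. -/
def start (w : ℕ) (p : Prog) (input : List ℕ) : Config :=
  ⟨[p], ⟨fun _ => 0, fun i => input.getD i 0 % 2 ^ w⟩⟩

/-- The probability that `p` halts on this input within at most `T` steps. -/
noncomputable def haltProb (w : ℕ) (p : Prog) (input : List ℕ) (T : ℕ) : ℝ≥0∞ :=
  (run w T (start w p input)).toOuterMeasure {c | c.todo = []}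

/-- The probability that `p` halts on this input (after any number of steps, hence the limit
of an increasing sequence) with a final memory that decodes to the output `a`. -/
noncomputable def outputProb {α : Type*} (w : ℕ) (p : Prog) (input : List ℕ)
    (decode : (ℕ → ℕ) → α) (a : α) : ℝ≥0∞ :=
  ⨆ T : ℕ, (run w T (start w p input)).toOuterMeasure
    {c | c.todo = [] ∧ decode c.state.mem = a}

end WordRAM

/-! ## Node-weighted correlation clustering

A clustering of `V` is a partition of `V`, given as an equivalence relation. -/

namespace NodeWeightedCC

/-- The graph with edge set `E_C`: the pairs with both endpoints in the same cluster. -/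
def clusterGraph {V : Type*} (C : Setoid V) : SimpleGraph V where
  Adj u v := u ≠ v ∧ C u v
  symm := ⟨fun _ _ h => ⟨h.1.symm, C.symm' h.2⟩⟩
  loopless := ⟨fun _ h => h.1 rfl⟩

open Classical in
/-- The cost of a clustering: the sum of `ω u * ω v` over the pairs `uv ∈ E ∆ E_C`. -/
noncomputable def cost {V : Type*} [Fintype V] (G : SimpleGraph V) (ω : V → ℕ+) (C : Setoid V) :
    ℕ :=
  ∑ e : Sym2 V with e ∈ G.edgeSet ∆ (clusterGraph C).edgeSet, (e.map fun u => (ω u : ℕ)).mul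

/-- The minimal cost of a clustering. -/
noncomputable def opt {V : Type*} [Fintype V] (G : SimpleGraph V) (ω : V → ℕ+) : ℕ :=
  ⨅ C : Setoid V, cost G ω C

theorem sum_weights_ne_zero {V : Type*} (ω : V → ℕ+) (S : Finset V) (hS : S.Nonempty) :
    (∑' u : S, ((ω u : ℕ) : ℝ≥0∞)) ≠ 0 := by
  obtain ⟨a, ha⟩ := hS
  intro h
  have := ENNReal.tsum_eq_zero.1 h ⟨a, ha⟩
  simp at this

theorem sum_weights_ne_top {V : Type*} (ω : V → ℕ+) (S : Finset V) :
    (∑' u : S, ((ω u : ℕ) : ℝ≥0∞)) ≠ ∞ := by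
  rw [tsum_fintype]
  simp

/-- A random element of `S`, where `u` is chosen with probability `ω u / ∑ v ∈ S, ω v`. -/
noncomputable def weightedSample {V : Type*} (ω : V → ℕ+) (S : Finset V) (hS : S.Nonempty) :
    PMF S :=
  PMF.normalize (fun u : S => ((ω u : ℕ) : ℝ≥0∞)) (sum_weights_ne_zero ω S hS)
    (sum_weights_ne_top ω S)

open Classical in
/-- The node `u` and its neighbors among the nodes of `S`. -/
noncomputable def pivotCluster {V : Type*} (G : SimpleGraph V) (S : Finset V) (u : V) :
    Finset V :=
  S.filter fun v => v = u ∨ G.Adj u v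

open Classical in
/-- The randomized pivot procedure on the set `S` of unclustered nodes: sample a pivot `u ∈ S`
with probability proportional to its weight, make `u` and its unclustered neighbors a cluster,
continue with the other nodes of `S`. The result maps each node of `S` to the pivot of its
cluster. -/
noncomputable def pivotLabels {V : Type*} (G : SimpleGraph V) (ω : V → ℕ+) (S : Finset V) :
    PMF (V → V) :=
  if hS : S.Nonempty then
    (weightedSample ω S hS).bind fun u =>
      (pivotLabels G ω (S \ pivotCluster G S u)).map fun f v =>
        if v ∈ pivotCluster G S u then (u : V) else f v
  else PMF.pure id
termination_by S.card
decreasing_by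
  exact Finset.card_lt_card (Finset.sdiff_ssubset (Finset.filter_subset _ _)
    ⟨u, Finset.mem_filter.2 ⟨u.2, Or.inl rfl⟩⟩)

/-- The random clustering computed by the randomized pivot procedure. -/
noncomputable def pivotClustering {V : Type*} [Fintype V] (G : SimpleGraph V) (ω : V → ℕ+) :
    PMF (Setoid V) :=
  (pivotLabels G ω Finset.univ).map Setoid.ker

/-- `adj` is an adjacency list representation of `G`: the list `adj u` enumerates the neighbors
of `u`, in any order, each once. -/
def IsAdjList {n : ℕ} (G : SimpleGraph (Fin n)) (adj : Fin n → List (Fin n)) : Prop :=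
  ∀ u, (adj u).Nodup ∧ ∀ v, v ∈ adj u ↔ G.Adj u v

/-- The input of a program: the number of nodes, the weights, the degrees, and then the
adjacency lists of the nodes `0, 1, …, n - 1` one after the other. -/
def encode {n : ℕ} (ω : Fin n → ℕ+) (adj : Fin n → List (Fin n)) : List ℕ :=
  [n] ++ List.ofFn (fun u => (ω u : ℕ)) ++ List.ofFn (fun u => (adj u).length) ++
    (List.finRange n).flatMap fun u => (adj u).map Fin.val

/-- The output of a program: the memory cells `0, 1, …, n - 1` hold labels of the nodes, and two
nodes are in the same cluster iff they have equal labels. -/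
def decode (n : ℕ) (mem : ℕ → ℕ) : Setoid (Fin n) :=
  Setoid.ker fun u : Fin n => mem u

end NodeWeightedCC

/-! Approximation. Call three nodes a bad triple if they span exactly two edges. When `p` is the
pivot, a pair that is settled in this round is settled wrongly only if it forms a bad triple with
`p`, while every clustering errs on some pair of every bad triple (`BadTriple.disagree`). The chance
of a pivot times the weights of the other two nodes is, up to the common normalization, the product
of all three weights. This product is invariant under rotation of the triple, so the expected cost
of a round is at most three times the expected cost that a fixed clustering pays for the pairs
removed in that round (`sum_badTriple_le`, `pivotExpect_pairCost_le`).

Sampling. A weight is rounded up to a capacity, a power of two times a power of `n + 1`, less than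
or equal to twice the weight. Only `O(d log n)` capacities occur, and nodes of equal capacity share
a bucket. A line of positions is cut into slots of equal width, each belonging to one bucket, and
every node owns as many accepted positions as its weight. A random word points to a position; if the
position is not accepted, the word is rejected. Each node in the buckets is hit by exactly `g * ω v`
words for a common `g`, and at least one word in sixteen is accepted (`exists_isSelection`). A node
that is clustered as a neighbor stays in its bucket until it is drawn itself, and is then merely
removed. This does not alter the law of the next pivot, since an unclustered node is still drawn
proportionally to its weight (`sum_completion_nextLab`).

Distribution. Rejections cannot go on forever, so every clustering is output with at least the
probability that the pivot procedure gives it (`AtHead.completion_le_haltLim`). The pivot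
probabilities sum to `1` and the output probabilities to at most `1`, hence they agree, and the
program halts almost surely.

Time. The slots are rebuilt only after the total capacity has dropped by more than a factor of two,
and a rebuild costs time linear in the number of buckets. This makes `O(d log n)` rebuilds of cost
`O(d log n)`, which is `O(n)` for fixed `d`. Accepted draws are paid for by the nodes and their
degrees. Rejected draws are controlled by an exponential moment: for a suitable `y > 1` the
expectation of `y ^ time` is at most `y ^ potential` (`AtHead.expTime_le`), and Markov's inequality
gives the tail bound (`haltProb_pivotProgram`). -/

/-! ## Expectations with respect to discrete distributions -/

/-- The expectation of `h` under `p`. -/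
noncomputable def PMF.expect {α : Type*} (p : PMF α) (h : α → ℝ≥0∞) : ℝ≥0∞ := ∑' a, p a * h a

namespace PMF

variable {α β : Type*}

theorem expect_pure (a : α) (h : α → ℝ≥0∞) : (PMF.pure a).expect h = h a := by
  rw [expect, tsum_eq_single a]
  · simp
  · intro b hb
    simp [PMF.pure_apply, hb]

theorem expect_bind (p : PMF α) (q : α → PMF β) (h : β → ℝ≥0∞) :
    (p.bind q).expect h = p.expect fun a => (q a).expect h := by
  simp only [expect, PMF.bind_apply, ← ENNReal.tsum_mul_right, ← ENNReal.tsum_mul_left]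
  rw [ENNReal.tsum_comm]
  simp only [mul_assoc]

theorem expect_map (p : PMF α) (f : α → β) (h : β → ℝ≥0∞) :
    (p.map f).expect h = p.expect fun a => h (f a) := by
  rw [← PMF.bind_pure_comp, expect_bind]
  simp only [Function.comp, expect_pure]

theorem expect_mono (p : PMF α) {h k : α → ℝ≥0∞} (hk : ∀ a, h a ≤ k a) :
    p.expect h ≤ p.expect k :=
  ENNReal.tsum_le_tsum fun a => by gcongr; exact hk a

theorem expect_mul_left (p : PMF α) (c : ℝ≥0∞) (h : α → ℝ≥0∞) :
    (p.expect fun a => c * h a) = c * p.expect h := by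
  simp only [expect, ← ENNReal.tsum_mul_left, mul_left_comm]

theorem expect_const (p : PMF α) (c : ℝ≥0∞) : (p.expect fun _ => c) = c := by
  simp [expect, ENNReal.tsum_mul_right]

theorem expect_add (p : PMF α) (h k : α → ℝ≥0∞) :
    (p.expect fun a => h a + k a) = p.expect h + p.expect k := by
  simp only [expect, mul_add, ENNReal.tsum_add]

theorem toOuterMeasure_eq_expect (p : PMF α) (s : Set α) :
    p.toOuterMeasure s = p.expect (s.indicator 1) := by
  rw [PMF.toOuterMeasure_apply, expect]
  congr 1
  ext a
  by_cases h : a ∈ s <;> simp [h]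

/-- Monotone convergence: finite partial sums commute with increasing suprema. Only this direction
is needed, because limits of halting probabilities are always bounded from below. -/
theorem expect_iSup_le (p : PMF α) (h : ℕ → α → ℝ≥0∞) (hm : Monotone h) :
    (p.expect fun a => ⨆ i, h i a) ≤ ⨆ i, p.expect (h i) := by
  simp only [expect, ENNReal.mul_iSup]
  rw [ENNReal.tsum_eq_iSup_sum]
  refine iSup_le fun s => ?_
  rw [ENNReal.finsetSum_iSup_of_monotone]
  · refine iSup_mono fun i => ?_
    exact ENNReal.sum_le_tsum s
  · intro a i j hij
    exact mul_le_mul_right (hm hij a) _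

theorem expect_uniformOfFinset (s : Finset α) (hs : s.Nonempty) (h : α → ℝ≥0∞) :
    (PMF.uniformOfFinset s hs).expect h = (∑ a ∈ s, h a) / s.card := by
  rw [expect, tsum_eq_sum (s := s)]
  · rw [div_eq_mul_inv, Finset.sum_mul]
    refine Finset.sum_congr rfl fun a ha => ?_
    rw [PMF.uniformOfFinset_apply_of_mem hs ha, mul_comm]
  · intro a ha
    rw [PMF.uniformOfFinset_apply_of_notMem hs ha, zero_mul]

end PMF

/-! ## Deterministic computations, output probabilities and running times -/

namespace WordRAM

/-- `Reach w c c' t`: from `c` the machine gets to `c'` in `t` deterministic steps. -/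
inductive Reach (w : ℕ) : Config → Config → ℕ → Prop
  | refl (c : Config) : Reach w c c 0
  | head {c c₁ c' : Config} {t : ℕ} : c.todo ≠ [] → step w c = PMF.pure c₁ → Reach w c₁ c' t →
      Reach w c c' (t + 1)

theorem Reach.trans {w : ℕ} {c c₁ c₂ : Config} {t t' : ℕ} (h : Reach w c c₁ t)
    (h' : Reach w c₁ c₂ t') : Reach w c c₂ (t + t') := by
  induction h with
  | refl => simpa using h'
  | head h1 h2 _ ih =>
    have := Reach.head h1 h2 (ih h')
    rwa [add_right_comm] at this

theorem Reach.single {w : ℕ} {c c₁ : Config} (h : c.todo ≠ []) (h' : step w c = PMF.pure c₁) :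
    Reach w c c₁ 1 := .head h h' (.refl _)

/-- The probability to have halted with a memory in `E` within `T` steps. -/
noncomputable def haltIn (w : ℕ) (E : Set (ℕ → ℕ)) (T : ℕ) (c : Config) : ℝ≥0∞ :=
  (run w T c).toOuterMeasure {c | c.todo = [] ∧ c.state.mem ∈ E}

theorem haltIn_succ (w : ℕ) (E : Set (ℕ → ℕ)) (T : ℕ) (c : Config) :
    haltIn w E (T + 1) c = (step w c).expect (haltIn w E T) := by
  simp only [haltIn, PMF.toOuterMeasure_eq_expect, run, PMF.expect_bind]
  rfl

theorem step_of_todo_eq_nil {w : ℕ} {c : Config} (h : c.todo = []) : step w c = PMF.pure c := by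
  obtain ⟨l, s⟩ := c
  subst h
  rfl

theorem haltIn_le_succ (w : ℕ) (E : Set (ℕ → ℕ)) (T : ℕ) (c : Config) :
    haltIn w E T c ≤ haltIn w E (T + 1) c := by
  induction T generalizing c with
  | zero =>
    by_cases h : c.todo = []
    · rw [haltIn_succ, step_of_todo_eq_nil h, PMF.expect_pure]
    · simp [haltIn, PMF.toOuterMeasure_eq_expect, run, PMF.expect_pure, h]
  | succ T ih =>
    rw [haltIn_succ, haltIn_succ w E (T + 1)]
    exact PMF.expect_mono _ ih

theorem haltIn_mono (w : ℕ) (E : Set (ℕ → ℕ)) : Monotone (haltIn w E) :=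
  monotone_nat_of_le_succ fun T c => haltIn_le_succ w E T c

/-- The probability to halt with a memory in `E`. -/
noncomputable def haltLim (w : ℕ) (E : Set (ℕ → ℕ)) (c : Config) : ℝ≥0∞ := ⨆ T, haltIn w E T c

theorem haltIn_le_one (w : ℕ) (E : Set (ℕ → ℕ)) (T : ℕ) (c : Config) : haltIn w E T c ≤ 1 := by
  rw [haltIn, PMF.toOuterMeasure_eq_expect]
  calc (run w T c).expect _ ≤ (run w T c).expect fun _ => 1 := PMF.expect_mono _ fun a => by
        by_cases h : a ∈ {c : Config | c.todo = [] ∧ c.state.mem ∈ E}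
        · rw [Set.indicator_of_mem h]; rfl
        · rw [Set.indicator_of_notMem h]; exact zero_le
    _ = 1 := PMF.expect_const _ _

theorem haltLim_le_one (w : ℕ) (E : Set (ℕ → ℕ)) (c : Config) : haltLim w E c ≤ 1 :=
  iSup_le fun T => haltIn_le_one w E T c

/-- Lower bounds on the halting probability thus travel backwards along an execution. The matching
upper bound is never proved stepwise; it comes from the total mass. -/
theorem expect_haltLim_le (w : ℕ) (E : Set (ℕ → ℕ)) (c : Config) :
    (step w c).expect (haltLim w E) ≤ haltLim w E c := by
  refine (PMF.expect_iSup_le _ (haltIn w E) (haltIn_mono w E)).trans (iSup_le fun T => ?_)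
  rw [← haltIn_succ]
  exact le_iSup (fun T => haltIn w E T c) (T + 1)

theorem haltLim_le_of_reach {w : ℕ} {E : Set (ℕ → ℕ)} {c c' : Config} {t : ℕ}
    (h : Reach w c c' t) : haltLim w E c' ≤ haltLim w E c := by
  induction h with
  | refl => exact le_rfl
  | head _ h2 _ ih =>
    refine ih.trans ?_
    have := expect_haltLim_le w E
    rename_i c c1 _ _ _ _
    have := this c
    rwa [h2, PMF.expect_pure] at this

theorem haltLim_halted (w : ℕ) {E : Set (ℕ → ℕ)} {s : State} (h : s.mem ∈ E) :
    1 ≤ haltLim w E ⟨[], s⟩ := by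
  refine le_trans ?_ (le_iSup (fun T => haltIn w E T ⟨[], s⟩) 0)
  simp [haltIn, PMF.toOuterMeasure_eq_expect, run, PMF.expect_pure, h]

theorem expect_step_rand (w x : ℕ) (l : List Prog) (s : State) (h : Config → ℝ≥0∞) :
    (step w ⟨.rand x :: l, s⟩).expect h =
      (∑ a ∈ Finset.range (2 ^ w), h ⟨l, s.setReg x a⟩) / 2 ^ w := by
  rw [step, PMF.expect_map]
  refine (PMF.expect_uniformOfFinset _ _ _).trans ?_
  simp

/-- The probability not to have halted within `T` steps. -/
noncomputable def surv (w T : ℕ) (c : Config) : ℝ≥0∞ :=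
  (run w T c).toOuterMeasure {c | c.todo ≠ []}

theorem surv_succ (w T : ℕ) (c : Config) :
    surv w (T + 1) c = (step w c).expect (surv w T) := by
  simp only [surv, PMF.toOuterMeasure_eq_expect, run, PMF.expect_bind]
  rfl

theorem surv_le_one (w T : ℕ) (c : Config) : surv w T c ≤ 1 := by
  rw [surv, PMF.toOuterMeasure_eq_expect]
  calc (run w T c).expect _ ≤ (run w T c).expect fun _ => 1 := PMF.expect_mono _ fun a => by
        by_cases h : a ∈ {c : Config | c.todo ≠ []}
        · rw [Set.indicator_of_mem h]; rfl
        · rw [Set.indicator_of_notMem h]; exact zero_le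
    _ = 1 := PMF.expect_const _ _

theorem surv_add_halt (w T : ℕ) (c : Config) :
    surv w T c + (run w T c).toOuterMeasure {c | c.todo = []} = 1 := by
  rw [surv, PMF.toOuterMeasure_eq_expect, PMF.toOuterMeasure_eq_expect, ← PMF.expect_add]
  convert PMF.expect_const (run w T c) 1 using 2
  ext a
  by_cases h : a.todo = [] <;> simp [h]

open Classical in
/-- The expectation of `y ^ t`, where `t` is the smaller one of `T` and the running time. -/
noncomputable def expTime (w : ℕ) (y : ℝ≥0∞) : ℕ → Config → ℝ≥0∞
  | 0, _ => 1
  | T + 1, c => if c.todo = [] then 1 else y * (step w c).expect (expTime w y T)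

theorem surv_halted (w T : ℕ) {c : Config} (h : c.todo = []) : surv w T c = 0 := by
  induction T with
  | zero => simp [surv, PMF.toOuterMeasure_eq_expect, run, PMF.expect_pure, h]
  | succ T ih => rw [surv_succ, step_of_todo_eq_nil h, PMF.expect_pure, ih]

/-- Markov's inequality: a run that is still alive after `T` steps contributes `y ^ T` to the
expectation. -/
theorem surv_mul_pow_le (w T : ℕ) (y : ℝ≥0∞) (c : Config) :
    surv w T c * y ^ T ≤ expTime w y T c := by
  induction T generalizing c with
  | zero => simpa [expTime] using surv_le_one w 0 c
  | succ T ih =>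
    by_cases h : c.todo = []
    · simp [surv_halted w _ h]
    · rw [expTime, if_neg h, surv_succ, pow_succ', mul_comm, mul_assoc, ← PMF.expect_mul_left]
      gcongr
      refine PMF.expect_mono _ fun c => ?_
      rw [mul_comm]
      exact ih c

theorem one_le_expTime (w T : ℕ) {y : ℝ≥0∞} (hy : 1 ≤ y) (c : Config) : 1 ≤ expTime w y T c := by
  induction T generalizing c with
  | zero => exact le_rfl
  | succ T ih =>
    rw [expTime]
    split_ifs with h
    · exact le_rfl
    · calc (1 : ℝ≥0∞) = 1 * (step w c).expect fun _ => 1 := by rw [PMF.expect_const, one_mul]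
        _ ≤ _ := mul_le_mul' hy (PMF.expect_mono _ ih)

theorem expTime_le_succ (w T : ℕ) {y : ℝ≥0∞} (hy : 1 ≤ y) (c : Config) :
    expTime w y T c ≤ expTime w y (T + 1) c := by
  induction T generalizing c with
  | zero => exact one_le_expTime w 1 hy c
  | succ T ih =>
    rw [expTime, expTime]
    split_ifs with h
    · exact le_rfl
    · exact mul_le_mul_right (PMF.expect_mono _ ih) _

theorem expTime_halted (w T : ℕ) (y : ℝ≥0∞) {c : Config} (h : c.todo = []) :
    expTime w y T c = 1 := by
  cases T with
  | zero => rfl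
  | succ T => rw [expTime, if_pos h]

/-- The budget `T` is not lowered on the right, which is allowed by monotonicity in `T`. Blocks of
unknown length can then be skipped without bookkeeping. -/
theorem expTime_le_step (w T : ℕ) {y : ℝ≥0∞} (hy : 1 ≤ y) {c : Config} (h : c.todo ≠ []) :
    expTime w y T c ≤ y * (step w c).expect (expTime w y T) := by
  refine (expTime_le_succ w T hy c).trans ?_
  rw [expTime, if_neg h]

theorem expTime_le_of_reach {w : ℕ} {c c' : Config} {t : ℕ} (h : Reach w c c' t) (T : ℕ)
    {y : ℝ≥0∞} (hy : 1 ≤ y) : expTime w y T c ≤ y ^ t * expTime w y T c' := by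
  induction h with
  | refl => simp
  | head h1 h2 _ ih =>
    refine (expTime_le_step w T hy h1).trans ?_
    rw [h2, PMF.expect_pure, pow_succ', mul_assoc]
    gcongr

/-- This exact form, in which the budget does drop, makes the induction on `T` over the iterations
of the main loop well-founded. -/
theorem expTime_succ_of_step {w : ℕ} {c c' : Config} (T : ℕ) {y : ℝ≥0∞} (h : c.todo ≠ [])
    (h' : step w c = PMF.pure c') : expTime w y (T + 1) c = y * expTime w y T c' := by
  rw [expTime, if_neg h, h', PMF.expect_pure]

end WordRAM

/-! ## A small structured language on top of the word RAM

The memory is divided into 16 regions of equal size. Register `0` holds the size of a region, the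
registers below `32` are variables, the others hold intermediate results. -/

namespace WordRAM

/-- The number of cells of a region. -/
def regionSize (w : ℕ) : ℕ := (2 ^ w - 1) / 16

/-- The variables, the regions of the memory, and the time that has been accounted for. -/
structure Env where
  reg : ℕ → ℕ
  mem : ℕ → ℕ → ℕ
  time : ℕ

namespace Env

def tick (σ : Env) (t : ℕ) : Env := ⟨σ.reg, σ.mem, σ.time + t⟩

def setReg (σ : Env) (x v t : ℕ) : Env :=
  ⟨fun y => if y = x then v else σ.reg y, σ.mem, σ.time + t⟩

def setMem (σ : Env) (k i v t : ℕ) : Env :=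
  ⟨σ.reg, fun k' i' => if k' = k then (if i' = i then v else σ.mem k i') else σ.mem k' i',
    σ.time + t⟩

@[simp] theorem tick_reg (σ : Env) (t : ℕ) : (σ.tick t).reg = σ.reg := rfl
@[simp] theorem tick_mem (σ : Env) (t : ℕ) : (σ.tick t).mem = σ.mem := rfl
@[simp] theorem tick_time (σ : Env) (t : ℕ) : (σ.tick t).time = σ.time + t := rfl
@[simp] theorem setReg_reg (σ : Env) (x v t y : ℕ) :
    (σ.setReg x v t).reg y = if y = x then v else σ.reg y := rfl
@[simp] theorem setReg_mem (σ : Env) (x v t : ℕ) : (σ.setReg x v t).mem = σ.mem := rfl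
@[simp] theorem setReg_time (σ : Env) (x v t : ℕ) : (σ.setReg x v t).time = σ.time + t := rfl
@[simp] theorem setMem_reg (σ : Env) (k i v t : ℕ) : (σ.setMem k i v t).reg = σ.reg := rfl
@[simp] theorem setMem_mem (σ : Env) (k i v t k' i' : ℕ) : (σ.setMem k i v t).mem k' i' =
    if k' = k then (if i' = i then v else σ.mem k i') else σ.mem k' i' := rfl
@[simp] theorem setMem_time (σ : Env) (k i v t : ℕ) :
    (σ.setMem k i v t).time = σ.time + t := rfl

end Env

/-- `s` represents `σ`. -/
structure Rep (w : ℕ) (s : State) (σ : Env) : Prop where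
  base : s.reg 0 = regionSize w
  reg : ∀ y < 32, s.reg y = σ.reg y
  mem : ∀ k < 16, ∀ i < regionSize w, s.mem (k * regionSize w + i) = σ.mem k i

theorem sixteen_mul_regionSize_lt (w : ℕ) : 16 * regionSize w < 2 ^ w := by
  have := Nat.two_pow_pos w
  have := Nat.mul_div_le (2 ^ w - 1) 16
  unfold regionSize
  omega

theorem address_lt {w k i : ℕ} (hk : k < 16) (hi : i < regionSize w) :
    k * regionSize w + i < 2 ^ w := by
  have := sixteen_mul_regionSize_lt w
  have : k * regionSize w ≤ 15 * regionSize w := Nat.mul_le_mul_right _ (by omega)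
  omega

theorem address_inj {q k k' i i' : ℕ} (hi : i < q) (hi' : i' < q)
    (h : k * q + i = k' * q + i') : k = k' ∧ i = i' := by
  have hq : 0 < q := by omega
  have h1 : (k * q + i) / q = k := by
    rw [mul_comm, Nat.mul_add_div hq, Nat.div_eq_of_lt hi, add_zero]
  have h2 : (k' * q + i') / q = k' := by
    rw [mul_comm, Nat.mul_add_div hq, Nat.div_eq_of_lt hi', add_zero]
  have : k = k' := by rw [← h1, h, h2]
  subst this
  exact ⟨rfl, by omega⟩

inductive Expr where
  | var (x : ℕ)
  | lit (k : ℕ)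
  | bin (o : Op) (a b : Expr)
  /-- the `i`-th cell of region `k` -/
  | get (k : ℕ) (i : Expr)

def Op.natEval : Op → ℕ → ℕ → ℕ
  | .add, a, b => a + b
  | .sub, a, b => a - b
  | .mul, a, b => a * b
  | .div, a, b => a / b
  | .mod, a, b => a % b

/-- There is no overflow. -/
def Op.Ok (w : ℕ) : Op → ℕ → ℕ → Prop
  | .add, a, b => a + b < 2 ^ w
  | .sub, a, b => b ≤ a ∧ a < 2 ^ w
  | .mul, a, b => a * b < 2 ^ w
  | .div, _, _ => True
  | .mod, _, _ => True

theorem Op.eval_eq {w : ℕ} {o : Op} {a b : ℕ} (h : o.Ok w a b) : o.eval w a b = o.natEval a b := by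
  cases o with
  | add => exact Nat.mod_eq_of_lt h
  | sub =>
    obtain ⟨h1, h2⟩ := h
    have : a + (2 ^ w - b) = (a - b) + 2 ^ w := by omega
    simp only [Op.eval, Op.natEval, this, Nat.add_mod_right]
    exact Nat.mod_eq_of_lt (by omega)
  | mul => exact Nat.mod_eq_of_lt h
  | div => rfl
  | mod => rfl

namespace Expr

def eval (σ : Env) : Expr → ℕ
  | var x => σ.reg x
  | lit k => k
  | bin o a b => o.natEval (a.eval σ) (b.eval σ)
  | get k i => σ.mem k (i.eval σ)

def Ok (w : ℕ) (σ : Env) : Expr → Prop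
  | var x => x < 32
  | lit k => k < 2 ^ w
  | bin o a b => a.Ok w σ ∧ b.Ok w σ ∧ o.Ok w (a.eval σ) (b.eval σ)
  | get k i => k < 16 ∧ i.Ok w σ ∧ i.eval σ < regionSize w

/-- The value goes to register `x`; the registers from `x` on are scratch and those below are
preserved. Register `0` holds the region size, which turns a region number into a base address. -/
def compile : Expr → ℕ → Prog
  | var y, x => .copy x y
  | lit k, x => .const x k
  | bin o a b, x => .seq (a.compile x) (.seq (b.compile (x + 1)) (.op x o x (x + 1)))
  | get k i, x => .seq (i.compile x) (.seq (.const (x + 1) k) (.seq (.op (x + 1) .mul (x + 1) 0)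
      (.seq (.op x .add (x + 1) x) (.load x x))))

/-- The exact number of machine steps, where each `seq` counts one. -/
def cost : Expr → ℕ
  | var _ => 1
  | lit _ => 1
  | bin _ a b => a.cost + b.cost + 3
  | get _ i => i.cost + 8

end Expr

/-- The machine gets from the state `s` to the state `s'` by executing `p`, in `t` steps. -/
def Exec (w : ℕ) (p : Prog) (s s' : State) (t : ℕ) : Prop :=
  ∀ l, Reach w ⟨p :: l, s⟩ ⟨l, s'⟩ t

theorem Exec.seq {w : ℕ} {p q : Prog} {s s₁ s₂ : State} {t₁ t₂ : ℕ} (h₁ : Exec w p s s₁ t₁)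
    (h₂ : Exec w q s₁ s₂ t₂) : Exec w (.seq p q) s s₂ (t₁ + t₂ + 1) := fun l =>
  .head (by simp) rfl ((h₁ _).trans (h₂ _))

theorem Exec.const (w : ℕ) {x k : ℕ} (s : State) :
    Exec w (.const x k) s (s.setReg x (k % 2 ^ w)) 1 :=
  fun _ => .single (by simp) rfl

theorem Exec.copy (w x y : ℕ) (s : State) : Exec w (.copy x y) s (s.setReg x (s.reg y)) 1 :=
  fun _ => .single (by simp) rfl

theorem Exec.op (w x : ℕ) (o : Op) (y z : ℕ) (s : State) :
    Exec w (.op x o y z) s (s.setReg x (o.eval w (s.reg y) (s.reg z))) 1 :=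
  fun _ => .single (by simp) rfl

theorem Exec.load (w x y : ℕ) (s : State) :
    Exec w (.load x y) s (s.setReg x (s.mem (s.reg y))) 1 :=
  fun _ => .single (by simp) rfl

theorem Exec.store (w x y : ℕ) (s : State) :
    Exec w (.store x y) s (s.setMem (s.reg x) (s.reg y)) 1 :=
  fun _ => .single (by simp) rfl

@[simp] theorem State.setReg_reg (s : State) (x a y : ℕ) :
    (s.setReg x a).reg y = if y = x then a else s.reg y := by
  simp [State.setReg, Function.update_apply]

@[simp] theorem State.setReg_mem (s : State) (x a : ℕ) : (s.setReg x a).mem = s.mem := rfl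

@[simp] theorem State.setMem_reg (s : State) (x a : ℕ) : (s.setMem x a).reg = s.reg := rfl

@[simp] theorem State.setMem_mem (s : State) (x a y : ℕ) :
    (s.setMem x a).mem y = if y = x then a else s.mem y := by
  simp [State.setMem, Function.update_apply]

theorem Rep.of_agree {w : ℕ} {s s' : State} {σ : Env} {x : ℕ} (h : Rep w s σ) (hx : 32 ≤ x)
    (hm : s'.mem = s.mem) (hr : ∀ y < x, s'.reg y = s.reg y) : Rep w s' σ where
  base := by rw [hr 0 (by omega), h.base]
  reg y hy := by rw [hr y (by omega), h.reg y hy]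
  mem k hk i hi := by rw [hm, h.mem k hk i hi]

theorem Expr.exec_compile {w : ℕ} {σ : Env} (e : Expr) {s : State} {x : ℕ} (hs : Rep w s σ)
    (hx : 32 ≤ x) (he : e.Ok w σ) : ∃ s', Exec w (e.compile x) s s' e.cost ∧ s'.mem = s.mem ∧
      (∀ y < x, s'.reg y = s.reg y) ∧ s'.reg x = e.eval σ := by
  induction e generalizing s x with
  | var y =>
    refine ⟨_, Exec.copy w x y s, rfl, fun z hz => ?_, ?_⟩
    · simp [hz.ne]
    · simpa [Expr.eval] using hs.reg y he
  | lit k =>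
    refine ⟨_, Exec.const w s, rfl, fun z hz => ?_, ?_⟩
    · simp [hz.ne]
    · simpa [Expr.eval] using Nat.mod_eq_of_lt he
  | bin o a b iha ihb =>
    obtain ⟨ha, hb, ho⟩ := he
    obtain ⟨s₁, e₁, m₁, r₁, v₁⟩ := iha hs hx ha
    have hs₁ := hs.of_agree hx m₁ r₁
    obtain ⟨s₂, e₂, m₂, r₂, v₂⟩ := ihb hs₁ (hx.trans (Nat.le_succ x)) hb
    refine ⟨_, (e₁.seq (e₂.seq (Exec.op w x o x (x + 1) s₂))), ?_, fun z hz => ?_, ?_⟩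
    · rw [State.setReg_mem, m₂, m₁]
    · simp [hz.ne, r₂ z (by omega), r₁ z hz]
    · simp only [State.setReg_reg, if_true, v₂, r₂ x (by omega), v₁]
      exact Op.eval_eq ho
  | get k i ih =>
    obtain ⟨hk, hi, hlt⟩ := he
    obtain ⟨s₁, e₁, m₁, r₁, v₁⟩ := ih hs hx hi
    have h16 := sixteen_mul_regionSize_lt w
    have hadr := address_lt hk hlt
    refine ⟨_, e₁.seq ((Exec.const w s₁).seq ((Exec.op w (x + 1) .mul (x + 1) 0 _).seq
      ((Exec.op w x .add (x + 1) x _).seq (Exec.load w x x _)))), ?_, fun z hz => ?_, ?_⟩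
    · simp [m₁]
    · have h1 : z ≠ x + 1 := by omega
      simp [hz.ne, h1, r₁ z hz]
    · have h0 : (0 : ℕ) ≠ x + 1 := by omega
      have hk' : k % 2 ^ w = k := Nat.mod_eq_of_lt (by omega)
      have hq : s₁.reg 0 = regionSize w := by rw [r₁ 0 (by omega), hs.base]
      simp only [State.setReg_reg, if_true, h0, if_false, (show x ≠ x + 1 by omega),
        State.setReg_mem, Op.eval, hk', hq, v₁, m₁]
      have hm : k * regionSize w % 2 ^ w = k * regionSize w := Nat.mod_eq_of_lt (by omega)
      rw [hm, Nat.mod_eq_of_lt hadr, hs.mem k hk _ hlt]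
      rfl

inductive Stmt where
  | skip
  | assign (x : ℕ) (e : Expr)
  /-- write into the `i`-th cell of region `k` -/
  | put (k : ℕ) (i e : Expr)
  | seq (p q : Stmt)
  | ite (t : Cmp) (a b : Expr) (p q : Stmt)
  | loop (t : Cmp) (y z : ℕ) (p : Stmt)

namespace Stmt

def compile : Stmt → Prog
  | skip => .skip
  | assign x e => .seq (e.compile 32) (.copy x 32)
  | put k i e => .seq (i.compile 32) (.seq (.const 33 k) (.seq (.op 33 .mul 33 0)
      (.seq (.op 32 .add 33 32) (.seq (e.compile 33) (.store 32 33)))))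
  | seq p q => .seq p.compile q.compile
  | ite t a b p q => .seq (a.compile 32) (.seq (b.compile 33)
      (.branch t 32 33 p.compile q.compile))
  | loop t y z p => .loop t y z p.compile

end Stmt

/-- From every state that represents `σ`, the program `p` leads to a state that represents some `σ'`
with `Φ σ'`, within the time that `σ'` accounts for. -/
def wp (w : ℕ) (p : Prog) (Φ : Env → Prop) (σ : Env) : Prop :=
  ∀ s, Rep w s σ → ∃ s' σ' t, Exec w p s s' t ∧ Rep w s' σ' ∧ σ.time + t ≤ σ'.time ∧ Φ σ'

theorem wp.mono {w : ℕ} {p : Prog} {Φ Ψ : Env → Prop} {σ : Env} (h : wp w p Φ σ)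
    (hΦ : ∀ σ', Φ σ' → Ψ σ') : wp w p Ψ σ := fun s hs => by
  obtain ⟨s', σ', t, h1, h2, h3, h4⟩ := h s hs
  exact ⟨s', σ', t, h1, h2, h3, hΦ _ h4⟩

theorem Rep.tick {w : ℕ} {s : State} {σ : Env} (h : Rep w s σ) (t : ℕ) : Rep w s (σ.tick t) :=
  ⟨h.base, h.reg, h.mem⟩

theorem wp_seq {w : ℕ} {p q : Prog} {Φ : Env → Prop} {σ : Env}
    (h : wp w p (wp w q Φ) (σ.tick 1)) : wp w (.seq p q) Φ σ := fun s hs => by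
  obtain ⟨s₁, σ₁, t₁, e₁, r₁, h₁, h⟩ := h s (hs.tick 1)
  obtain ⟨s₂, σ₂, t₂, e₂, r₂, h₂, h⟩ := h s₁ r₁
  refine ⟨s₂, σ₂, _, e₁.seq e₂, r₂, ?_, h⟩
  simp only [Env.tick_time] at h₁
  omega

theorem Rep.setReg {w : ℕ} {s : State} {σ : Env} (h : Rep w s σ) {x : ℕ} (hx : x ≠ 0) (v t : ℕ) :
    Rep w (s.setReg x v) (σ.setReg x v t) where
  base := by simp [hx.symm, h.base]
  reg y hy := by simp [h.reg y hy]
  mem := h.mem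

theorem wp_assign {w : ℕ} {x : ℕ} {e : Expr} {Φ : Env → Prop} {σ : Env} (hx : x ≠ 0)
    (he : e.Ok w σ) (h : Φ (σ.setReg x (e.eval σ) (e.cost + 2))) :
    wp w (Stmt.assign x e).compile Φ σ := fun s hs => by
  obtain ⟨s₁, e₁, m₁, r₁, v₁⟩ := e.exec_compile hs le_rfl he
  have h₁ : Rep w s₁ σ := hs.of_agree le_rfl m₁ r₁
  refine ⟨_, _, _, e₁.seq (Exec.copy w x 32 s₁), ?_, ?_, h⟩
  · rw [v₁]
    exact h₁.setReg hx _ _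
  · simp only [Env.setReg_time]
    omega

theorem wp_put {w : ℕ} {k : ℕ} {i e : Expr} {Φ : Env → Prop} {σ : Env} (hk : k < 16)
    (hi : i.Ok w σ) (hlt : i.eval σ < regionSize w) (he : e.Ok w σ)
    (h : Φ (σ.setMem k (i.eval σ) (e.eval σ) (i.cost + e.cost + 9))) :
    wp w (Stmt.put k i e).compile Φ σ := fun s hs => by
  obtain ⟨s₁, e₁, m₁, r₁, v₁⟩ := i.exec_compile hs le_rfl hi
  have h16 := sixteen_mul_regionSize_lt w
  have hadr := address_lt hk hlt
  have hk' : k % 2 ^ w = k := Nat.mod_eq_of_lt (by omega)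
  have hq : s₁.reg 0 = regionSize w := by rw [r₁ 0 (by omega), hs.base]
  have hm : k * regionSize w % 2 ^ w = k * regionSize w := Nat.mod_eq_of_lt (by omega)
  have f₁ := Exec.const w (x := 33) (k := k) s₁
  have f₂ := Exec.op w 33 .mul 33 0 (s₁.setReg 33 (k % 2 ^ w))
  have f₃ := Exec.op w 32 .add 33 32 ((s₁.setReg 33 (k % 2 ^ w)).setReg 33
    (Op.eval w .mul ((s₁.setReg 33 (k % 2 ^ w)).reg 33) ((s₁.setReg 33 (k % 2 ^ w)).reg 0)))
  set s₂ := (((s₁.setReg 33 (k % 2 ^ w)).setReg 33 _).setReg 32 _) with hs₂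
  have v₂ : s₂.reg 32 = k * regionSize w + i.eval σ := by
    simp only [hs₂, State.setReg_reg, if_true, Op.eval]
    simp [hk', hq, hm, v₁, Nat.mod_eq_of_lt hadr]
  have h₂ : Rep w s₂ σ := by
    refine hs.of_agree le_rfl (by simp [hs₂, m₁]) fun y hy => ?_
    simp [hs₂, hy.ne, (show y ≠ 33 by omega), r₁ y hy]
  obtain ⟨s₃, e₃, m₃, r₃, v₃⟩ := e.exec_compile h₂ (show 32 ≤ 33 by omega) he
  have h₃ := h₂.of_agree (show 32 ≤ 33 by omega) m₃ r₃
  refine ⟨_, _, _, e₁.seq (f₁.seq (f₂.seq (f₃.seq (e₃.seq (Exec.store w 32 33 s₃))))), ?_, ?_, h⟩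
  · rw [v₃, r₃ 32 (by omega), v₂]
    refine ⟨h₃.base, h₃.reg, fun k' hk' i' hi' => ?_⟩
    simp only [State.setMem_mem, Env.setMem_mem, h₃.mem k' hk' i' hi']
    by_cases hkk : k' = k
    · subst hkk
      by_cases hii : i' = i.eval σ
      · simp [hii]
      · simp [hii]
    · rw [if_neg (fun he => hkk (address_inj hi' hlt he).1), if_neg hkk]
  · simp only [Env.setMem_time]
    omega

theorem wp_ite {w : ℕ} {t : Cmp} {a b : Expr} {p q : Stmt} {Φ : Env → Prop} {σ : Env}
    (ha : a.Ok w σ) (hb : b.Ok w σ)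
    (hp : t.eval (a.eval σ) (b.eval σ) = true → wp w p.compile Φ (σ.tick (a.cost + b.cost + 3)))
    (hq : t.eval (a.eval σ) (b.eval σ) = false → wp w q.compile Φ (σ.tick (a.cost + b.cost + 3))) :
    wp w (Stmt.ite t a b p q).compile Φ σ := fun s hs => by
  obtain ⟨s₁, e₁, m₁, r₁, v₁⟩ := a.exec_compile hs le_rfl ha
  have h₁ : Rep w s₁ σ := hs.of_agree le_rfl m₁ r₁
  obtain ⟨s₂, e₂, m₂, r₂, v₂⟩ := b.exec_compile h₁ (show 32 ≤ 33 by omega) hb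
  have h₂ := h₁.of_agree (show 32 ≤ 33 by omega) m₂ r₂
  have key : ∃ s' σ' u, Exec w (if t.eval (a.eval σ) (b.eval σ) then p.compile else q.compile)
      s₂ s' u ∧ Rep w s' σ' ∧ (σ.tick (a.cost + b.cost + 3)).time + u ≤ σ'.time ∧ Φ σ' := by
    cases hc : t.eval (a.eval σ) (b.eval σ) with
    | true => exact hp hc s₂ (h₂.tick _)
    | false => exact hq hc s₂ (h₂.tick _)
  obtain ⟨s', σ', u, e₃, h₃, ht, hΦ⟩ := key
  have e₄ : Exec w (.branch t 32 33 p.compile q.compile) s₂ s' (u + 1) := fun l => by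
    refine .head (c₁ := ⟨(if t.eval (a.eval σ) (b.eval σ) then p.compile else q.compile) :: l, s₂⟩)
      (by simp) ?_ (e₃ l)
    rw [step, v₂, r₂ 32 (by omega), v₁]
  refine ⟨s', σ', _, e₁.seq (e₂.seq e₄), h₃, ?_, hΦ⟩
  simp only [Env.tick_time] at ht
  omega

theorem wp_skip {w : ℕ} {Φ : Env → Prop} {σ : Env} (h : Φ (σ.tick 1)) : wp w .skip Φ σ :=
  fun s hs => ⟨s, _, 1, fun _ => .single (by simp) rfl, hs.tick 1, le_rfl, h⟩

/-- A loop that is run `N` times and has the invariant `I`. -/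
theorem wp_loop {w : ℕ} {t : Cmp} {y z : ℕ} {p : Prog} {Φ : Env → Prop} {σ : Env} (N : ℕ)
    (I : ℕ → Env → Prop) (hy : y < 32) (hz : z < 32) (h0 : I 0 σ)
    (hstep : ∀ i < N, ∀ σ', I i σ' →
      t.eval (σ'.reg y) (σ'.reg z) = true ∧ wp w p (I (i + 1)) (σ'.tick 1))
    (hend : ∀ σ', I N σ' → t.eval (σ'.reg y) (σ'.reg z) = false ∧ Φ (σ'.tick 1)) :
    wp w (.loop t y z p) Φ σ := by
  -- Induction on the number `j` of iterations that remain.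
  suffices h : ∀ j ≤ N, ∀ σ', I (N - j) σ' → wp w (.loop t y z p) Φ σ' by
    refine h N le_rfl σ ?_
    rwa [Nat.sub_self]
  intro j
  induction j with
  | zero =>
    intro _ σ' hI s hs
    obtain ⟨h1, h2⟩ := hend σ' hI
    refine ⟨s, _, 1, fun l => .single (by simp) ?_, hs.tick 1, le_rfl, h2⟩
    simp [step, hs.reg y hy, hs.reg z hz, h1]
  | succ j ih =>
    intro hj σ' hI s hs
    obtain ⟨h1, h2⟩ := hstep _ (by omega) σ' hI
    obtain ⟨s₁, σ₁, t₁, e₁, r₁, ht₁, hI₁⟩ := h2 s (hs.tick 1)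
    rw [show N - (j + 1) + 1 = N - j by omega] at hI₁
    obtain ⟨s₂, σ₂, t₂, e₂, r₂, ht₂, hΦ⟩ := ih (by omega) σ₁ hI₁ s₁ r₁
    refine ⟨s₂, σ₂, t₁ + t₂ + 1, fun l => .head (c₁ := ⟨p :: .loop t y z p :: l, s⟩) (by simp) ?_
      ((e₁ _).trans (e₂ _)), r₂, ?_, hΦ⟩
    · simp [step, hs.reg y hy, hs.reg z hz, h1]
    · simp only [Env.tick_time] at ht₁
      omega

/-- The verification condition of a statement. -/
def Stmt.vc (w : ℕ) : Stmt → (Env → Prop) → Env → Prop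
  | .skip, Φ, σ => Φ (σ.tick 1)
  | .assign x e, Φ, σ =>
      (x ≠ 0 ∧ x < 32) ∧ e.Ok w σ ∧ Φ (σ.setReg x (e.eval σ) (e.cost + 2))
  | .put k i e, Φ, σ => k < 16 ∧ (i.Ok w σ ∧ i.eval σ < regionSize w) ∧ e.Ok w σ ∧
      Φ (σ.setMem k (i.eval σ) (e.eval σ) (i.cost + e.cost + 9))
  | .seq p q, Φ, σ => p.vc w (q.vc w Φ) (σ.tick 1)
  | .ite t a b p q, Φ, σ => (a.Ok w σ ∧ b.Ok w σ) ∧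
      (t.eval (a.eval σ) (b.eval σ) = true → p.vc w Φ (σ.tick (a.cost + b.cost + 3))) ∧
      (t.eval (a.eval σ) (b.eval σ) = false → q.vc w Φ (σ.tick (a.cost + b.cost + 3)))
  -- Loops carry no invariant in their syntax, so this goal is left to `wp_loop` with an explicit
  -- invariant and iteration count.
  | .loop t y z p, Φ, σ => wp w (Stmt.loop t y z p).compile Φ σ

theorem Stmt.wp_of_vc {w : ℕ} {p : Stmt} {Φ : Env → Prop} {σ : Env} (h : p.vc w Φ σ) :
    wp w p.compile Φ σ := by
  induction p generalizing Φ σ with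
  | skip => exact wp_skip h
  | assign x e => exact wp_assign h.1.1 h.2.1 h.2.2
  | put k i e => exact wp_put h.1 h.2.1.1 h.2.1.2 h.2.2.1 h.2.2.2
  | seq p q ihp ihq => exact wp_seq ((ihp h).mono fun σ' h' => ihq h')
  | ite t a b p q ihp ihq =>
    exact wp_ite h.1.1 h.1.2 (fun hc => ihp (h.2.1 hc)) (fun hc => ihq (h.2.2 hc))
  | loop t y z p => exact h

end WordRAM

/-! ### The cost over ordered pairs, and bad triples. -/

namespace NodeWeightedCC

section Cost

variable {V : Type*}

open Classical in
/-- The ordered pair `(u, v)` is a disagreement between `G` and the clustering `C`. -/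
def Disagree (G : SimpleGraph V) (C : Setoid V) (u v : V) : Prop :=
  u ≠ v ∧ (G.Adj u v ↔ ¬ C u v)

theorem mem_symmDiff_iff_disagree {G : SimpleGraph V} {C : Setoid V} {u v : V} :
    s(u, v) ∈ G.edgeSet ∆ (clusterGraph C).edgeSet ↔ Disagree G C u v := by
  rw [Set.mem_symmDiff, SimpleGraph.mem_edgeSet, SimpleGraph.mem_edgeSet]
  simp only [clusterGraph, Disagree]
  constructor
  · rintro (⟨h1, h2⟩ | ⟨⟨h1, h2⟩, h3⟩)
    · have := h1.ne
      exact ⟨this, by tauto⟩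
    · exact ⟨h1, by tauto⟩
  · rintro ⟨h1, h2⟩
    by_cases h : G.Adj u v
    · left; tauto
    · right; tauto

open Classical in
/-- The cost of the clustering `C` within `S`, every pair being counted twice. -/
noncomputable def pairCost (G : SimpleGraph V) (ω : V → ℕ+) (C : Setoid V) (S : Finset V) : ℝ≥0∞ :=
  ∑ u ∈ S, ∑ v ∈ S, if Disagree G C u v then ((ω u : ℕ) : ℝ≥0∞) * (ω v : ℕ) else 0

-- An unordered pair off the diagonal has exactly two ordered representatives, and `hP` excludes the
-- diagonal.
open Classical in
theorem sum_sym2_eq_sum_prod [Fintype V] (P : Sym2 V → Prop) (hP : ∀ u, ¬ P s(u, u))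
    (f : Sym2 V → ℕ) :
    (∑ u : V, ∑ v : V, if P s(u, v) then f s(u, v) else 0) = 2 * ∑ e : Sym2 V with P e, f e := by
  rw [← Finset.sum_product', Finset.univ_product_univ]
  have h1 : ∀ x ∈ (Finset.univ : Finset (V × V)), Sym2.mk x.1 x.2 ∈ (Finset.univ : Finset (Sym2 V)) :=
    fun _ _ => Finset.mem_univ _
  rw [← Finset.sum_fiberwise_of_maps_to h1, Finset.sum_filter, Finset.mul_sum]
  refine Finset.sum_congr rfl fun e _ => ?_
  induction e using Sym2.ind with
  | _ a b =>
    by_cases hp : P s(a, b)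
    · have hab : a ≠ b := by rintro rfl; exact hP a hp
      have : (Finset.univ.filter fun x : V × V => s(x.1, x.2) = s(a, b)) = {(a, b), (b, a)} := by
        ext ⟨x, y⟩
        simp
      rw [this, Finset.sum_pair (by simp [hab])]
      simp only [hp, if_true, Sym2.eq_swap (a := b)]
      ring
    · rw [if_neg hp, mul_zero]
      refine Finset.sum_eq_zero fun x hx => ?_
      rw [(Finset.mem_filter.1 hx).2, if_neg hp]

theorem two_mul_cost [Fintype V] (G : SimpleGraph V) (ω : V → ℕ+) (C : Setoid V) :
    2 * (cost G ω C : ℝ≥0∞) = pairCost G ω C Finset.univ := by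
  classical
  have := sum_sym2_eq_sum_prod (fun e => e ∈ G.edgeSet ∆ (clusterGraph C).edgeSet)
    (fun u h => (mem_symmDiff_iff_disagree.1 h).1 rfl) fun e => (e.map fun u => (ω u : ℕ)).mul
  rw [cost, pairCost]
  have h2 := congrArg (Nat.cast : ℕ → ℝ≥0∞) this
  rw [Nat.cast_mul] at h2
  refine h2.symm.trans ?_
  push_cast
  simp only [mem_symmDiff_iff_disagree]
  refine Finset.sum_congr rfl fun u _ => Finset.sum_congr rfl fun v _ => ?_
  by_cases h : Disagree G C u v
  · simp only [h, if_true, Sym2.map_mk, Sym2.mul_mk]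
    push_cast
    rfl
  · simp [h]

/-- Exactly two of the three pairs are edges of `G`. -/
def BadTriple (G : SimpleGraph V) (p u v : V) : Prop :=
  p ≠ u ∧ p ≠ v ∧ u ≠ v ∧ ((G.Adj p u ∧ G.Adj p v ∧ ¬ G.Adj u v) ∨
    (G.Adj p u ∧ ¬ G.Adj p v ∧ G.Adj u v) ∨ (¬ G.Adj p u ∧ G.Adj p v ∧ G.Adj u v))

theorem BadTriple.rotate {G : SimpleGraph V} {p u v : V} (h : BadTriple G p u v) :
    BadTriple G u v p := by
  obtain ⟨h1, h2, h3, h4⟩ := h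
  refine ⟨h3, h1.symm, h2.symm, ?_⟩
  rw [G.adj_comm u p, G.adj_comm v p]
  tauto

/-- Every clustering disagrees with a bad triple. -/
theorem BadTriple.disagree {G : SimpleGraph V} {p u v : V} (h : BadTriple G p u v)
    (C : Setoid V) : Disagree G C p u ∨ Disagree G C u v ∨ Disagree G C v p := by
  obtain ⟨h1, h2, h3, h4⟩ := h
  have key : ∀ {a b : V}, a ≠ b → ¬ Disagree G C a b → (G.Adj a b ↔ C a b) := fun hab hd => by
    simp only [Disagree, not_and] at hd
    have := hd hab
    tauto
  by_contra hc
  simp only [not_or] at hc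
  obtain ⟨c1, c2, c3⟩ := hc
  rw [key h1 c1, key h3 c2, G.adj_comm p v, key h2.symm c3] at h4
  -- If the clustering agreed with all three pairs, two joined pairs and one separated pair would
  -- violate transitivity.
  rcases h4 with ⟨a, b, c⟩ | ⟨a, b, c⟩ | ⟨a, b, c⟩
  · exact c (C.symm' (C.trans' b a))
  · exact b (C.symm' (C.trans' a c))
  · exact a (C.symm' (C.trans' c b))

-- Some pair of a bad triple is a disagreement. One of the three rotations moves it to the last two
-- places, and rotating changes neither the weight product nor the range of summation, so each
-- triple is charged to one of three equal sums.
open Classical in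
theorem sum_badTriple_le (G : SimpleGraph V) (ω : V → ℕ+) (C : Setoid V) (S : Finset V) :
    (∑ p ∈ S, ∑ u ∈ S, ∑ v ∈ S, if BadTriple G p u v then
        ((ω p : ℕ) : ℝ≥0∞) * ((ω u : ℕ) * (ω v : ℕ)) else 0) ≤
      3 * ∑ p ∈ S, ∑ u ∈ S, ∑ v ∈ S, if BadTriple G p u v ∧ Disagree G C u v then
        ((ω p : ℕ) : ℝ≥0∞) * ((ω u : ℕ) * (ω v : ℕ)) else 0 := by
  set F : V → V → V → ℝ≥0∞ := fun p u v => if BadTriple G p u v ∧ Disagree G C u v then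
        ((ω p : ℕ) : ℝ≥0∞) * ((ω u : ℕ) * (ω v : ℕ)) else 0 with hF
  have h1 : ∑ p ∈ S, ∑ u ∈ S, ∑ v ∈ S, F u v p = ∑ p ∈ S, ∑ u ∈ S, ∑ v ∈ S, F p u v := by
    rw [Finset.sum_comm]
    refine Finset.sum_congr rfl fun u _ => ?_
    rw [Finset.sum_comm]
  have h2 : ∑ p ∈ S, ∑ u ∈ S, ∑ v ∈ S, F v p u = ∑ p ∈ S, ∑ u ∈ S, ∑ v ∈ S, F p u v := by
    exact (Finset.sum_congr rfl fun p _ => Finset.sum_comm).trans Finset.sum_comm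
  calc _ ≤ ∑ p ∈ S, ∑ u ∈ S, ∑ v ∈ S, (F p u v + F u v p + F v p u) := by
        refine Finset.sum_le_sum fun p _ => Finset.sum_le_sum fun u _ =>
          Finset.sum_le_sum fun v _ => ?_
        by_cases h : BadTriple G p u v
        · have hr := h.rotate
          have hrr := hr.rotate
          rw [if_pos h]
          simp only [hF, h, hr, hrr, true_and]
          rcases h.disagree C with d | d | d
          · rw [if_pos d]
            refine le_trans (le_of_eq ?_) le_add_self
            ring
          · rw [if_pos d]
            exact le_add_right (le_add_right le_rfl)
          · rw [if_pos d]
            refine le_trans (le_of_eq ?_) (le_add_right le_add_self)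
            ring
        · rw [if_neg h]
          exact zero_le
    _ = _ := by
        simp only [Finset.sum_add_distrib, h1, h2]
        ring

end Cost

/-! ### The expected cost of the pivot procedure. -/

section Expectation

variable {V : Type*}

/-- The expectation of `h` at the labelling that the pivot procedure computes. -/
noncomputable def pivotExpect (G : SimpleGraph V) (ω : V → ℕ+) (S : Finset V)
    (h : (V → V) → ℝ≥0∞) : ℝ≥0∞ :=
  (pivotLabels G ω S).expect h

noncomputable def weight (ω : V → ℕ+) (S : Finset V) : ℝ≥0∞ := ∑ u ∈ S, ((ω u : ℕ) : ℝ≥0∞)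

theorem weight_ne_top (ω : V → ℕ+) (S : Finset V) : weight ω S ≠ ∞ := by
  simp [weight]

theorem weight_ne_zero (ω : V → ℕ+) {S : Finset V} (hS : S.Nonempty) : weight ω S ≠ 0 := by
  obtain ⟨a, ha⟩ := hS
  intro h
  have := Finset.sum_eq_zero_iff.1 h a ha
  simp at this

/-- Multiplying by the total weight removes the normalization, so that all later estimates are free
of division. -/
theorem weight_mul_expect_weightedSample (ω : V → ℕ+) (S : Finset V) (hS : S.Nonempty)
    (h : V → ℝ≥0∞) :
    weight ω S * (weightedSample ω S hS).expect (fun u => h u) = ∑ u ∈ S, (ω u : ℕ) * h u := by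
  have hw : (∑' u : S, ((ω u : ℕ) : ℝ≥0∞)) = weight ω S := by
    rw [tsum_fintype, weight, ← Finset.sum_coe_sort S]
  rw [PMF.expect, tsum_fintype, Finset.mul_sum, ← Finset.sum_coe_sort S]
  refine Finset.sum_congr rfl fun u _ => ?_
  rw [weightedSample, PMF.normalize_apply, hw]
  rw [mul_comm (((ω u : ℕ) : ℝ≥0∞)), mul_assoc, ← mul_assoc, ENNReal.mul_inv_cancel
    (weight_ne_zero ω hS) (weight_ne_top ω S), one_mul]

theorem pivotExpect_empty (G : SimpleGraph V) (ω : V → ℕ+) (h : (V → V) → ℝ≥0∞) :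
    pivotExpect G ω ∅ h = h id := by
  rw [pivotExpect, pivotLabels, dif_neg (by simp), PMF.expect_pure]

open Classical in
theorem weight_mul_pivotExpect (G : SimpleGraph V) (ω : V → ℕ+) (S : Finset V)
    (h : (V → V) → ℝ≥0∞) : weight ω S * pivotExpect G ω S h = ∑ u ∈ S, (ω u : ℕ) *
      pivotExpect G ω (S \ pivotCluster G S u)
        (fun f => h fun v => if v ∈ pivotCluster G S u then u else f v) := by
  by_cases hS : S.Nonempty
  · rw [← weight_mul_expect_weightedSample ω S hS, pivotExpect, pivotLabels, dif_pos hS,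
      PMF.expect_bind]
    simp only [PMF.expect_map]
    rfl
  · rw [Finset.not_nonempty_iff_eq_empty] at hS
    subst hS
    simp [weight]

theorem pivotCluster_subset (G : SimpleGraph V) (S : Finset V) (u : V) :
    pivotCluster G S u ⊆ S := by
  classical
  exact Finset.filter_subset _ _

theorem mem_pivotCluster {G : SimpleGraph V} {S : Finset V} {u v : V} :
    v ∈ pivotCluster G S u ↔ v ∈ S ∧ (v = u ∨ G.Adj u v) := by
  classical
  exact Finset.mem_filter

open Classical in
theorem sdiff_pivotCluster_ssubset (G : SimpleGraph V) {S : Finset V} {u : V} (hu : u ∈ S) :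
    S \ pivotCluster G S u ⊂ S :=
  Finset.sdiff_ssubset (pivotCluster_subset G S u) ⟨u, mem_pivotCluster.2 ⟨hu, Or.inl rfl⟩⟩

-- Needed to know that a later label never coincides with the current pivot, which lies outside the
-- remaining set.
open Classical in
theorem pivotLabels_mapsTo (G : SimpleGraph V) (ω : V → ℕ+) (S : Finset V) {f : V → V}
    (hf : f ∈ (pivotLabels G ω S).support) {v : V} (hv : v ∈ S) : f v ∈ S := by
  induction S using Finset.strongInduction generalizing f with
  | H S ih =>
    rw [pivotLabels, dif_pos ⟨v, hv⟩, PMF.mem_support_bind_iff] at hf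
    obtain ⟨u, _, hf⟩ := hf
    rw [PMF.mem_support_map_iff] at hf
    obtain ⟨f', hf', rfl⟩ := hf
    dsimp only
    split_ifs with h
    · exact u.2
    · have hv' : v ∈ S \ pivotCluster G S u := Finset.mem_sdiff.2 ⟨hv, h⟩
      exact (Finset.mem_sdiff.1 (ih _ (sdiff_pivotCluster_ssubset G u.2) hf' hv')).1

theorem pivotExpect_mono (G : SimpleGraph V) (ω : V → ℕ+) (S : Finset V)
    {h k : (V → V) → ℝ≥0∞} (hk : ∀ f, (∀ v ∈ S, f v ∈ S) → h f ≤ k f) :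
    pivotExpect G ω S h ≤ pivotExpect G ω S k := by
  refine ENNReal.tsum_le_tsum fun f => ?_
  by_cases hf : f ∈ (pivotLabels G ω S).support
  · gcongr
    exact hk f fun v hv => pivotLabels_mapsTo G ω S hf hv
  · rw [PMF.mem_support_iff, not_not] at hf
    simp [hf]

theorem BadTriple.adj_or_adj {G : SimpleGraph V} {p u v : V} (h : BadTriple G p u v) :
    G.Adj p u ∨ G.Adj p v := by
  obtain ⟨_, _, _, h⟩ := h
  tauto

-- A pair that meets the cluster of `u` is wrong in only two ways: both nodes are neighbors of `u`
-- without being adjacent, or exactly one is in the cluster and they are adjacent. Both make a bad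
-- triple with `u`.
open Classical in
theorem disagree_ker_glue {G : SimpleGraph V} {S : Finset V} {u a b : V}
    (ha : a ∈ S) (hb : b ∈ S) {f : V → V}
    (hf : ∀ v ∈ S \ pivotCluster G S u, f v ∈ S \ pivotCluster G S u) (hu : u ∈ S)
    (h : Disagree G (Setoid.ker fun v => if v ∈ pivotCluster G S u then u else f v) a b) :
    BadTriple G u a b ∨ (a ∈ S \ pivotCluster G S u ∧ b ∈ S \ pivotCluster G S u ∧
      Disagree G (Setoid.ker f) a b) := by
  have hne : ∀ v ∈ S, v ∉ pivotCluster G S u → f v ≠ u := fun v hv hvc hfv => by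
    have := hf v (Finset.mem_sdiff.2 ⟨hv, hvc⟩)
    rw [hfv] at this
    exact (Finset.mem_sdiff.1 this).2 (mem_pivotCluster.2 ⟨hu, Or.inl rfl⟩)
  obtain ⟨hab, h⟩ := h
  simp only [Setoid.ker_def] at h
  by_cases hac : a ∈ pivotCluster G S u <;> by_cases hbc : b ∈ pivotCluster G S u
  · left
    simp only [hac, hbc, if_true, not_true, iff_false] at h
    have h1 := (mem_pivotCluster.1 hac).2
    have h2 := (mem_pivotCluster.1 hbc).2
    have h1 : G.Adj u a := by
      rcases h1 with rfl | h1
      · rcases h2 with rfl | h2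
        · exact absurd rfl hab
        · exact absurd h2 h
      · exact h1
    have h2 : G.Adj u b := by
      rcases h2 with rfl | h2
      · exact absurd h1.symm h
      · exact h2
    exact ⟨h1.ne, h2.ne, hab, Or.inl ⟨h1, h2, h⟩⟩
  · left
    simp only [hac, hbc, if_true, if_false] at h
    have h3 : G.Adj a b := h.2 fun he => hne b hb hbc he.symm
    have h2 : b ≠ u ∧ ¬ G.Adj u b := by
      rw [mem_pivotCluster, not_and, not_or] at hbc
      exact hbc hb
    have h1 : G.Adj u a := by
      rcases (mem_pivotCluster.1 hac).2 with rfl | h1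
      · exact absurd h3 h2.2
      · exact h1
    exact ⟨h1.ne, h2.1.symm, hab, Or.inr (Or.inl ⟨h1, h2.2, h3⟩)⟩
  · left
    simp only [hac, hbc, if_true, if_false] at h
    have h3 : G.Adj a b := h.2 fun he => hne a ha hac he
    have h2 : a ≠ u ∧ ¬ G.Adj u a := by
      rw [mem_pivotCluster, not_and, not_or] at hac
      exact hac ha
    have h1 : G.Adj u b := by
      rcases (mem_pivotCluster.1 hbc).2 with rfl | h1
      · exact absurd h3.symm h2.2
      · exact h1
    exact ⟨h2.1.symm, h1.ne, hab, Or.inr (Or.inr ⟨h2.2, h1, h3⟩)⟩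
  · right
    simp only [hac, hbc, if_false] at h
    exact ⟨Finset.mem_sdiff.2 ⟨ha, hac⟩, Finset.mem_sdiff.2 ⟨hb, hbc⟩, hab, h⟩

open Classical in
theorem pairCost_eq_sum_ite (G : SimpleGraph V) (ω : V → ℕ+) (C : Setoid V) {S T : Finset V}
    (hT : T ⊆ S) : pairCost G ω C T = ∑ a ∈ S, ∑ b ∈ S,
      if a ∈ T ∧ b ∈ T ∧ Disagree G C a b then ((ω a : ℕ) : ℝ≥0∞) * (ω b : ℕ) else 0 := by
  rw [pairCost, ← Finset.sum_subset hT]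
  · refine Finset.sum_congr rfl fun a ha => ?_
    rw [← Finset.sum_subset hT]
    · refine Finset.sum_congr rfl fun b hb => ?_
      simp [ha, hb]
    · intro b _ hb
      simp [hb]
  · intro a _ ha
    simp [ha]

open Classical in
theorem pairCost_ker_glue_le {G : SimpleGraph V} (ω : V → ℕ+) {S : Finset V} {u : V} {f : V → V}
    (hf : ∀ v ∈ S \ pivotCluster G S u, f v ∈ S \ pivotCluster G S u) (hu : u ∈ S) :
    pairCost G ω (Setoid.ker fun v => if v ∈ pivotCluster G S u then u else f v) S ≤
      (∑ a ∈ S, ∑ b ∈ S, if BadTriple G u a b then ((ω a : ℕ) : ℝ≥0∞) * (ω b : ℕ) else 0) +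
      pairCost G ω (Setoid.ker f) (S \ pivotCluster G S u) := by
  rw [pairCost_eq_sum_ite G ω (Setoid.ker f) Finset.sdiff_subset, pairCost]
  simp only [← Finset.sum_add_distrib]
  refine Finset.sum_le_sum fun a ha => Finset.sum_le_sum fun b hb => ?_
  split_ifs with h1 h2 h3 h3 h4
  all_goals first
    | exact zero_le
    | exact le_add_right le_rfl
    | exact le_add_left le_rfl
    | exact absurd (disagree_ker_glue ha hb hf hu h1) (by tauto)

-- A bad triple with pivot `u` contains an edge at `u`, so one of `a` and `b` enters the cluster.
-- The charged pairs are therefore disjoint from the pairs that remain.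
open Classical in
theorem pairCost_sdiff_add_le (G : SimpleGraph V) (ω : V → ℕ+) (C : Setoid V) (S : Finset V)
    (u : V) : (∑ a ∈ S, ∑ b ∈ S, if BadTriple G u a b ∧ Disagree G C a b then
        ((ω a : ℕ) : ℝ≥0∞) * (ω b : ℕ) else 0) + pairCost G ω C (S \ pivotCluster G S u) ≤
      pairCost G ω C S := by
  rw [pairCost_eq_sum_ite G ω C Finset.sdiff_subset, pairCost]
  simp only [← Finset.sum_add_distrib]
  refine Finset.sum_le_sum fun a ha => Finset.sum_le_sum fun b hb => ?_
  by_cases hd : Disagree G C a b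
  · by_cases hb' : BadTriple G u a b
    · have hn : ¬ (a ∈ S \ pivotCluster G S u ∧ b ∈ S \ pivotCluster G S u) := by
        rintro ⟨h1, h2⟩
        rcases hb'.adj_or_adj with h | h
        · exact (Finset.mem_sdiff.1 h1).2 (mem_pivotCluster.2 ⟨ha, Or.inr h⟩)
        · exact (Finset.mem_sdiff.1 h2).2 (mem_pivotCluster.2 ⟨hb, Or.inr h⟩)
      rw [if_pos ⟨hb', hd⟩, if_neg (fun h => hn ⟨h.1, h.2.1⟩), if_pos hd, add_zero]
    · rw [if_neg (fun h => hb' h.1), if_pos hd, zero_add]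
      split_ifs
      · exact le_rfl
      · exact zero_le
  · simp [hd]

/-- The pivot procedure is a 3-approximation in expectation. -/
theorem pivotExpect_pairCost_le (G : SimpleGraph V) (ω : V → ℕ+) (C : Setoid V) (S : Finset V) :
    pivotExpect G ω S (fun f => pairCost G ω (Setoid.ker f) S) ≤ 3 * pairCost G ω C S := by
  classical
  induction S using Finset.strongInduction with
  | H S ih =>
    rcases S.eq_empty_or_nonempty with rfl | hS
    · rw [pivotExpect_empty]
      simp [pairCost]
    refine (ENNReal.mul_le_mul_iff_right (weight_ne_zero ω hS) (weight_ne_top ω S)).1 ?_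
    rw [weight_mul_pivotExpect]
    -- `I u` bounds the cost of the round with pivot `u`, and `J u` is what `C` pays for the same
    -- triples. The factor `3` arises only after averaging over `u`, in `hIJ`.
    set I : V → ℝ≥0∞ := fun u => ∑ a ∈ S, ∑ b ∈ S,
      if BadTriple G u a b then ((ω a : ℕ) : ℝ≥0∞) * (ω b : ℕ) else 0 with hI
    set J : V → ℝ≥0∞ := fun u => ∑ a ∈ S, ∑ b ∈ S,
      if BadTriple G u a b ∧ Disagree G C a b then ((ω a : ℕ) : ℝ≥0∞) * (ω b : ℕ) else 0 with hJ
    have hIJ : ∑ u ∈ S, ((ω u : ℕ) : ℝ≥0∞) * I u ≤ 3 * ∑ u ∈ S, ((ω u : ℕ) : ℝ≥0∞) * J u := by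
      have := sum_badTriple_le G ω C S
      simp only [hI, hJ, Finset.mul_sum, mul_ite, mul_zero] at this ⊢
      exact this
    calc _ ≤ ∑ u ∈ S, ((ω u : ℕ) : ℝ≥0∞) *
          (I u + 3 * pairCost G ω C (S \ pivotCluster G S u)) := by
          refine Finset.sum_le_sum fun u hu => ?_
          gcongr
          calc _ ≤ pivotExpect G ω (S \ pivotCluster G S u) fun f =>
                I u + pairCost G ω (Setoid.ker f) (S \ pivotCluster G S u) :=
                pivotExpect_mono G ω _ fun f hf => pairCost_ker_glue_le ω hf hu
            _ ≤ _ := by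
                rw [pivotExpect, PMF.expect_add, PMF.expect_const]
                gcongr
                exact ih _ (sdiff_pivotCluster_ssubset G hu)
      _ ≤ 3 * ∑ u ∈ S, ((ω u : ℕ) : ℝ≥0∞) * J u + ∑ u ∈ S, ((ω u : ℕ) : ℝ≥0∞) *
          (3 * pairCost G ω C (S \ pivotCluster G S u)) := by
          simp only [mul_add, Finset.sum_add_distrib]
          gcongr
      _ = ∑ u ∈ S, ((ω u : ℕ) : ℝ≥0∞) *
          (3 * (J u + pairCost G ω C (S \ pivotCluster G S u))) := by
          rw [Finset.mul_sum, ← Finset.sum_add_distrib]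
          refine Finset.sum_congr rfl fun u _ => ?_
          ring
      _ ≤ ∑ u ∈ S, ((ω u : ℕ) : ℝ≥0∞) * (3 * pairCost G ω C S) := by
          refine Finset.sum_le_sum fun u _ => ?_
          gcongr
          exact pairCost_sdiff_add_le G ω C S u
      _ = _ := by rw [← Finset.sum_mul, weight]

theorem expect_cost_pivotClustering_le [Fintype V] (G : SimpleGraph V) (ω : V → ℕ+) :
    (pivotClustering G ω).expect (fun C => (cost G ω C : ℝ≥0∞)) ≤ 3 * (opt G ω : ℝ≥0∞) := by
  obtain ⟨C, hC⟩ : ∃ C, cost G ω C = opt G ω := ciInf_mem (cost G ω)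
  rw [← hC, pivotClustering, PMF.expect_map,
    ← ENNReal.mul_le_mul_iff_right two_ne_zero ENNReal.ofNat_ne_top, mul_left_comm, two_mul_cost,
    ← PMF.expect_mul_left]
  simp only [two_mul_cost]
  exact pivotExpect_pairCost_le G ω C Finset.univ

end Expectation

end NodeWeightedCC

/-! ## The program

The nodes are kept in buckets according to `capacity`, an upper bound on the weight that is tight up
to a factor of two and takes few different values. Each bucket owns a number of slots that is
roughly proportional to its total capacity, so that a random node is found by rejection sampling.

Regions: `0` the input, `1` powers of two, `2` starts of the adjacency lists, `3` the list of
capacities, `4` the numbers of nodes in the buckets, `5` the nodes in the buckets, `6` the buckets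
of the slots, `7` the first positions of the buckets of the slots, `8` labels (`0` for unclustered
nodes).

Variables: `2` is `n`, `3` is `n + 1`, `6` is the total capacity, `7` the number of buckets, `11` the
total capacity for which the slots have been made, `12` the width of a slot, `13` the number of
slots, `18` the number of random words per position, `19` the random word, `30` the largest
word, `31` is zero. -/

namespace WordRAM

namespace PivotProgram

open WordRAM.Expr WordRAM.Stmt

/-- Tabulate the powers of two. -/
def powersLoop : Stmt :=
  loop .lt 4 3 <|
    seq (put 1 (var 4)
      (bin .add (get 1 (bin .div (var 4) (lit 2))) (get 1 (bin .div (var 4) (lit 2))))) <|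
    assign 4 (bin .add (var 4) (lit 1))

/-- Split off the powers of `n + 1` from a weight. -/
def digitLoop : Stmt :=
  loop .le 3 8 <|
    seq (assign 8 (bin .div (var 8) (var 3))) <|
    assign 9 (bin .mul (var 9) (var 3))

/-- Put the node with number `var 4` into its bucket. -/
def insertNode : Stmt :=
  seq (assign 10 (bin .mul (get 1 (var 8)) (var 9))) <|
  seq (assign 17 (get 4 (var 10))) <|
  seq (ite .eq (var 17) (lit 0)
    (seq (put 3 (var 7) (var 10)) (assign 7 (bin .add (var 7) (lit 1)))) skip) <|
  seq (put 5 (bin .add (bin .mul (var 10) (var 2)) (var 17)) (var 4)) <|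
  seq (put 4 (var 10) (bin .add (var 17) (lit 1))) <|
  seq (assign 6 (bin .add (var 6) (var 10))) <|
  assign 4 (bin .add (var 4) (lit 1))

/-- After `digitLoop`, variable `8` holds the leading digit of the weight in base `n + 1`. It is at
most `n`, so the table of powers of two covers it and the capacity is found in time `O(d)`, without
a search of length `log n`. -/
def nodesLoop : Stmt :=
  loop .lt 4 2 <|
    seq (put 2 (var 4) (var 5)) <|
    seq (assign 5 (bin .add (var 5) (get 0 (bin .add (var 3) (var 4))))) <|
    seq (assign 8 (get 0 (bin .add (lit 1) (var 4)))) <|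
    seq (assign 9 (lit 1)) <|
    seq digitLoop insertNode

def init : Stmt :=
  seq (assign 2 (get 0 (lit 0))) <|
  seq (assign 3 (bin .add (var 2) (lit 1))) <|
  seq (put 1 (lit 0) (lit 1)) <|
  seq (assign 4 (lit 1)) <|
  seq powersLoop <|
  seq (assign 5 (bin .add (bin .add (var 2) (var 2)) (lit 1))) <|
  seq (assign 4 (lit 0)) <|
  seq (assign 6 (lit 0)) <|
  seq (assign 7 (lit 0)) <|
  seq nodesLoop <|
  -- This value makes the first `refresh` build the slots, which do not exist yet.
  assign 11 (bin .add (bin .add (var 6) (var 6)) (lit 1))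

/-- Make the slots of one bucket. -/
def slotLoop : Stmt :=
  loop .lt 16 17 <|
    seq (put 6 (var 13) (var 10)) <|
    seq (put 7 (var 13) (var 15)) <|
    seq (assign 13 (bin .add (var 13) (lit 1))) <|
    assign 16 (bin .add (var 16) (var 12))

/-- A bucket receives its total capacity divided by the slot width, rounded up, as its number of
slots. Variable `15` is the first position of the bucket. -/
def bucketLoop : Stmt :=
  loop .lt 14 7 <|
    seq (assign 10 (get 3 (var 14))) <|
    seq (assign 17 (bin .mul (get 4 (var 10)) (var 10))) <|
    seq (assign 15 (bin .mul (var 13) (var 12))) <|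
    seq (assign 16 (lit 0)) <|
    seq slotLoop <|
    assign 14 (bin .add (var 14) (lit 1))

/-- Make new slots. -/
def rebuild : Stmt :=
  seq (assign 11 (var 6)) <|
  seq (assign 12 (bin .add (bin .div (var 6) (var 7)) (lit 1))) <|
  seq (assign 13 (lit 0)) <|
  seq (assign 14 (lit 0)) <|
  seq bucketLoop <|
  assign 18 (bin .div (var 30) (bin .mul (var 13) (var 12)))

/-- Make new slots if the total capacity has dropped by a factor of two. -/
def refresh : Stmt := ite .lt (bin .add (var 6) (var 6)) (var 11) rebuild skip

/-- Label the unlabelled neighbors of the node `var 23`. -/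
def neighborLoop : Stmt :=
  loop .lt 24 25 <|
    seq (assign 27 (get 0 (var 24))) <|
    seq (ite .eq (get 8 (var 27)) (lit 0) (put 8 (var 27) (bin .add (var 23) (lit 1))) skip) <|
    assign 24 (bin .add (var 24) (lit 1))

/-- If the node `var 23` is unclustered, make it a pivot. -/
def makePivot : Stmt :=
  ite .eq (get 8 (var 23)) (lit 0)
    (seq (put 8 (var 23) (bin .add (var 23) (lit 1))) <|
     seq (assign 24 (get 2 (var 23))) <|
     seq (assign 25 (bin .add (var 24) (get 0 (bin .add (var 3) (var 23))))) <|
     neighborLoop) skip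

/-- Remove the node `var 23` from its bucket. -/
def removeNode : Stmt :=
  seq (assign 17 (bin .sub (var 17) (lit 1))) <|
  seq (put 4 (var 10) (var 17)) <|
  seq (put 5 (bin .add (bin .mul (var 10) (var 2)) (var 22))
    (get 5 (bin .add (bin .mul (var 10) (var 2)) (var 17)))) <|
  assign 6 (bin .sub (var 6) (var 10))

/-- Process the random word `var 19`. -/
def attempt : Stmt :=
  seq (assign 20 (bin .div (var 19) (var 18))) <|
  seq (assign 21 (bin .div (var 20) (var 12))) <|
  ite .lt (var 21) (var 13)
    (seq (assign 10 (get 6 (var 21))) <|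
     seq (assign 26 (bin .sub (var 20) (get 7 (var 21)))) <|
     seq (assign 22 (bin .div (var 26) (var 10))) <|
     seq (assign 17 (get 4 (var 10))) <|
     ite .lt (var 22) (var 17)
       (seq (assign 23 (get 5 (bin .add (bin .mul (var 10) (var 2)) (var 22)))) <|
        -- A node owns as many consecutive positions as its capacity, and only the first `ω` of them
        -- are accepted.
        ite .lt (bin .mod (var 26) (var 10)) (get 0 (bin .add (lit 1) (var 23)))
          -- The node is removed even if it already has a label, so each node is drawn at most once.
          (seq removeNode makePivot) skip) skip) skip

/-- Copy the labels to the output. -/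
def output : Stmt :=
  seq (assign 4 (lit 0)) <|
  loop .lt 4 2 <|
    seq (put 0 (var 4) (get 8 (var 4))) <|
    assign 4 (bin .add (var 4) (lit 1))

def setup : Prog :=
  .seq (.const 1 1) <| .seq (.op 30 .sub 31 1) <| .seq (.const 1 16) (.op 0 .div 30 1)

def mainLoop : Prog :=
  .loop .ne 6 31 <| .seq refresh.compile <| .seq (.rand 19) attempt.compile

end PivotProgram

open PivotProgram in
/-- The weighted pivot procedure. -/
def pivotProgram : Prog :=
  .seq setup <| .seq init.compile <| .seq mainLoop output.compile

/-! ## Capacities -/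

/-- An upper bound on `x` that is tight up to a factor of two: a power of two times a power of
`n + 1`. -/
def capacity (n x : ℕ) : ℕ :=
  2 ^ (Nat.log 2 (x / (n + 1) ^ Nat.log (n + 1) x) + 1) * (n + 1) ^ Nat.log (n + 1) x

theorem lt_capacity (n x : ℕ) : x < capacity n x := by
  have h := Nat.lt_pow_succ_log_self (b := 2) (by norm_num) (x / (n + 1) ^ Nat.log (n + 1) x)
  have hp : 0 < (n + 1) ^ Nat.log (n + 1) x := by positivity
  exact (Nat.div_lt_iff_lt_mul hp).1 h

theorem capacity_le (n : ℕ) {x : ℕ} (hx : x ≠ 0) : capacity n x ≤ 2 * x := by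
  have hp : 0 < (n + 1) ^ Nat.log (n + 1) x := by positivity
  have h0 : x / (n + 1) ^ Nat.log (n + 1) x ≠ 0 :=
    (Nat.div_pos (Nat.pow_log_le_self _ hx) hp).ne'
  have h := Nat.pow_log_le_self 2 h0
  have h' := (Nat.le_div_iff_mul_le hp).1 h
  rw [capacity, pow_succ, mul_comm _ 2, mul_assoc]
  omega

theorem capacity_pos (n x : ℕ) : 0 < capacity n x := (Nat.zero_le x).trans_lt (lt_capacity n x)

open NodeWeightedCC

/-! ### Invariants of the data structure. -/

section Invariants

variable {n : ℕ} (ω : Fin n → ℕ+) (adj : Fin n → List (Fin n))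

/-- The capacity of a node. -/
def cap (u : Fin n) : ℕ := capacity n (ω u)

/-- The address of the adjacency list of `u`. -/
def listStart (u : ℕ) : ℕ :=
  2 * n + 1 + ∑ v : Fin n with v.val < u, (adj v).length

/-- The total capacity. -/
def total (D : Finset (Fin n)) : ℕ := ∑ v ∈ D, cap ω v

/-- The number of nodes in a bucket. -/
def bucketSize (D : Finset (Fin n)) (c : ℕ) : ℕ := (D.filter fun v => cap ω v = c).card

/-- The capacities that occur. -/
def capacities : Finset ℕ := Finset.univ.image (cap ω)

/-- The words are large enough. -/
structure Fits (w B : ℕ) : Prop where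
  pos : 1 ≤ n
  -- The bucket of capacity `c` occupies the cells from `c * n` on, which explains the product.
  total_mul_le : total ω Finset.univ * (n + 1) ≤ B
  listStart_le : listStart adj n ≤ B
  le_region : 4 * B + 20 ≤ regionSize w

/-- The nodes of `D` are in the buckets, at the positions `pos`; the labels are `lab`. -/
structure Core (w : ℕ) (D : Finset (Fin n)) (lab : Fin n → ℕ) (pos : Fin n → ℕ) (σ : Env) :
    Prop where
  reg_n : σ.reg 2 = n
  reg_n1 : σ.reg 3 = n + 1
  reg_max : σ.reg 30 = 2 ^ w - 1
  reg_zero : σ.reg 31 = 0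
  reg_total : σ.reg 6 = total ω D
  reg_buckets : σ.reg 7 = (capacities ω).card
  weight : ∀ u : Fin n, σ.mem 0 (1 + u) = ω u
  degree : ∀ u : Fin n, σ.mem 0 (n + 1 + u) = (adj u).length
  neighbor : ∀ (u : Fin n) (j : ℕ) (h : j < (adj u).length),
    σ.mem 0 (listStart adj u + j) = (adj u)[j]
  listStart : ∀ u : Fin n, σ.mem 2 u = listStart adj u
  capacities : (Finset.range (capacities ω).card).image (σ.mem 3) = capacities ω
  bucketSize : ∀ c, σ.mem 4 c = bucketSize ω D c
  pos_lt : ∀ v ∈ D, pos v < WordRAM.bucketSize ω D (cap ω v)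
  bucket : ∀ v ∈ D, σ.mem 5 (cap ω v * n + pos v) = v
  -- Together with `pos_lt` and `bucket`, `pos` is a bijection from each bucket onto an initial
  -- segment.
  exists_pos : ∀ c j, j < WordRAM.bucketSize ω D c → ∃ v ∈ D, cap ω v = c ∧ pos v = j
  label : ∀ u : Fin n, σ.mem 8 u = lab u

/-- The slots have been made at a time when the total capacity was `U`. -/
structure Slots (w : ℕ) (D : Finset (Fin n)) (U : ℕ) (start : ℕ → ℕ) (σ : Env) : Prop where
  reg_total : σ.reg 11 = U
  width_pos : 0 < σ.reg 12
  mul_le : σ.reg 13 * σ.reg 12 ≤ 2 * U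
  words : σ.reg 18 = (2 ^ w - 1) / (σ.reg 13 * σ.reg 12)
  start_eq : ∀ s < σ.reg 13, σ.mem 7 s = start (σ.mem 6 s) * σ.reg 12 ∧ start (σ.mem 6 s) ≤ s
  slot : ∀ c p, p < bucketSize ω D c * c →
    start c + p / σ.reg 12 < σ.reg 13 ∧ σ.mem 6 (start c + p / σ.reg 12) = c
  mem_capacities : ∀ s < σ.reg 13, σ.mem 6 s ∈ capacities ω

/-- The labels after `v` has become a pivot. -/
def pivotLab (lab : Fin n → ℕ) (v : Fin n) (u : Fin n) : ℕ :=
  if lab u = 0 ∧ (u = v ∨ u ∈ adj v) then (v : ℕ) + 1 else lab u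

end Invariants

end WordRAM

namespace WordRAM

/-! ### Sizes of buckets, addresses and words. -/

section Bounds

variable {n w B : ℕ} {ω : Fin n → ℕ+} {adj : Fin n → List (Fin n)}

theorem total_mono {D D' : Finset (Fin n)} (h : D ⊆ D') : total ω D ≤ total ω D' :=
  Finset.sum_le_sum_of_subset h

theorem cap_le_total (ω : Fin n → ℕ+) (u : Fin n) : cap ω u ≤ total ω Finset.univ :=
  Finset.single_le_sum (f := cap ω) (fun _ _ => Nat.zero_le _) (Finset.mem_univ u)

theorem cap_pos (ω : Fin n → ℕ+) (u : Fin n) : 0 < cap ω u := capacity_pos _ _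

theorem le_total_univ (ω : Fin n → ℕ+) : n ≤ total ω Finset.univ := by
  calc n = ∑ _u : Fin n, 1 := by simp
    _ ≤ _ := Finset.sum_le_sum fun u _ => cap_pos ω u

theorem bucketSize_mul_le (D : Finset (Fin n)) (c : ℕ) : bucketSize ω D c * c ≤ total ω D := by
  rw [bucketSize, ← smul_eq_mul, ← Finset.sum_const]
  calc _ = ∑ v ∈ D with cap ω v = c, cap ω v :=
        Finset.sum_congr rfl fun v hv => (Finset.mem_filter.1 hv).2.symm
    _ ≤ _ := Finset.sum_le_sum_of_subset (Finset.filter_subset _ _)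

theorem bucketSize_le (D : Finset (Fin n)) (c : ℕ) : bucketSize ω D c ≤ n :=
  (Finset.card_le_univ _).trans (by simp)

theorem bucketSize_mono {D D' : Finset (Fin n)} (h : D ⊆ D') (c : ℕ) :
    bucketSize ω D c ≤ bucketSize ω D' c :=
  Finset.card_le_card (Finset.filter_subset_filter _ h)

theorem sum_bucketSize_mul (D : Finset (Fin n)) :
    ∑ c ∈ capacities ω, bucketSize ω D c * c = total ω D := by
  rw [total, ← Finset.sum_fiberwise_of_maps_to (t := capacities ω) (g := cap ω)]
  · refine Finset.sum_congr rfl fun c _ => ?_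
    rw [bucketSize, ← smul_eq_mul, ← Finset.sum_const]
    exact Finset.sum_congr rfl fun v hv => (Finset.mem_filter.1 hv).2.symm
  · exact fun v _ => Finset.mem_image_of_mem _ (Finset.mem_univ v)

theorem card_capacities_le (ω : Fin n → ℕ+) : (capacities ω).card ≤ n :=
  Finset.card_image_le.trans (by simp)

theorem listStart_succ (adj : Fin n → List (Fin n)) (u : Fin n) :
    listStart adj (u + 1) = listStart adj u + (adj u).length := by
  have : (Finset.univ.filter fun v : Fin n => v.val < u.val + 1) =
      insert u (Finset.univ.filter fun v : Fin n => v.val < u.val) := by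
    ext v
    simp only [Finset.mem_filter, Finset.mem_univ, true_and, Finset.mem_insert, Fin.ext_iff]
    omega
  rw [listStart, this, Finset.sum_insert (by simp), listStart]
  omega

theorem listStart_mono (adj : Fin n → List (Fin n)) : Monotone (listStart adj) := fun a b h => by
  rw [listStart, listStart]
  gcongr with v

theorem listStart_add_le (adj : Fin n → List (Fin n)) (u : Fin n) :
    listStart adj u + (adj u).length ≤ listStart adj n := by
  rw [← listStart_succ]
  exact listStart_mono adj u.isLt

theorem two_mul_lt_listStart (adj : Fin n → List (Fin n)) (u : ℕ) : 2 * n < listStart adj u := by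
  rw [listStart]
  omega

theorem Fits.total_lt (h : Fits ω adj w B) : total ω Finset.univ + n ≤ B := by
  have h1 := h.total_mul_le
  have h2 := h.pos
  have h3 := le_total_univ ω
  nlinarith

theorem Fits.index_lt (h : Fits ω adj w B) {c j : ℕ} (hc : c ∈ capacities ω) (hj : j ≤ n) :
    c * n + j ≤ B := by
  obtain ⟨u, _, rfl⟩ := Finset.mem_image.1 hc
  have h1 := h.total_mul_le
  have h3 := le_total_univ ω
  have h4 := cap_le_total ω u
  nlinarith

theorem Fits.lt_pow (h : Fits ω adj w B) : 16 * (4 * B + 20) < 2 ^ w := by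
  have := sixteen_mul_regionSize_lt w
  have := h.le_region
  omega

theorem Fits.word_ne_zero (h : Fits ω adj w B) : w ≠ 0 := by
  rintro rfl
  have := h.lt_pow
  omega

end Bounds

/-! ### Removing a node and making a pivot. -/

section Verification

variable {n w B : ℕ} {ω : Fin n → ℕ+} {adj : Fin n → List (Fin n)}

open PivotProgram

theorem neighborLoop_spec (hF : Fits ω adj w B) {σ : Env} {v : Fin n} {lab : Fin n → ℕ}
    (h23 : σ.reg 23 = v) (h24 : σ.reg 24 = listStart adj v)
    (h25 : σ.reg 25 = listStart adj v + (adj v).length)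
    (hn : ∀ (j : ℕ) (h : j < (adj v).length), σ.mem 0 (listStart adj v + j) = (adj v)[j])
    (hlab : ∀ u : Fin n, σ.mem 8 u = lab u) :
    wp w neighborLoop.compile (fun σ' => σ'.time ≤ σ.time + 60 * (adj v).length + 10 ∧
      (∀ k i, k ≠ 8 → σ'.mem k i = σ.mem k i) ∧ (∀ y < 24, σ'.reg y = σ.reg y) ∧
      (∀ y > 27, σ'.reg y = σ.reg y) ∧
      ∀ u : Fin n, σ'.mem 8 u = if lab u = 0 ∧ u ∈ adj v then (v : ℕ) + 1 else lab u) σ := by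
  have hB := hF.lt_pow
  have hR := hF.le_region
  have hT := hF.total_lt
  have hL := hF.listStart_le
  have hS := listStart_add_le adj v
  -- The new labels depend only on membership in the scanned prefix of the list, because a label
  -- once set is never changed.
  refine wp_loop (adj v).length (fun i σ' => σ'.time ≤ σ.time + 60 * i ∧
      (∀ k i, k ≠ 8 → σ'.mem k i = σ.mem k i) ∧ (∀ y < 24, σ'.reg y = σ.reg y) ∧
      (∀ y > 27, σ'.reg y = σ.reg y) ∧ σ'.reg 24 = listStart adj v + i ∧
      σ'.reg 25 = listStart adj v + (adj v).length ∧
      ∀ u : Fin n, σ'.mem 8 u = if lab u = 0 ∧ u ∈ (adj v).take i then (v : ℕ) + 1 else lab u)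
    (by norm_num) (by norm_num) ?_ ?_ ?_
  · simp [h24, h25, hlab]
  · rintro i hi σ' ⟨ht, hm, hr, hr', h24', h25', hl⟩
    refine ⟨by simp [Cmp.eval, h24', h25', hi], ?_⟩
    have hx : σ'.mem 0 (listStart adj v + i) = (adj v)[i] := by rw [hm 0 _ (by norm_num), hn i hi]
    have h23' : σ'.reg 23 = v := by rw [hr 23 (by norm_num), h23]
    have hlt := ((adj v)[i]).isLt
    have hvlt := v.isLt
    have hw := hF.word_ne_zero
    have htake : ∀ u, u ∈ (adj v).take (i + 1) ↔ u ∈ (adj v).take i ∨ u = (adj v)[i] := fun u => by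
      rw [← List.take_append_getElem hi, List.mem_append, List.mem_singleton]
    refine Stmt.wp_of_vc ?_
    simp [Stmt.vc, Expr.Ok, Expr.eval, Op.Ok, Op.natEval, Cmp.eval, Expr.cost, h24', hx, h23', hl,
      hw]
    refine ⟨by omega, by omega, fun h => ⟨by omega, by omega, by omega, by omega, ?_, ?_, ?_,
      by omega, h25', fun u => ?_⟩, fun h => ⟨by omega, by omega, hm, ?_, ?_, by omega, h25',
      fun u => ?_⟩⟩
    · intro k i' hk
      simp [hk, hm k i' hk]
    · intro y hy
      simp [hy.ne, (show y ≠ 27 by omega), hr y hy]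
    · intro y hy
      simp [hy.ne', (show y ≠ 24 by omega), hr' y hy]
    · have h0 : lab (adj v)[i] = 0 := by
        by_contra h0
        simp [h0] at h
      simp only [htake]
      by_cases hu : u = (adj v)[i]
      · subst hu
        simp [h0]
      · have : (u : ℕ) ≠ ((adj v)[i] : Fin n) := fun h => hu (Fin.ext h)
        simp only [hu, this, or_false, if_false]
    · intro y hy
      simp [hy.ne, (show y ≠ 27 by omega), hr y hy]
    · intro y hy
      simp [hy.ne', (show y ≠ 24 by omega), hr' y hy]
    · simp only [htake]
      by_cases hu : u = (adj v)[i]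
      · subst hu
        by_cases h0 : lab (adj v)[i] = 0
        · by_cases h1 : (adj v)[i] ∈ (adj v).take i
          · simp [h1]
          · simp [h0, h1] at h
        · simp [h0]
      · simp only [hu, or_false]
  · rintro σ' ⟨ht, hm, hr, hr', h24', h25', hl⟩
    simp only [List.take_length] at hl
    refine ⟨by simp [Cmp.eval, h24', h25'], by simp; omega, hm, hr, hr', hl⟩

theorem bucketSize_erase {D : Finset (Fin n)} {v : Fin n} (hv : v ∈ D) (c : ℕ) :
    bucketSize ω (D.erase v) c =
      if c = cap ω v then bucketSize ω D c - 1 else bucketSize ω D c := by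
  rw [bucketSize, Finset.filter_erase, bucketSize]
  split_ifs with h
  · rw [Finset.card_erase_of_mem (Finset.mem_filter.2 ⟨hv, h.symm⟩)]
  · rw [Finset.erase_eq_of_notMem]
    exact fun hm => h (Finset.mem_filter.1 hm).2.symm

theorem total_erase {D : Finset (Fin n)} {v : Fin n} (hv : v ∈ D) :
    total ω (D.erase v) + cap ω v = total ω D := Finset.sum_erase_add _ _ hv

theorem Core.congr {D : Finset (Fin n)} {lab lab' : Fin n → ℕ} {pos : Fin n → ℕ} {σ σ' : Env}
    (h : Core ω adj w D lab pos σ)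
    (hr : ∀ y, y = 2 ∨ y = 3 ∨ y = 6 ∨ y = 7 ∨ y = 30 ∨ y = 31 → σ'.reg y = σ.reg y)
    (hm : ∀ k i, k = 0 ∨ k = 2 ∨ k = 3 ∨ k = 4 ∨ k = 5 → σ'.mem k i = σ.mem k i)
    (hl : ∀ u : Fin n, σ'.mem 8 u = lab' u) : Core ω adj w D lab' pos σ' where
  reg_n := by rw [hr _ (by simp), h.reg_n]
  reg_n1 := by rw [hr _ (by simp), h.reg_n1]
  reg_max := by rw [hr _ (by simp), h.reg_max]
  reg_zero := by rw [hr _ (by simp), h.reg_zero]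
  reg_total := by rw [hr _ (by simp), h.reg_total]
  reg_buckets := by rw [hr _ (by simp), h.reg_buckets]
  weight u := by rw [hm _ _ (by simp), h.weight]
  degree u := by rw [hm _ _ (by simp), h.degree]
  neighbor u j hj := by rw [hm _ _ (by simp), h.neighbor]
  listStart u := by rw [hm _ _ (by simp), h.listStart]
  capacities := (Finset.image_congr fun i _ => hm 3 i (by simp)).trans h.capacities
  bucketSize c := by rw [hm _ _ (by simp), h.bucketSize]
  pos_lt := h.pos_lt
  bucket v hv := by rw [hm _ _ (by simp), h.bucket v hv]
  exists_pos := h.exists_pos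
  label := hl

/-- Old slots stay valid when nodes are removed: bucket sizes only shrink, so the slots cover more
than is needed. -/
theorem Slots.congr {D D' : Finset (Fin n)} {U : ℕ} {start : ℕ → ℕ} {σ σ' : Env}
    (h : Slots ω w D U start σ) (hD : D' ⊆ D)
    (hr : ∀ y, y = 11 ∨ y = 12 ∨ y = 13 ∨ y = 18 → σ'.reg y = σ.reg y)
    (hm : ∀ k i, k = 6 ∨ k = 7 → σ'.mem k i = σ.mem k i) : Slots ω w D' U start σ' where
  reg_total := by rw [hr _ (by simp), h.reg_total]
  width_pos := by rw [hr _ (by simp)]; exact h.width_pos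
  mul_le := by rw [hr _ (by simp), hr _ (by simp)]; exact h.mul_le
  words := by rw [hr _ (by simp), hr _ (by simp), hr _ (by simp), h.words]
  start_eq s hs := by
    rw [hr _ (by simp)] at hs
    rw [hm _ _ (by simp), hm _ _ (by simp), hr _ (by simp)]
    exact h.start_eq s hs
  slot c p hp := by
    rw [hm _ _ (by simp), hr _ (by simp), hr _ (by simp)]
    exact h.slot c p (hp.trans_le (Nat.mul_le_mul_right _ (bucketSize_mono hD c)))
  mem_capacities s hs := by
    rw [hr _ (by simp)] at hs
    rw [hm _ _ (by simp)]
    exact h.mem_capacities s hs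

theorem cap_mem_capacities (ω : Fin n → ℕ+) (v : Fin n) : cap ω v ∈ capacities ω :=
  Finset.mem_image_of_mem _ (Finset.mem_univ v)

theorem removeNode_spec (hF : Fits ω adj w B) {D : Finset (Fin n)} {lab pos : Fin n → ℕ} {σ : Env}
    {Φ : Env → Prop} (hC : Core ω adj w D lab pos σ) {v : Fin n} (hv : v ∈ D)
    (h10 : σ.reg 10 = cap ω v) (h17 : σ.reg 17 = bucketSize ω D (cap ω v))
    (h22 : σ.reg 22 = pos v)
    (hΦ : ∀ σ' pos', Core ω adj w (D.erase v) lab pos' σ' → σ'.time ≤ σ.time + 120 →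
      (∀ y, y ≠ 6 → y ≠ 17 → σ'.reg y = σ.reg y) →
      (∀ k i, k = 6 ∨ k = 7 → σ'.mem k i = σ.mem k i) → Φ σ') :
    removeNode.vc w Φ σ := by
  have hB := hF.lt_pow
  have hR := hF.le_region
  have hT := hF.total_lt
  have hw := hF.word_ne_zero
  have hpl := hC.pos_lt v hv
  have hsn := bucketSize_le (ω := ω) D (cap ω v)
  have hi1 := hF.index_lt (cap_mem_capacities ω v) (j := pos v) (by omega)
  have hi2 := hF.index_lt (cap_mem_capacities ω v) (j := bucketSize ω D (cap ω v) - 1) (by omega)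
  have hi3 := hF.index_lt (cap_mem_capacities ω v) (j := n) le_rfl
  have hcT := cap_le_total ω v
  have hTe := total_erase (ω := ω) hv
  have hTu := total_mono (ω := ω) (Finset.subset_univ D)
  -- `u` is the node in the last place of the bucket; it may be `v` itself. It inherits the position
  -- of `v`.
  obtain ⟨u, hu, huc, hup⟩ := hC.exists_pos (cap ω v) (bucketSize ω D (cap ω v) - 1) (by omega)
  have hbu := hC.bucket u hu
  rw [huc, hup] at hbu
  have hinj : ∀ x ∈ D, ∀ y ∈ D, cap ω x = cap ω y → pos x = pos y → x = y := fun x hx y hy h1 h2 => by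
    have e1 := hC.bucket x hx
    rw [h1, h2, hC.bucket y hy] at e1
    exact Fin.ext e1.symm
  simp [removeNode, Stmt.vc, Expr.Ok, Expr.eval, Op.Ok, Op.natEval, Expr.cost, h10, h17, h22,
    hC.reg_n, hC.reg_total, hw]
  refine ⟨by omega, by omega, by omega, by omega, by omega, ?_⟩
  refine hΦ _ (fun x => if x = u then pos v else pos x) ?_ (by simp) ?_ ?_
  · refine ⟨?_, ?_, ?_, ?_, ?_, ?_, ?_, ?_, ?_, ?_, ?_, ?_, ?_, ?_, ?_, ?_⟩
    · simp [hC.reg_n]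
    · simp [hC.reg_n1]
    · simp [hC.reg_max]
    · simp [hC.reg_zero]
    · simp; omega
    · simp [hC.reg_buckets]
    · simp [hC.weight]
    · simp [hC.degree]
    · simp +contextual [hC.neighbor]
    · simp [hC.listStart]
    · refine (Finset.image_congr fun i _ => ?_).trans hC.capacities
      simp
    · intro c
      rw [bucketSize_erase hv]
      by_cases hc : c = cap ω v
      · simp [hc]
      · simp [hc, hC.bucketSize]
    · intro x hx
      obtain ⟨hxv, hx⟩ := Finset.mem_erase.1 hx
      rw [bucketSize_erase hv]
      have hpx := hC.pos_lt x hx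
      by_cases hxu : x = u
      · subst hxu
        have : pos v ≠ pos x := fun h => hxv (hinj x hx v hv huc h.symm)
        rw [if_pos rfl, if_pos huc, huc]
        omega
      · rw [if_neg hxu]
        split_ifs with hc
        · have : pos x ≠ pos u := fun h => hxu (hinj x hx u hu (hc.trans huc.symm) h)
          rw [hc] at hpx ⊢
          omega
        · exact hpx
    · intro x hx
      obtain ⟨hxv, hx⟩ := Finset.mem_erase.1 hx
      have hpx := hC.pos_lt x hx
      have hsx := bucketSize_le (ω := ω) D (cap ω x)
      by_cases hxu : x = u
      · subst hxu
        simp [huc, hbu]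
      -- Positions are below `n`, so the address determines the bucket and the position in it.
      · have hne : ¬ cap ω x * n + pos x = cap ω v * n + pos v := fun h => by
          obtain ⟨e1, e2⟩ := address_inj (by omega) (by omega) h
          exact hxv (hinj x hx v hv e1 e2)
        simp [hxu, hne, hC.bucket x hx]
    · intro c j hj
      rw [bucketSize_erase hv] at hj
      by_cases hc : c = cap ω v
      · subst hc
        rw [if_pos rfl] at hj
        obtain ⟨x, hx, hxc, hxj⟩ := hC.exists_pos (cap ω v) j (by omega)
        have hxu : x ≠ u := by rintro rfl; omega
        by_cases hxv : x = v
        · subst hxv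
          exact ⟨u, Finset.mem_erase.2 ⟨hxu.symm, hu⟩, huc, by simp [hxj]⟩
        · exact ⟨x, Finset.mem_erase.2 ⟨hxv, hx⟩, hxc, by simp [hxu, hxj]⟩
      · rw [if_neg hc] at hj
        obtain ⟨x, hx, hxc, hxj⟩ := hC.exists_pos c j hj
        have hxu : x ≠ u := by rintro rfl; exact hc (hxc.symm.trans huc)
        have hxv : x ≠ v := by rintro rfl; exact hc hxc.symm
        exact ⟨x, Finset.mem_erase.2 ⟨hxv, hx⟩, hxc, by simp [hxu, hxj]⟩
    · simp [hC.label]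
  · intro y h6 h17
    simp [h6, h17]
  · rintro k i (rfl | rfl) <;> simp

theorem makePivot_spec (hF : Fits ω adj w B) {D : Finset (Fin n)} {lab pos : Fin n → ℕ} {σ : Env}
    {Φ : Env → Prop} (hC : Core ω adj w D lab pos σ) {v : Fin n} (h23 : σ.reg 23 = v)
    (hΦ : ∀ σ', Core ω adj w D (if lab v = 0 then pivotLab adj lab v else lab) pos σ' →
      σ'.time ≤ σ.time + 100 + 60 * (adj v).length →
      (∀ y, y < 24 → σ'.reg y = σ.reg y) →
      (∀ k i, k = 6 ∨ k = 7 → σ'.mem k i = σ.mem k i) → Φ σ') :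
    makePivot.vc w Φ σ := by
  have hB := hF.lt_pow
  have hR := hF.le_region
  have hT := hF.total_lt
  have hw := hF.word_ne_zero
  have hL := hF.listStart_le
  have hS := listStart_add_le adj v
  have hlt := v.isLt
  have h2n := two_mul_lt_listStart adj n
  simp [makePivot, Stmt.vc, Expr.Ok, Expr.eval, Op.Ok, Op.natEval, Cmp.eval, Expr.cost, h23,
    hC.reg_n1, hw, hC.label, hC.listStart, hC.degree]
  refine ⟨by omega, fun h0 => ⟨by omega, by omega, by omega, by omega, ?_⟩, fun h0 => ?_⟩
  -- The pivot has received its own label before its neighbors are scanned.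
  · refine (neighborLoop_spec hF (v := v) (lab := fun u => if u = v then (v : ℕ) + 1 else lab u)
      ?_ ?_ ?_ ?_ ?_).mono ?_
    · simp [h23]
    · simp
    · simp
    · simpa using hC.neighbor v
    · simp [hC.label, Fin.ext_iff]
    · rintro σ' ⟨ht, hm, hr, hr', hl⟩
      refine hΦ σ' (hC.congr (fun y hy => ?_) (fun k i hk => ?_) fun u => ?_) ?_ ?_ ?_
      · by_cases h : y < 24
        · rw [hr y h]
          simp [show y ≠ 24 by omega, show y ≠ 25 by omega]
        · rw [hr' y (by omega)]
          simp [show y ≠ 24 by omega, show y ≠ 25 by omega]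
      · rw [hm k i (by omega)]
        simp [show k ≠ 8 by omega]
      · rw [hl u, if_pos h0, pivotLab]
        by_cases huv : u = v
        · subst huv
          simp [h0]
        · simp [huv]
      · refine ht.trans ?_
        simp
        omega
      · intro y hy
        rw [hr y hy]
        simp [show y ≠ 24 by omega, show y ≠ 25 by omega]
      · intro k i hk
        rw [hm k i (by omega)]
        simp [show k ≠ 8 by omega]
  · refine hΦ _ (hC.congr (by simp) (by simp) ?_) ?_ (by simp) (by simp)
    · simp [hC.label, h0]
    · simp; omega

end Verification

end WordRAM

namespace WordRAM

/-! ### Processing one random word. -/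

section Attempt

variable {n w B : ℕ} {ω : Fin n → ℕ+} {adj : Fin n → List (Fin n)}

open PivotProgram

/-- The first position of the node `v`. -/
def nodePos (ω : Fin n → ℕ+) (q : ℕ) (start : ℕ → ℕ) (pos : Fin n → ℕ) (v : Fin n) : ℕ :=
  start (cap ω v) * q + pos v * cap ω v

/-- The position `z` belongs to the node `v`. -/
def Hits (ω : Fin n → ℕ+) (q : ℕ) (start : ℕ → ℕ) (pos : Fin n → ℕ) (v : Fin n) (z : ℕ) : Prop :=
  nodePos ω q start pos v ≤ z ∧ z < nodePos ω q start pos v + ω v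

theorem weight_lt_cap (ω : Fin n → ℕ+) (v : Fin n) : (ω v : ℕ) < cap ω v := lt_capacity _ _

/-- Within its bucket the position has offset `pos v * cap ω v + r` with `r < ω v < cap ω v`, so
division with remainder by the capacity recovers the node and passes the acceptance test. -/
theorem Slots.of_hits {D : Finset (Fin n)} {lab pos : Fin n → ℕ} {σ : Env} {U : ℕ}
    {start : ℕ → ℕ} (hC : Core ω adj w D lab pos σ) (hS : Slots ω w D U start σ) {v : Fin n}
    (hv : v ∈ D) {z : ℕ} (hz : Hits ω (σ.reg 12) start pos v z) :
    z / σ.reg 12 < σ.reg 13 ∧ σ.mem 6 (z / σ.reg 12) = cap ω v ∧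
      σ.mem 7 (z / σ.reg 12) ≤ z ∧
      (z - σ.mem 7 (z / σ.reg 12)) / cap ω v = pos v ∧
      (z - σ.mem 7 (z / σ.reg 12)) % cap ω v < ω v := by
  obtain ⟨h1, h2⟩ := hz
  have hwc := weight_lt_cap ω v
  have hcp := cap_pos ω v
  have hp := hC.pos_lt v hv
  have hq := hS.width_pos
  obtain ⟨p, hpz⟩ : ∃ p, z = start (cap ω v) * σ.reg 12 + p :=
    ⟨z - start (cap ω v) * σ.reg 12, by rw [nodePos] at h1; omega⟩
  obtain ⟨r, hr⟩ : ∃ r, p = pos v * cap ω v + r := ⟨p - pos v * cap ω v, by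
    rw [nodePos] at h1; omega⟩
  have hrw : r < ω v := by rw [nodePos] at h2; omega
  have hplt : p < bucketSize ω D (cap ω v) * cap ω v := by
    calc p < (pos v + 1) * cap ω v := by rw [add_mul]; omega
      _ ≤ _ := Nat.mul_le_mul_right _ hp
  obtain ⟨s1, s2⟩ := hS.slot _ p hplt
  have hzd : z / σ.reg 12 = start (cap ω v) + p / σ.reg 12 := by
    rw [hpz, mul_comm, Nat.mul_add_div hq]
  have h7 := (hS.start_eq _ s1).1
  rw [s2] at h7
  rw [hzd, s2, h7]
  refine ⟨s1, rfl, by omega, ?_, ?_⟩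
  · rw [hpz, Nat.add_sub_cancel_left, hr, mul_comm, Nat.mul_add_div hcp,
      Nat.div_eq_of_lt (by omega), add_zero]
  · rw [hpz, Nat.add_sub_cancel_left, hr, mul_comm, Nat.mul_add_mod, Nat.mod_eq_of_lt (by omega)]
    exact hrw

theorem Slots.hits {D : Finset (Fin n)} {pos : Fin n → ℕ} {σ : Env} {U : ℕ}
    {start : ℕ → ℕ} (hS : Slots ω w D U start σ)
    {v : Fin n} {z : ℕ} (h1 : z / σ.reg 12 < σ.reg 13)
    (h2 : σ.mem 6 (z / σ.reg 12) = cap ω v)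
    (h3 : (z - σ.mem 7 (z / σ.reg 12)) / cap ω v = pos v)
    (h4 : (z - σ.mem 7 (z / σ.reg 12)) % cap ω v < ω v) :
    Hits ω (σ.reg 12) start pos v z := by
  obtain ⟨e1, e2⟩ := hS.start_eq _ h1
  rw [h2] at e1 e2
  rw [e1] at h3 h4
  have hle : start (cap ω v) * σ.reg 12 ≤ z :=
    (Nat.mul_le_mul_right _ e2).trans (Nat.div_mul_le_self _ _)
  have := Nat.div_add_mod (z - start (cap ω v) * σ.reg 12) (cap ω v)
  rw [h3, mul_comm] at this
  rw [Hits, nodePos]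
  omega

theorem Slots.index_lt {D : Finset (Fin n)} {σ : Env} {U : ℕ} {start : ℕ → ℕ}
    (hF : Fits ω adj w B) (hS : Slots ω w D U start σ) (hU : U ≤ total ω Finset.univ) :
    σ.reg 13 ≤ 2 * B := by
  have h1 := hS.width_pos
  have h2 := hS.mul_le
  have h3 := hF.total_lt
  have : σ.reg 13 * 1 ≤ σ.reg 13 * σ.reg 12 := Nat.mul_le_mul_left _ h1
  omega

theorem attempt_hit (hF : Fits ω adj w B) {D : Finset (Fin n)} {lab pos : Fin n → ℕ} {σ : Env}
    {U : ℕ} {start : ℕ → ℕ} (hU : U ≤ total ω Finset.univ) (hC : Core ω adj w D lab pos σ)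
    (hS : Slots ω w D U start σ) (hr : σ.reg 19 < 2 ^ w) {v : Fin n} (hv : v ∈ D)
    (hz : Hits ω (σ.reg 12) start pos v (σ.reg 19 / σ.reg 18)) :
    wp w attempt.compile (fun σ' => ∃ pos',
      Core ω adj w (D.erase v) (if lab v = 0 then pivotLab adj lab v else lab) pos' σ' ∧
      Slots ω w (D.erase v) U start σ' ∧
      σ'.time ≤ σ.time + 400 + 60 * (adj v).length) σ := by
  obtain ⟨h1, h2, h3, h4, h5⟩ := Slots.of_hits hC hS hv hz
  have hB := hF.lt_pow
  have hR := hF.le_region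
  have hT := hF.total_lt
  have hw := hF.word_ne_zero
  have hI := hS.index_lt hF hU
  have hpl := hC.pos_lt v hv
  have hsn := bucketSize_le (ω := ω) D (cap ω v)
  have hi1 := hF.index_lt (cap_mem_capacities ω v) (j := pos v) (by omega)
  have hi2 := hF.index_lt (cap_mem_capacities ω v) (j := 0) (by omega)
  have hcT := cap_le_total ω v
  have hlt := v.isLt
  have hzw : σ.reg 19 / σ.reg 18 < 2 ^ w := (Nat.div_le_self _ _).trans_lt hr
  generalize hz' : σ.reg 19 / σ.reg 18 = z at *
  generalize hs' : z / σ.reg 12 = s at *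
  generalize hp' : z - σ.mem 7 s = p at *
  -- The postcondition is made opaque, so that simplifying the verification condition does not take
  -- it apart.
  suffices H : ∀ Φ : Env → Prop, (∀ σ' pos',
      Core ω adj w (D.erase v) (if lab v = 0 then pivotLab adj lab v else lab) pos' σ' →
      Slots ω w (D.erase v) U start σ' →
      σ'.time ≤ σ.time + 400 + 60 * (adj v).length → Φ σ') → attempt.vc w Φ σ from
    Stmt.wp_of_vc (H _ fun σ' pos' h₁ h₂ h₃ => ⟨pos', h₁, h₂, h₃⟩)
  intro Φ hΦ
  simp [attempt, Stmt.vc, Expr.Ok, Expr.eval, Op.Ok, Op.natEval, Cmp.eval, Expr.cost, hz', hs',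
    h2, hp', h4, hC.bucketSize, hC.bucket v hv, hC.weight, hC.reg_n]
  refine ⟨fun _ => ⟨by omega, ⟨by omega, by omega, by omega⟩, by omega, fun _ =>
    ⟨⟨⟨by omega, by omega⟩, by omega⟩, ⟨⟨by omega, by omega⟩, by omega⟩, fun _ => ?_, ?_⟩, ?_⟩, ?_⟩
  · refine removeNode_spec hF (D := D) (lab := lab) (pos := pos) (v := v) ?_ hv ?_ ?_ ?_ ?_
    · exact hC.congr (by rintro y (rfl | rfl | rfl | rfl | rfl | rfl) <;> simp) (by simp)
        (by simp [hC.label])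
    · simp
    · simp
    · simp
    · intro σ₁ pos' hC₁ ht₁ hr₁ hm₁
      refine makePivot_spec hF hC₁ (v := v) ?_ ?_
      · rw [hr₁ _ (by norm_num) (by norm_num)]
        simp
      · intro σ₂ hC₂ ht₂ hr₂ hm₂
        refine hΦ σ₂ pos' hC₂ (hS.congr (Finset.erase_subset _ _) (fun y hy => ?_)
          (fun k i hk => ?_)) ?_
        · rw [hr₂ y (by omega), hr₁ y (by omega) (by omega)]
          rcases hy with rfl | rfl | rfl | rfl <;> simp
        · rw [hm₂ k i hk, hm₁ k i hk]
          simp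
        · simp at ht₁
          omega
  · intro h
    omega
  · intro h
    omega
  · intro h
    omega

/-- A word fails in three ways: beyond the last slot, beyond the last node of the bucket, or beyond
the weight of the node. In each case only scratch variables have changed. -/
theorem attempt_miss (hF : Fits ω adj w B) {D : Finset (Fin n)} {lab pos : Fin n → ℕ} {σ : Env}
    {U : ℕ} {start : ℕ → ℕ} (hU : U ≤ total ω Finset.univ) (hC : Core ω adj w D lab pos σ)
    (hS : Slots ω w D U start σ) (hr : σ.reg 19 < 2 ^ w)
    (hz : ∀ v ∈ D, ¬ Hits ω (σ.reg 12) start pos v (σ.reg 19 / σ.reg 18)) :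
    wp w attempt.compile (fun σ' => Core ω adj w D lab pos σ' ∧ Slots ω w D U start σ' ∧
      σ'.time ≤ σ.time + 400) σ := by
  have hB := hF.lt_pow
  have hR := hF.le_region
  have hT := hF.total_lt
  have hw := hF.word_ne_zero
  have hI := hS.index_lt hF hU
  have hzw : σ.reg 19 / σ.reg 18 < 2 ^ w := (Nat.div_le_self _ _).trans_lt hr
  generalize hz' : σ.reg 19 / σ.reg 18 = z at *
  have hst := hS.start_eq (z / σ.reg 12)
  have hmc := hS.mem_capacities (z / σ.reg 12)
  have hhit : ∀ v, z / σ.reg 12 < σ.reg 13 → _ → _ → _ → Hits ω (σ.reg 12) start pos v z :=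
    fun v => hS.hits
  have hdm := Nat.div_mul_le_self z (σ.reg 12)
  generalize hs' : z / σ.reg 12 = s at *
  generalize hp' : z - σ.mem 7 s = p at *
  generalize hc' : σ.mem 6 s = c at *
  suffices H : ∀ Φ : Env → Prop, (∀ σ', Core ω adj w D lab pos σ' ∧ Slots ω w D U start σ' ∧
      σ'.time ≤ σ.time + 400 → Φ σ') → attempt.vc w Φ σ from Stmt.wp_of_vc (H _ fun _ h => h)
  intro Φ hΦ
  have fin : ∀ σ' : Env, (∀ y, y < 19 → y ≠ 10 → y ≠ 17 → σ'.reg y = σ.reg y) →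
      (∀ y, 30 ≤ y → σ'.reg y = σ.reg y) → σ'.mem = σ.mem → σ'.time ≤ σ.time + 400 → Φ σ' := by
    intro σ' hr₁ hr₂ hm ht
    refine hΦ _ ⟨hC.congr (fun y hy => ?_) (by simp [hm]) (by simp [hm, hC.label]),
      hS.congr subset_rfl (fun y hy => hr₁ y (by omega) (by omega) (by omega)) (by simp [hm]), ht⟩
    by_cases h : y < 19
    · exact hr₁ y h (by omega) (by omega)
    · exact hr₂ y (by omega)
  simp [attempt, Stmt.vc, Expr.Ok, Expr.eval, Op.Ok, Op.natEval, Cmp.eval, Expr.cost, hz', hs', hc',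
    hp', hC.bucketSize, hC.reg_n]
  refine ⟨fun hsS => ?_, fun hsS => ?_⟩
  · obtain ⟨e1, e2⟩ := hst hsS
    have hcm := hmc hsS
    have hi2 := hF.index_lt hcm (j := 0) (by omega)
    have hcB : c ≤ B := by
      obtain ⟨u, _, rfl⟩ := Finset.mem_image.1 hcm
      have := cap_le_total ω u
      omega
    have hle : σ.mem 7 s ≤ z := by
      rw [e1]
      exact (Nat.mul_le_mul_right _ e2).trans hdm
    refine ⟨by omega, ⟨by omega, by omega, by omega⟩, by omega, fun hj => ?_, fun hj => ?_⟩
    · obtain ⟨v, hv, hvc, hvp⟩ := hC.exists_pos c _ hj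
      have hsn := bucketSize_le (ω := ω) D c
      have hi1 := hF.index_lt hcm (j := p / c) (by omega)
      have hlt := v.isLt
      have hb := hC.bucket v hv
      rw [hvc, hvp] at hb
      simp only [hb, hC.weight]
      refine ⟨⟨⟨by omega, by omega⟩, by omega⟩, ⟨⟨by omega, by omega⟩, by omega⟩, fun hh => ?_,
        fun hh => fin _ ?_ ?_ ?_ ?_⟩
      -- A word that passes all tests hits `v`, by `Slots.hits`.
      · exact absurd (hhit v hsS hvc.symm (by rw [hvc]; exact hvp.symm) (by rw [hvc]; exact hh))
          (hz v hv)
      · intro y h1 h2 h3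
        simp [h2, h3, show y ≠ 23 by omega, show y ≠ 22 by omega, show y ≠ 26 by omega,
          show y ≠ 21 by omega, show y ≠ 20 by omega]
      · intro y h1
        simp [show y ≠ 10 by omega, show y ≠ 17 by omega, show y ≠ 23 by omega,
          show y ≠ 22 by omega, show y ≠ 26 by omega, show y ≠ 21 by omega, show y ≠ 20 by omega]
      · rfl
      · simp
    · refine fin _ ?_ ?_ rfl ?_
      · intro y h1 h2 h3
        simp [h2, h3, show y ≠ 22 by omega, show y ≠ 26 by omega,
          show y ≠ 21 by omega, show y ≠ 20 by omega]
      · intro y h1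
        simp [show y ≠ 10 by omega, show y ≠ 17 by omega,
          show y ≠ 22 by omega, show y ≠ 26 by omega, show y ≠ 21 by omega, show y ≠ 20 by omega]
      · simp
  · refine fin _ ?_ ?_ rfl ?_
    · intro y h1 h2 h3
      simp [show y ≠ 21 by omega, show y ≠ 20 by omega]
    · intro y h1
      simp [show y ≠ 21 by omega, show y ≠ 20 by omega]
    · simp

end Attempt

end WordRAM

namespace WordRAM

/-! ### Making the slots. -/

section Rebuild

variable {n w B : ℕ} {ω : Fin n → ℕ+} {adj : Fin n → List (Fin n)}

open PivotProgram

theorem slotLoop_spec {σ : Env} {m q S : ℕ} (hw : w ≠ 0) (hq : 0 < q) (h12 : σ.reg 12 = q)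
    (h13 : σ.reg 13 = S) (h16 : σ.reg 16 = 0) (h17 : σ.reg 17 = m)
    (hlt : S + (m + q - 1) / q < regionSize w) (hlt' : m + q < 2 ^ w) :
    wp w slotLoop.compile (fun σ' => σ'.time ≤ σ.time + 60 * ((m + q - 1) / q) + 10 ∧
      σ'.reg 13 = S + (m + q - 1) / q ∧
      (∀ y, y ≠ 13 → y ≠ 16 → σ'.reg y = σ.reg y) ∧
      (∀ k i, k ≠ 6 → k ≠ 7 → σ'.mem k i = σ.mem k i) ∧
      (∀ i, σ'.mem 6 i = if S ≤ i ∧ i < S + (m + q - 1) / q then σ.reg 10 else σ.mem 6 i) ∧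
      ∀ i, σ'.mem 7 i = if S ≤ i ∧ i < S + (m + q - 1) / q then σ.reg 15 else σ.mem 7 i) σ := by
  -- The quotient `m / q` rounded up.
  set K := (m + q - 1) / q with hK
  have h16' := sixteen_mul_regionSize_lt w
  have hKq : K * q ≤ m + q - 1 := Nat.div_mul_le_self _ _
  have hKq' : m ≤ K * q := by
    have h1 := Nat.lt_div_mul_add hq (a := m + q - 1)
    rw [← hK] at h1
    omega
  refine wp_loop K (fun j σ' => σ'.time ≤ σ.time + 60 * j ∧ σ'.reg 13 = S + j ∧
      σ'.reg 16 = j * q ∧ (∀ y, y ≠ 13 → y ≠ 16 → σ'.reg y = σ.reg y) ∧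
      (∀ k i, k ≠ 6 → k ≠ 7 → σ'.mem k i = σ.mem k i) ∧
      (∀ i, σ'.mem 6 i = if S ≤ i ∧ i < S + j then σ.reg 10 else σ.mem 6 i) ∧
      ∀ i, σ'.mem 7 i = if S ≤ i ∧ i < S + j then σ.reg 15 else σ.mem 7 i)
    (by norm_num) (by norm_num) ?_ ?_ ?_
  · simp [h13, h16]
  · rintro j hj σ' ⟨ht, e13, e16, hr, hm, hm6, hm7⟩
    have hjq : (j + 1) * q ≤ K * q := Nat.mul_le_mul_right _ hj
    rw [add_mul, one_mul] at hjq
    have e12 : σ'.reg 12 = q := by rw [hr _ (by norm_num) (by norm_num), h12]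
    have e17 : σ'.reg 17 = m := by rw [hr _ (by norm_num) (by norm_num), h17]
    refine ⟨by simp [Cmp.eval, e16, e17]; omega, Stmt.wp_of_vc ?_⟩
    simp [Stmt.vc, Expr.Ok, Expr.eval, Op.Ok, Op.natEval, Expr.cost, e13, e16, e12, hw]
    refine ⟨by omega, by omega, by omega, by omega, by omega, by ring, ?_, ?_, ?_, ?_⟩
    · intro y h1 h2
      simp [h1, h2, hr]
    · intro k i h1 h2
      simp [h1, h2, hm]
    · intro i
      rw [hm6 i, hr 10 (by norm_num) (by norm_num)]
      by_cases h : i = S + j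
      · simp [h]
      · simp only [h, if_false]
        congr 1
        exact propext ⟨fun h' => ⟨h'.1, by omega⟩, fun h' => ⟨h'.1, by omega⟩⟩
    · intro i
      rw [hm7 i, hr 15 (by norm_num) (by norm_num)]
      by_cases h : i = S + j
      · simp [h]
      · simp only [h, if_false]
        congr 1
        exact propext ⟨fun h' => ⟨h'.1, by omega⟩, fun h' => ⟨h'.1, by omega⟩⟩
  · rintro σ' ⟨ht, e13, e16, hr, hm, hm6, hm7⟩
    have e17 : σ'.reg 17 = m := by rw [hr _ (by norm_num) (by norm_num), h17]
    exact ⟨by simp [Cmp.eval, e16, e17]; omega, by simp; omega, e13, hr, hm, hm6, hm7⟩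

/-- The invariant of `bucketLoop`: the slots of the first `b` buckets have been made. -/
structure SlotsUpTo (ω : Fin n → ℕ+) (D : Finset (Fin n)) (l : ℕ → ℕ) (q h b : ℕ)
    (start : ℕ → ℕ) (σ : Env) : Prop where
  mul_le : σ.reg 13 * q ≤ ∑ i ∈ Finset.range b, bucketSize ω D (l i) * l i + b * h
  start_eq : ∀ s < σ.reg 13, σ.mem 7 s = start (σ.mem 6 s) * q ∧ start (σ.mem 6 s) ≤ s
  slot : ∀ i < b, ∀ p, p < bucketSize ω D (l i) * l i →
    start (l i) + p / q < σ.reg 13 ∧ σ.mem 6 (start (l i) + p / q) = l i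
  mem : ∀ s < σ.reg 13, ∃ i < b, σ.mem 6 s = l i

/-- Rounding up wastes at most `h` positions per bucket, which accounts for `b * h` in `mul_le`. As
`l` is injective, setting `start` at the new capacity leaves the earlier buckets alone. -/
theorem SlotsUpTo.succ {D : Finset (Fin n)} {l : ℕ → ℕ} {h b L : ℕ}
    {start : ℕ → ℕ} {σ σ' : Env} (hinj : Set.InjOn l (Finset.range L)) (hb : b < L)
    (hσ : SlotsUpTo ω D l (h + 1) h b start σ) {K : ℕ}
    (hK : K = (bucketSize ω D (l b) * l b + (h + 1) - 1) / (h + 1))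
    (h13 : σ'.reg 13 = σ.reg 13 + K)
    (h6 : ∀ i, σ'.mem 6 i = if σ.reg 13 ≤ i ∧ i < σ.reg 13 + K then l b else σ.mem 6 i)
    (h7 : ∀ i, σ'.mem 7 i = if σ.reg 13 ≤ i ∧ i < σ.reg 13 + K then σ.reg 13 * (h + 1)
      else σ.mem 7 i) :
    SlotsUpTo ω D l (h + 1) h (b + 1) (Function.update start (l b) (σ.reg 13)) σ' := by
  have hne : ∀ i < b, l i ≠ l b := fun i hi he => by
    have := hinj (by simp; omega) (by simp; omega) he
    omega
  have hKq : K * (h + 1) ≤ bucketSize ω D (l b) * l b + h := by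
    rw [hK]
    exact Nat.div_mul_le_self _ _
  have hKq' : bucketSize ω D (l b) * l b ≤ K * (h + 1) := by
    have h1 := Nat.lt_div_mul_add (Nat.succ_pos h) (a := bucketSize ω D (l b) * l b + (h + 1) - 1)
    rw [Nat.succ_eq_add_one, ← hK] at h1
    omega
  have hold : ∀ s < σ.reg 13, σ'.mem 6 s = σ.mem 6 s ∧ σ'.mem 7 s = σ.mem 7 s := fun s hs => by
    rw [h6, h7, if_neg (by omega), if_neg (by omega)]
    exact ⟨rfl, rfl⟩
  refine ⟨?_, ?_, ?_, ?_⟩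
  · rw [h13, Finset.sum_range_succ, add_mul, add_mul, one_mul]
    have := hσ.mul_le
    omega
  · intro s hs
    by_cases hs' : s < σ.reg 13
    · obtain ⟨i, hi, hsi⟩ := hσ.mem s hs'
      rw [(hold s hs').1, (hold s hs').2, hsi, Function.update_of_ne (hne i hi), ← hsi]
      exact hσ.start_eq s hs'
    · rw [h6, h7, if_pos (by omega), if_pos (by omega), Function.update_self]
      omega
  · intro i hi p hp
    by_cases hib : i = b
    · subst hib
      rw [Function.update_self]
      have hpK : p / (h + 1) < K := by
        rw [Nat.div_lt_iff_lt_mul (Nat.succ_pos h)]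
        exact hp.trans_le hKq'
      generalize p / (h + 1) = y at hpK ⊢
      rw [h6, if_pos (by omega), h13]
      omega
    · rw [Function.update_of_ne (hne i (by omega))]
      obtain ⟨e1, e2⟩ := hσ.slot i (by omega) p hp
      rw [(hold _ e1).1, h13]
      exact ⟨by omega, e2⟩
  · intro s hs
    by_cases hs' : s < σ.reg 13
    · obtain ⟨i, hi, hsi⟩ := hσ.mem s hs'
      exact ⟨i, by omega, by rw [(hold s hs').1, hsi]⟩
    · exact ⟨b, by omega, by rw [h6, if_pos (by omega)]⟩

/-- A list as long as the set that it enumerates has no repetitions. -/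
theorem sum_list_eq_total {D : Finset (Fin n)} {l : ℕ → ℕ}
    (hl : (Finset.range (capacities ω).card).image l = capacities ω) :
    Set.InjOn l (Finset.range (capacities ω).card) ∧
    ∑ i ∈ Finset.range (capacities ω).card, bucketSize ω D (l i) * l i = total ω D := by
  have hinj : Set.InjOn l (Finset.range (capacities ω).card) := by
    rw [← Finset.card_image_iff, hl, Finset.card_range]
  refine ⟨hinj, ?_⟩
  rw [← sum_bucketSize_mul]
  conv_rhs => rw [← hl]
  rw [Finset.sum_image hinj]

theorem bucketLoop_spec (hF : Fits ω adj w B) {D : Finset (Fin n)} {lab pos : Fin n → ℕ} {σ : Env}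
    (hC : Core ω adj w D lab pos σ) (hD : D.Nonempty)
    (h12 : σ.reg 12 = total ω D / (capacities ω).card + 1) (h13 : σ.reg 13 = 0)
    (h14 : σ.reg 14 = 0) :
    wp w bucketLoop.compile (fun σ' => ∃ start, σ'.time ≤ σ.time + 300 * (capacities ω).card + 10 ∧
      (∀ y, y < 10 ∨ y = 11 ∨ y = 12 ∨ 17 < y → σ'.reg y = σ.reg y) ∧
      (∀ k i, k ≠ 6 → k ≠ 7 → σ'.mem k i = σ.mem k i) ∧
      SlotsUpTo ω D (σ.mem 3) (total ω D / (capacities ω).card + 1)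
        (total ω D / (capacities ω).card) (capacities ω).card start σ') σ := by
  have hB := hF.lt_pow
  have hR := hF.le_region
  have hT := hF.total_lt
  have hw := hF.word_ne_zero
  have hTu := total_mono (ω := ω) (Finset.subset_univ D)
  obtain ⟨hinj, hsum⟩ := sum_list_eq_total (D := D) hC.capacities
  have hcn := card_capacities_le ω
  set L := (capacities ω).card with hL
  have hL0 : 0 < L := by
    obtain ⟨v, _⟩ := hD
    exact Finset.card_pos.2 ⟨_, cap_mem_capacities ω v⟩
  set h := total ω D / L with hh
  -- This bounds the waste of all buckets by the total capacity; the next inequality bounds the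
  -- number of slots by `2 * L`.
  have hLh : L * h ≤ total ω D := Nat.mul_div_le _ _
  have hLh' : total ω D < L * (h + 1) := Nat.lt_mul_div_succ _ hL0
  have hlmem : ∀ i < L, σ.mem 3 i ∈ capacities ω := fun i hi => by
    rw [← hC.capacities]
    exact Finset.mem_image_of_mem _ (Finset.mem_range.2 hi)
  have hle : ∀ b ≤ L, ∑ i ∈ Finset.range b, bucketSize ω D (σ.mem 3 i) * σ.mem 3 i + b * h ≤
      2 * total ω D := fun b hb => by
    have h1 : ∑ i ∈ Finset.range b, bucketSize ω D (σ.mem 3 i) * σ.mem 3 i ≤ total ω D := by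
      rw [← hsum]
      exact Finset.sum_le_sum_of_subset (Finset.range_subset_range.2 hb)
    have h2 : b * h ≤ L * h := Nat.mul_le_mul_right _ hb
    omega
  refine wp_loop L (fun b σ' => ∃ start, σ'.time ≤ σ.time + 100 * b + 60 * σ'.reg 13 ∧
      σ'.reg 14 = b ∧
      (∀ y, y < 10 ∨ y = 11 ∨ y = 12 ∨ 17 < y → σ'.reg y = σ.reg y) ∧
      (∀ k i, k ≠ 6 → k ≠ 7 → σ'.mem k i = σ.mem k i) ∧
      SlotsUpTo ω D (σ.mem 3) (h + 1) h b start σ') (by norm_num) (by norm_num) ?_ ?_ ?_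
  · refine ⟨fun _ => 0, by omega, h14, by simp, by simp, ⟨?_, ?_, ?_, ?_⟩⟩ <;> simp [h13]
  · rintro b hb σ' ⟨start, ht, e14, hr, hm, hS⟩
    have e7 : σ'.reg 7 = L := by rw [hr 7 (by norm_num), hC.reg_buckets]
    have e12 : σ'.reg 12 = h + 1 := by rw [hr 12 (by norm_num), h12]
    refine ⟨by simp [Cmp.eval, e7, e14, hb], Stmt.wp_of_vc ?_⟩
    have hc := hlmem b hb
    have hbs : ∀ c, σ'.mem 4 c = bucketSize ω D c := fun c => by
      rw [hm _ _ (by norm_num) (by norm_num), hC.bucketSize]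
    have h3 : σ'.mem 3 b = σ.mem 3 b := hm _ _ (by norm_num) (by norm_num)
    generalize hcb : σ.mem 3 b = c at *
    have hcl := hF.index_lt hc (j := 0) (by omega)
    have hcB : c ≤ B := by
      obtain ⟨u, _, rfl⟩ := Finset.mem_image.1 hc
      have := cap_le_total ω u
      omega
    have hbm := bucketSize_mul_le (ω := ω) D c
    have hS1 := hS.mul_le
    have hS2 := hle b hb.le
    have hS3 : σ'.reg 13 ≤ σ'.reg 13 * (h + 1) := Nat.le_mul_of_pos_right _ (Nat.succ_pos h)
    have hhT : h ≤ total ω D := Nat.div_le_self _ _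
    set K := (bucketSize ω D c * c + (h + 1) - 1) / (h + 1) with hK
    have hK' : K ≤ bucketSize ω D c * c + (h + 1) - 1 := Nat.div_le_self _ _
    suffices H : ∀ Φ : Env → Prop, (∀ σ'', σ''.time ≤ σ'.time + 60 * K + 100 →
        σ''.reg 14 = b + 1 → σ''.reg 13 = σ'.reg 13 + K →
        (∀ y, y < 10 ∨ y = 11 ∨ y = 12 ∨ 17 < y → σ''.reg y = σ'.reg y) →
        (∀ k i, k ≠ 6 → k ≠ 7 → σ''.mem k i = σ'.mem k i) →
        (∀ i, σ''.mem 6 i = if σ'.reg 13 ≤ i ∧ i < σ'.reg 13 + K then c else σ'.mem 6 i) →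
        (∀ i, σ''.mem 7 i = if σ'.reg 13 ≤ i ∧ i < σ'.reg 13 + K then σ'.reg 13 * (h + 1)
          else σ'.mem 7 i) → Φ σ'') → Stmt.vc w _ Φ (σ'.tick 1) by
      refine H _ fun σ'' ht' e14' e13 hr' hm' h6 h7 =>
        ⟨Function.update start c (σ'.reg 13), by omega, e14', ?_, ?_, ?_⟩
      · intro y hy
        rw [hr' y hy, hr y hy]
      · intro k i hk hk'
        rw [hm' k i hk hk', hm k i hk hk']
      · subst hcb
        exact SlotsUpTo.succ hinj hb hS hK e13 h6 h7
    intro Φ hΦ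
    simp [Stmt.vc, Expr.Ok, Expr.eval, Op.Ok, Op.natEval, Expr.cost, e12, e14, h3, hbs]
    refine ⟨by omega, ⟨by omega, by omega⟩, by omega, ?_⟩
    refine (slotLoop_spec (m := bucketSize ω D c * c) (q := h + 1) (S := σ'.reg 13) hw
      (Nat.succ_pos h) ?_ ?_ ?_ ?_ ?_ ?_).mono ?_
    · simp [e12]
    · simp
    · simp
    · simp
    · omega
    · omega
    · rintro σ'' ⟨ht', e13, hr', hm', h6, h7⟩
      have e14' : σ''.reg 14 = b := by
        rw [hr' _ (by norm_num) (by norm_num)]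
        simp [e14]
      simp [e14']
      refine ⟨⟨by omega, by omega⟩, hΦ _ ?_ ?_ ?_ ?_ ?_ ?_ ?_⟩
      · simp only [Env.tick_time, Env.setReg_time] at ht' ⊢
        omega
      · simp
      · simp [e13, hK]
      · intro y hy
        simp [show y ≠ 14 by omega]
        rw [hr' y (by omega) (by omega)]
        simp [show y ≠ 10 by omega, show y ≠ 17 by omega, show y ≠ 15 by omega, show y ≠ 16 by omega]
      · intro k i hk hk'
        simp [hm' k i hk hk']
      · intro i
        simp [h6]
        rfl
      · intro i
        simp [h7]
        rfl
  · rintro σ' ⟨start, ht, e14, hr, hm, hS⟩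
    have e7 : σ'.reg 7 = L := by rw [hr 7 (by norm_num), hC.reg_buckets]
    refine ⟨by simp [Cmp.eval, e7, e14], start, ?_, hr, hm, hS.1, hS.2, hS.3, hS.4⟩
    have hS1 := hS.mul_le
    have hS2 := hle L le_rfl
    -- The slots have joint width at most twice the total capacity, hence there are at most `2 * L`
    -- of them and the time is linear in `L`.
    have : σ'.reg 13 * (h + 1) ≤ (2 * L) * (h + 1) := by
      rw [mul_assoc]
      omega
    have := Nat.le_of_mul_le_mul_right this (Nat.succ_pos h)
    simp
    omega

/-- The slots are new enough. -/
theorem refresh_spec (hF : Fits ω adj w B) {D : Finset (Fin n)} {lab pos : Fin n → ℕ} {σ : Env}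
    {U : ℕ} (hC : Core ω adj w D lab pos σ) (hD : D.Nonempty) (h11 : σ.reg 11 = U)
    (hS : 2 * total ω D < U ∨ ∃ start, Slots ω w D U start σ) :
    wp w refresh.compile (fun σ' => ∃ U' start, Core ω adj w D lab pos σ' ∧
      Slots ω w D U' start σ' ∧ U' ≤ 2 * total ω D ∧
      ((U' = U ∧ σ'.time ≤ σ.time + 200) ∨
        (U' = total ω D ∧ 2 * total ω D < U ∧
          σ'.time ≤ σ.time + 200 + 300 * (capacities ω).card))) σ := by
  have hB := hF.lt_pow
  have hR := hF.le_region
  have hT := hF.total_lt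
  have hw := hF.word_ne_zero
  have hTu := total_mono (ω := ω) (Finset.subset_univ D)
  suffices H : ∀ Φ : Env → Prop, (∀ σ' U' start, Core ω adj w D lab pos σ' →
      Slots ω w D U' start σ' → U' ≤ 2 * total ω D →
      ((U' = U ∧ σ'.time ≤ σ.time + 200) ∨
        (U' = total ω D ∧ 2 * total ω D < U ∧
          σ'.time ≤ σ.time + 200 + 300 * (capacities ω).card)) → Φ σ') → refresh.vc w Φ σ from
    Stmt.wp_of_vc (H _ fun σ' U' start h1 h2 h3 h4 => ⟨U', start, h1, h2, h3, h4⟩)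
  intro Φ hΦ
  simp [refresh, rebuild, Stmt.vc, Expr.Ok, Expr.eval, Op.Ok, Op.natEval, Cmp.eval, Expr.cost, h11,
    hC.reg_total, hC.reg_buckets, hw]
  refine ⟨by omega, fun hlt => ⟨?_, ?_⟩, fun hle => ?_⟩
  · have := Nat.div_le_self (total ω D) (capacities ω).card
    omega
  · refine (bucketLoop_spec hF (D := D) (lab := lab) (pos := pos) ?_ hD ?_ ?_ ?_).mono ?_
    · exact hC.congr (by rintro y (rfl | rfl | rfl | rfl | rfl | rfl) <;> simp) (by simp)
        (by simp [hC.label])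
    · simp
    · simp
    · simp
    · rintro σ' ⟨start, ht, hr, hm, hS'⟩
      have e30 : σ'.reg 30 = 2 ^ w - 1 := by
        rw [hr _ (by norm_num)]
        simp [hC.reg_max]
      have e12 : σ'.reg 12 = total ω D / (capacities ω).card + 1 := by
        rw [hr _ (by norm_num)]
        simp
      obtain ⟨hinj, hsum⟩ := sum_list_eq_total (D := D) hC.capacities
      have hm3 : σ.mem 3 = (((((((((σ.tick 5).tick 1).setReg 11 (total ω D) 3).tick 1).setReg 12
        (total ω D / (capacities ω).card + 1) 11).tick 1).setReg 13 0 3).tick 1).setReg 14 0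
        3).mem 3 := rfl
      have hmul : σ'.reg 13 * (total ω D / (capacities ω).card + 1) ≤ 2 * total ω D := by
        have h1 := hS'.mul_le
        have h2 : (capacities ω).card * (total ω D / (capacities ω).card) ≤ total ω D :=
          Nat.mul_div_le _ _
        simp only [Env.setReg_mem, Env.tick_mem] at h1
        omega
      simp [e30, e12]
      refine ⟨by omega, hΦ _ (total ω D) start ?_ ?_ (by omega) (Or.inr ⟨rfl, by omega, ?_⟩)⟩
      · refine hC.congr (fun y hy => ?_) (fun k i hk => ?_) (fun u => ?_)
        · simp [show y ≠ 18 by omega, hr y (by omega)]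
          simp [show y ≠ 11 by omega, show y ≠ 12 by omega, show y ≠ 13 by omega,
            show y ≠ 14 by omega]
        · simp [hm k i (by omega) (by omega)]
        · simp [hm, hC.label]
      · refine ⟨?_, ?_, ?_, ?_, ?_, ?_, ?_⟩
        · simp [hr 11 (by norm_num)]
        · simp [e12]
        · simpa [e12] using hmul
        · simp [e12]
        · simpa [e12] using hS'.start_eq
        · intro c p hp
          have hc : c ∈ capacities ω := by
            have h0 : 0 < bucketSize ω D c := Nat.pos_of_ne_zero fun h0 => by simp [h0] at hp
            obtain ⟨v, hv⟩ := Finset.card_pos.1 h0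
            rw [← (Finset.mem_filter.1 hv).2]
            exact cap_mem_capacities ω v
          rw [← hC.capacities] at hc
          obtain ⟨i, hi, rfl⟩ := Finset.mem_image.1 hc
          simpa [e12] using hS'.slot i (Finset.mem_range.1 hi) p hp
        · intro s hs
          obtain ⟨i, hi, he⟩ := hS'.mem s (by simpa using hs)
          simp at he
          simp [he]
          rw [← hC.capacities]
          exact Finset.mem_image_of_mem _ (Finset.mem_range.2 hi)
      · simp at ht
        simp
        omega
  · obtain ⟨start, hS⟩ := hS.resolve_left (by omega)
    refine hΦ _ U start (hC.congr (by simp) (by simp) (by simp [hC.label]))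
      (hS.congr subset_rfl (by simp) (by simp)) (by omega) (Or.inl ⟨rfl, by simp⟩)

end Rebuild

end WordRAM

namespace WordRAM

/-! ### Initialization and output. -/

section Init

variable {n w B : ℕ} {ω : Fin n → ℕ+} {adj : Fin n → List (Fin n)}

open PivotProgram

/-- The input stands in region `0`, the other regions are empty. -/
structure HasInput (ω : Fin n → ℕ+) (adj : Fin n → List (Fin n)) (w : ℕ) (σ : Env) : Prop where
  reg_max : σ.reg 30 = 2 ^ w - 1
  reg_zero : σ.reg 31 = 0
  nodes : σ.mem 0 0 = n
  weight : ∀ u : Fin n, σ.mem 0 (1 + u) = ω u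
  degree : ∀ u : Fin n, σ.mem 0 (n + 1 + u) = (adj u).length
  neighbor : ∀ (u : Fin n) (j : ℕ) (h : j < (adj u).length),
    σ.mem 0 (listStart adj u + j) = (adj u)[j]
  mem : ∀ k i, k ≠ 0 → σ.mem k i = 0

/-- The least power of two above `x`. -/
def powAbove (x : ℕ) : ℕ := if x = 0 then 1 else 2 ^ (Nat.log 2 x + 1)

/-- The recursion by which `powersLoop` fills its table; the value `1` at `0` is the seed. -/
theorem powAbove_div_two {x : ℕ} (hx : x ≠ 0) :
    powAbove (x / 2) + powAbove (x / 2) = powAbove x := by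
  by_cases h : x = 1
  · subst h
    simp [powAbove]
  · have h2 : 2 ≤ x := by omega
    have h3 : x / 2 ≠ 0 := by omega
    rw [powAbove, if_neg h3, powAbove, if_neg hx, Nat.log_of_one_lt_of_le (by norm_num) h2]
    ring

theorem powAbove_le (x : ℕ) : powAbove x ≤ 2 * x + 1 := by
  rw [powAbove]
  split_ifs with h
  · omega
  · have := Nat.pow_log_le_self 2 h
    rw [pow_succ]
    omega

theorem powersLoop_spec (hF : Fits ω adj w B) {σ : Env} (h3 : σ.reg 3 = n + 1)
    (h4 : σ.reg 4 = 1) (h0 : σ.mem 1 0 = 1) :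
    wp w powersLoop.compile (fun σ' => σ'.time ≤ σ.time + 70 * n + 10 ∧
      (∀ y, y ≠ 4 → σ'.reg y = σ.reg y) ∧ (∀ k i, k ≠ 1 → σ'.mem k i = σ.mem k i) ∧
      ∀ x ≤ n, σ'.mem 1 x = powAbove x) σ := by
  have hB := hF.lt_pow
  have hR := hF.le_region
  have hT := hF.total_lt
  have hw := hF.word_ne_zero
  refine wp_loop n (fun i σ' => σ'.time ≤ σ.time + 70 * i ∧ σ'.reg 4 = i + 1 ∧
      (∀ y, y ≠ 4 → σ'.reg y = σ.reg y) ∧ (∀ k i, k ≠ 1 → σ'.mem k i = σ.mem k i) ∧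
      ∀ x ≤ i, σ'.mem 1 x = powAbove x) (by norm_num) (by norm_num) ?_ ?_ ?_
  · simp [h4, h0, powAbove]
  · rintro i hi σ' ⟨ht, e4, hr, hm, hp⟩
    have e3 : σ'.reg 3 = n + 1 := by rw [hr _ (by norm_num), h3]
    refine ⟨by simp [Cmp.eval, e3, e4, hi], Stmt.wp_of_vc ?_⟩
    have hdiv : σ'.mem 1 ((i + 1) / 2) = powAbove ((i + 1) / 2) := hp _ (by omega)
    have hadd := powAbove_div_two (Nat.succ_ne_zero i)
    have hple := powAbove_le (i + 1)
    rw [Nat.succ_eq_add_one] at hadd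
    simp [Stmt.vc, Expr.Ok, Expr.eval, Op.Ok, Op.natEval, Expr.cost, e4, hdiv, hadd, hw]
    refine ⟨by omega, ⟨⟨by omega, by omega⟩, by omega⟩, by omega, by omega, ?_, ?_, ?_⟩
    · intro y hy
      simp [hy, hr]
    · intro k j hk
      simp [hk, hm]
    · intro x hx
      by_cases h : x = i + 1
      · simp [h]
      · simp [h, hp x (by omega)]
  · rintro σ' ⟨ht, e4, hr, hm, hp⟩
    have e3 : σ'.reg 3 = n + 1 := by rw [hr _ (by norm_num), h3]
    exact ⟨by simp [Cmp.eval, e3, e4], by simp; omega, hr, hm, hp⟩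

theorem digitLoop_spec (hn : 1 ≤ n) {σ : Env} {x : ℕ} (hx : x ≠ 0) (hxw : x < 2 ^ w)
    (h3 : σ.reg 3 = n + 1) (h8 : σ.reg 8 = x) (h9 : σ.reg 9 = 1) :
    wp w digitLoop.compile (fun σ' => σ'.time ≤ σ.time + 40 * Nat.log (n + 1) x + 10 ∧
      σ'.reg 8 = x / (n + 1) ^ Nat.log (n + 1) x ∧ σ'.reg 9 = (n + 1) ^ Nat.log (n + 1) x ∧
      (∀ y, y ≠ 8 → y ≠ 9 → σ'.reg y = σ.reg y) ∧ σ'.mem = σ.mem) σ := by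
  have hlog := Nat.pow_log_le_self (n + 1) hx
  have hlog' := Nat.lt_pow_succ_log_self (b := n + 1) (by omega) x
  set e := Nat.log (n + 1) x
  refine wp_loop e (fun i σ' => σ'.time ≤ σ.time + 40 * i ∧
      σ'.reg 8 = x / (n + 1) ^ i ∧ σ'.reg 9 = (n + 1) ^ i ∧
      (∀ y, y ≠ 8 → y ≠ 9 → σ'.reg y = σ.reg y) ∧ σ'.mem = σ.mem) (by norm_num) (by norm_num) ?_ ?_ ?_
  · simp [h8, h9]
  · rintro i hi σ' ⟨ht, e8, e9, hr, hm⟩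
    have e3 : σ'.reg 3 = n + 1 := by rw [hr _ (by norm_num) (by norm_num), h3]
    have hpow : (n + 1) ^ (i + 1) ≤ x := (Nat.pow_le_pow_right (by omega) hi).trans hlog
    have hpos : 0 < (n + 1) ^ i := by positivity
    refine ⟨?_, Stmt.wp_of_vc ?_⟩
    · simp only [Cmp.eval, e3, e8, decide_eq_true_eq]
      rw [Nat.le_div_iff_mul_le hpos, mul_comm, ← pow_succ]
      exact hpow
    · simp only [Stmt.vc, Expr.Ok, Expr.eval, Op.Ok, Op.natEval, Expr.cost, Env.tick_reg,
        Env.setReg_reg, e8, e3, e9]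
      simp [hm, Nat.div_div_eq_div_mul, ← pow_succ]
      refine ⟨by omega, by omega, fun y h1 h2 => ?_⟩
      simp [h1, h2, hr]
  · rintro σ' ⟨ht, e8, e9, hr, hm⟩
    have e3 : σ'.reg 3 = n + 1 := by rw [hr _ (by norm_num) (by norm_num), h3]
    have hpos : 0 < (n + 1) ^ e := by positivity
    refine ⟨?_, by simp; omega, e8, e9, hr, hm⟩
    simp only [Cmp.eval, e3, e8, decide_eq_false_iff_not, not_le]
    rw [Nat.div_lt_iff_lt_mul hpos, mul_comm, ← pow_succ]
    exact hlog'

/-- The nodes with a number below `u`. -/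
def below (n u : ℕ) : Finset (Fin n) := Finset.univ.filter fun v => v.val < u

theorem mem_below {u : ℕ} {v : Fin n} : v ∈ below n u ↔ v.val < u := by simp [below]

theorem below_succ {u : ℕ} (hu : u < n) : below n (u + 1) = insert ⟨u, hu⟩ (below n u) := by
  ext v
  simp only [mem_below, Finset.mem_insert, Fin.ext_iff]
  omega

theorem notMem_below {u : ℕ} (hu : u < n) : (⟨u, hu⟩ : Fin n) ∉ below n u := by simp [mem_below]

theorem bucketSize_insert {D : Finset (Fin n)} {v : Fin n} (hv : v ∉ D) (c : ℕ) :
    bucketSize ω (insert v D) c = if c = cap ω v then bucketSize ω D c + 1 else bucketSize ω D c := by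
  rw [bucketSize, Finset.filter_insert, bucketSize]
  by_cases h : cap ω v = c
  · rw [if_pos h, if_pos h.symm, Finset.card_insert_of_notMem]
    exact fun hm => hv (Finset.mem_filter.1 hm).1
  · rw [if_neg h, if_neg (Ne.symm h)]

/-- The initial position of a node in its bucket. -/
def initPos (ω : Fin n → ℕ+) (v : Fin n) : ℕ := bucketSize ω (below n v) (cap ω v)

/-- The invariant of `nodesLoop`. -/
structure InsertedBelow (ω : Fin n → ℕ+) (u : ℕ) (σ : Env) :
    Prop where
  reg_node : σ.reg 4 = u
  reg_total : σ.reg 6 = total ω (below n u)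
  reg_buckets : σ.reg 7 = ((below n u).image (cap ω)).card
  capacities : (Finset.range ((below n u).image (cap ω)).card).image (σ.mem 3) =
    (below n u).image (cap ω)
  bucketSize : ∀ c, σ.mem 4 c = bucketSize ω (below n u) c
  bucket : ∀ v : Fin n, v.val < u → σ.mem 5 (cap ω v * n + initPos ω v) = (v : ℕ)

theorem InsertedBelow.congr {u : ℕ} {σ σ' : Env} (h : InsertedBelow ω u σ)
    (hr : ∀ y, y = 4 ∨ y = 6 ∨ y = 7 → σ'.reg y = σ.reg y)
    (hm : ∀ k i, k = 3 ∨ k = 4 ∨ k = 5 → σ'.mem k i = σ.mem k i) : InsertedBelow ω u σ' where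
  reg_node := by rw [hr _ (by simp), h.reg_node]
  reg_total := by rw [hr _ (by simp), h.reg_total]
  reg_buckets := by rw [hr _ (by simp), h.reg_buckets]
  capacities := (Finset.image_congr fun i _ => hm 3 i (by simp)).trans h.capacities
  bucketSize c := by rw [hm _ _ (by simp), h.bucketSize]
  bucket v hv := by rw [hm _ _ (by simp), h.bucket v hv]

theorem exists_initPos {u : ℕ} (hu : u ≤ n) {c j : ℕ} (hj : j < bucketSize ω (below n u) c) :
    ∃ v, cap ω v = c ∧ initPos ω v = j := by
  induction u with
  | zero => simp [below, bucketSize] at hj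
  | succ u ih =>
    rw [below_succ hu, bucketSize_insert (notMem_below hu)] at hj
    by_cases h : j < bucketSize ω (below n u) c
    · exact ih (by omega) h
    · split_ifs at hj with hc
      · refine ⟨⟨u, hu⟩, hc.symm, ?_⟩
        rw [initPos, ← hc]
        change bucketSize ω (below n u) c = j
        omega
      · exact absurd hj h

theorem initPos_lt {u : ℕ} {v : Fin n} (hv : v.val < u) :
    initPos ω v < bucketSize ω (below n u) (cap ω v) := by
  have h1 := bucketSize_insert (ω := ω) (notMem_below v.isLt) (cap ω v)
  rw [← below_succ v.isLt, if_pos rfl] at h1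
  have h2 := bucketSize_mono (ω := ω) (D := below n (v + 1)) (D' := below n u) (fun x hx => by
    rw [mem_below] at hx ⊢
    omega) (cap ω v)
  rw [initPos]
  omega

theorem insertNode_spec (hF : Fits ω adj w B) {σ : Env} {u : ℕ} (hu : u < n)
    (hI : InsertedBelow ω u σ) (h2 : σ.reg 2 = n)
    (h89 : σ.mem 1 (σ.reg 8) * σ.reg 9 = cap ω ⟨u, hu⟩) (h8 : σ.reg 8 ≤ n) {Φ : Env → Prop}
    (hΦ : ∀ σ', σ'.time ≤ σ.time + 300 → InsertedBelow ω (u + 1) σ' →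
      (∀ y, y < 4 ∨ y = 5 ∨ 17 < y → σ'.reg y = σ.reg y) →
      (∀ k i, k < 3 ∨ 5 < k → σ'.mem k i = σ.mem k i) → Φ σ') :
    insertNode.vc w Φ σ := by
  have hB := hF.lt_pow
  have hR := hF.le_region
  have hT := hF.total_lt
  have hw := hF.word_ne_zero
  have hcap := cap_le_total ω ⟨u, hu⟩
  have hcp := cap_pos ω ⟨u, hu⟩
  have hsn := bucketSize_le (ω := ω) (below n u) (cap ω ⟨u, hu⟩)
  have hi1 := hF.index_lt (cap_mem_capacities ω ⟨u, hu⟩)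
    (j := bucketSize ω (below n u) (cap ω ⟨u, hu⟩)) (by omega)
  have hi2 := hF.index_lt (cap_mem_capacities ω ⟨u, hu⟩) (j := 0) (by omega)
  have htot : total ω (below n (u + 1)) = total ω (below n u) + cap ω ⟨u, hu⟩ := by
    rw [below_succ hu, total, Finset.sum_insert (notMem_below hu), add_comm, total]
  have htu := total_mono (ω := ω) (Finset.subset_univ (below n (u + 1)))
  have him : (below n (u + 1)).image (cap ω) =
      insert (cap ω ⟨u, hu⟩) ((below n u).image (cap ω)) := by
    rw [below_succ hu, Finset.image_insert]
  have hLn : ((below n u).image (cap ω)).card ≤ n :=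
    (Finset.card_le_card (Finset.image_subset_image (Finset.subset_univ _))).trans
      (card_capacities_le ω)
  have hsize : ∀ c, bucketSize ω (below n (u + 1)) c = if c = cap ω ⟨u, hu⟩ then
      bucketSize ω (below n u) c + 1 else bucketSize ω (below n u) c := fun c => by
    rw [below_succ hu, bucketSize_insert (notMem_below hu)]
  have hpos : initPos ω ⟨u, hu⟩ = bucketSize ω (below n u) (cap ω ⟨u, hu⟩) := rfl
  -- An empty bucket means that the capacity is new and has to be appended to the list of
  -- capacities.
  have hzero : bucketSize ω (below n u) (cap ω ⟨u, hu⟩) = 0 ↔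
      cap ω ⟨u, hu⟩ ∉ (below n u).image (cap ω) := by
    rw [bucketSize, Finset.card_eq_zero, Finset.filter_eq_empty_iff, Finset.mem_image]
    push Not
    rfl
  have fin5 : ∀ σ' : Env, (∀ i, σ'.mem 5 i = if i = cap ω ⟨u, hu⟩ * n +
      bucketSize ω (below n u) (cap ω ⟨u, hu⟩) then u else σ.mem 5 i) →
      (∀ v : Fin n, v.val < u + 1 → σ'.mem 5 (cap ω v * n + initPos ω v) = (v : ℕ)) := by
    intro σ' h5 v hv
    rw [h5]
    by_cases hvu : v.val = u
    · have : v = ⟨u, hu⟩ := Fin.ext hvu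
      subst this
      rw [if_pos (by rw [hpos])]
    · have hv' : v.val < u := by omega
      rw [if_neg, hI.bucket v hv']
      intro he
      have h1 := initPos_lt (ω := ω) hv'
      have h2 := bucketSize_le (ω := ω) (below n u) (cap ω v)
      have h3 : bucketSize ω (below n u) (cap ω ⟨u, hu⟩) < n := by
        have := hsize (cap ω ⟨u, hu⟩)
        rw [if_pos rfl] at this
        have := bucketSize_le (ω := ω) (below n (u + 1)) (cap ω ⟨u, hu⟩)
        omega
      obtain ⟨e1, e2⟩ := address_inj (by omega) h3 he
      rw [e1] at h1
      omega
  have h89' : σ.mem 1 (σ.reg 8) * σ.reg 9 < 2 ^ w := by omega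
  simp [insertNode, Stmt.vc, Expr.Ok, Expr.eval, Op.Ok, Op.natEval, Cmp.eval, Expr.cost, h89,
    hI.bucketSize, hI.reg_buckets, hI.reg_node, hI.reg_total, h2, hw]
  refine ⟨⟨by omega, by omega⟩, by omega, fun h0 => ⟨by omega, by omega, ⟨⟨by omega, by omega⟩,
    by omega⟩, by omega, by omega, by omega, by omega, hΦ _ ?_ ⟨?_, ?_, ?_, ?_, ?_, ?_⟩ ?_ ?_⟩,
    fun h0 => ⟨⟨⟨by omega, by omega⟩, by omega⟩, by omega, by omega, by omega, by omega,
    hΦ _ ?_ ⟨?_, ?_, ?_, ?_, ?_, ?_⟩ ?_ ?_⟩⟩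
  · simp only [Env.tick_time, Env.setReg_time, Env.setMem_time]
    omega
  · simp
  · simp [htot]
  · rw [him, Finset.card_insert_of_notMem (hzero.1 h0)]
    simp
  · rw [him, Finset.card_insert_of_notMem (hzero.1 h0), Finset.range_add_one, Finset.image_insert]
    simp only [Env.setReg_mem, Env.setMem_mem, Env.tick_mem]
    congr 1
    refine (Finset.image_congr fun i hi => ?_).trans hI.capacities
    simp only [Finset.coe_range, Set.mem_Iio] at hi
    simp [hi.ne]
  · intro c
    rw [hsize]
    by_cases hc : c = cap ω ⟨u, hu⟩
    · simp [hc]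
    · simp [hc, hI.bucketSize]
  · exact fin5 _ fun i => by simp
  · intro y hy
    simp [show y ≠ 4 by omega, show y ≠ 6 by omega, show y ≠ 7 by omega, show y ≠ 10 by omega,
      show y ≠ 17 by omega]
  · intro k i hk
    simp [show k ≠ 3 by omega, show k ≠ 4 by omega, show k ≠ 5 by omega]
  · simp only [Env.tick_time, Env.setReg_time, Env.setMem_time]
    omega
  · simp
  · simp [htot]
  · rw [him, Finset.insert_eq_of_mem (by_contra fun h => h0 (hzero.2 h))]
    simp [hI.reg_buckets]
  · rw [him, Finset.insert_eq_of_mem (by_contra fun h => h0 (hzero.2 h))]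
    refine (Finset.image_congr fun i hi => ?_).trans hI.capacities
    simp
  · intro c
    rw [hsize]
    by_cases hc : c = cap ω ⟨u, hu⟩
    · simp [hc]
    · simp [hc, hI.bucketSize]
  · exact fin5 _ fun i => by simp
  · intro y hy
    simp [show y ≠ 4 by omega, show y ≠ 6 by omega, show y ≠ 10 by omega,
      show y ≠ 17 by omega]
  · intro k i hk
    simp [show k ≠ 4 by omega, show k ≠ 5 by omega]

theorem nodesLoop_spec (hF : Fits ω adj w B) {d : ℕ} (hd : ∀ u, (ω u : ℕ) ≤ (n + 1) ^ d) {σ : Env}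
    (hin : ∀ u : Fin n, σ.mem 0 (1 + u) = ω u)
    (hdeg : ∀ u : Fin n, σ.mem 0 (n + 1 + u) = (adj u).length)
    (hpow : ∀ x ≤ n, σ.mem 1 x = powAbove x)
    (h2 : σ.reg 2 = n) (h3 : σ.reg 3 = n + 1) (h5 : σ.reg 5 = listStart adj 0)
    (hI : InsertedBelow ω 0 σ) :
    wp w nodesLoop.compile (fun σ' => σ'.time ≤ σ.time + (400 + 40 * d) * n + 10 ∧
      InsertedBelow ω n σ' ∧ (∀ v : Fin n, σ'.mem 2 v = listStart adj v) ∧ (∀ y, y < 4 ∨ 17 < y → σ'.reg y = σ.reg y) ∧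
      (∀ k i, k < 2 ∨ 5 < k → σ'.mem k i = σ.mem k i)) σ := by
  have hB := hF.lt_pow
  have hR := hF.le_region
  have hT := hF.total_lt
  have hw := hF.word_ne_zero
  have hLn := hF.listStart_le
  refine wp_loop n (fun u σ' => σ'.time ≤ σ.time + (400 + 40 * d) * u ∧
      InsertedBelow ω u σ' ∧ σ'.reg 5 = listStart adj u ∧
      (∀ v : Fin n, v.val < u → σ'.mem 2 v = listStart adj v) ∧
      (∀ y, y < 4 ∨ 17 < y → σ'.reg y = σ.reg y) ∧
      (∀ k i, k < 2 ∨ 5 < k → σ'.mem k i = σ.mem k i)) (by norm_num) (by norm_num) ?_ ?_ ?_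
  · exact ⟨by omega, hI, h5, by simp, fun _ _ => rfl, fun _ _ _ => rfl⟩
  · rintro u hu σ' ⟨ht, hI', e5, h2', hr, hm⟩
    have e2 : σ'.reg 2 = n := by rw [hr _ (by norm_num), h2]
    have e3 : σ'.reg 3 = n + 1 := by rw [hr _ (by norm_num), h3]
    have eω : σ'.mem 0 (1 + u) = ω ⟨u, hu⟩ := by
      rw [hm _ _ (by norm_num)]
      exact hin ⟨u, hu⟩
    have edeg : σ'.mem 0 (n + 1 + u) = (adj ⟨u, hu⟩).length := by
      rw [hm _ _ (by norm_num)]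
      exact hdeg ⟨u, hu⟩
    have hstart := listStart_succ adj ⟨u, hu⟩
    have hle := listStart_add_le adj ⟨u, hu⟩
    have hx0 : (ω ⟨u, hu⟩ : ℕ) ≠ 0 := (ω ⟨u, hu⟩).pos.ne'
    have hxc := weight_lt_cap ω ⟨u, hu⟩
    have hct := cap_le_total ω ⟨u, hu⟩
    -- The polynomial bound on the weights limits the number of digits, and so the time for a node.
    have hlogd : Nat.log (n + 1) (ω ⟨u, hu⟩) ≤ d := by
      refine (Nat.log_mono_right (hd ⟨u, hu⟩)).trans ?_
      rw [Nat.log_pow (by have := hF.pos; omega)]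
    refine ⟨by simp [Cmp.eval, e2, hI'.reg_node, hu], Stmt.wp_of_vc ?_⟩
    suffices H : ∀ Φ : Env → Prop, (∀ σ'', σ''.time ≤ σ'.time + 400 + 40 * d →
        InsertedBelow ω (u + 1) σ'' → σ''.reg 5 = listStart adj (u + 1) →
        (∀ v : Fin n, v.val < u + 1 → σ''.mem 2 v = listStart adj v) →
        (∀ y, y < 4 ∨ 17 < y → σ''.reg y = σ'.reg y) →
        (∀ k i, k < 2 ∨ 5 < k → σ''.mem k i = σ'.mem k i) → Φ σ'') →
        Stmt.vc w _ Φ (σ'.tick 1) by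
      refine H _ fun σ'' ht' hI'' e5'' h2'' hr' hm' => ⟨?_, hI'', e5'', h2'', fun y hy => (hr' y hy).trans (hr y hy),
        fun k i hk => (hm' k i hk).trans (hm k i hk)⟩
      rw [mul_add, mul_one]
      omega
    intro Φ hΦ
    simp [Stmt.vc, Expr.Ok, Expr.eval, Op.Ok, Op.natEval, Expr.cost, hI'.reg_node, e5,
      e3, eω, edeg, hw]
    simp only at hstart hle
    refine ⟨by omega, ⟨⟨by omega, by omega⟩, by omega⟩, ⟨by omega, by omega⟩, ?_⟩
    refine (digitLoop_spec hF.pos (x := ω ⟨u, hu⟩) hx0 (by omega) ?_ ?_ ?_).mono ?_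
    · simp [e3]
    · simp
    · simp
    · rintro σ₁ ⟨ht₁, e8, e9, hr₁, hm₁⟩
      -- The leading digit lies within the table of powers of two.
      have hdiv : (ω ⟨u, hu⟩ : ℕ) / (n + 1) ^ Nat.log (n + 1) (ω ⟨u, hu⟩) ≤ n := by
        have hlog' := Nat.lt_pow_succ_log_self (b := n + 1) (by have := hF.pos; omega)
          (ω ⟨u, hu⟩ : ℕ)
        rw [pow_succ'] at hlog'
        exact Nat.lt_succ_iff.1 ((Nat.div_lt_iff_lt_mul (by positivity)).2 hlog')
      have hdiv0 : (ω ⟨u, hu⟩ : ℕ) / (n + 1) ^ Nat.log (n + 1) (ω ⟨u, hu⟩) ≠ 0 :=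
        (Nat.div_pos (Nat.pow_log_le_self _ hx0) (by positivity)).ne'
      refine insertNode_spec hF hu (hI'.congr ?_ ?_) ?_ ?_ ?_ ?_
      · intro y hy
        rw [hr₁ y (by omega) (by omega)]
        simp [show y ≠ 5 by omega, show y ≠ 8 by omega, show y ≠ 9 by omega]
      · intro k i hk
        simp [hm₁, show k ≠ 2 by omega]
      · rw [hr₁ _ (by norm_num) (by norm_num)]
        simp [e2]
      · rw [e8, e9, hm₁]
        simp [hm, hpow _ hdiv, powAbove, hdiv0]
        rfl
      · rw [e8]
        exact hdiv
      · intro σ₂ ht₂ hI₂ hr₂ hm₂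
        refine hΦ σ₂ ?_ hI₂ ?_ ?_ ?_ ?_
        · simp only [Env.tick_time, Env.setReg_time, Env.setMem_time] at ht₁
          omega
        · rw [hr₂ _ (by norm_num), hr₁ _ (by norm_num) (by norm_num), hstart]
          simp
        · intro v hv
          rw [hm₂ _ _ (by norm_num), hm₁]
          by_cases hvu : v.val = u
          · simp [hvu]
          · simp [hvu, h2' v (by omega)]
        · intro y hy
          rw [hr₂ _ (by omega), hr₁ _ (by omega) (by omega)]
          simp [show y ≠ 5 by omega, show y ≠ 8 by omega, show y ≠ 9 by omega]
        · intro k i hk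
          rw [hm₂ _ _ (by omega), hm₁]
          simp [show k ≠ 2 by omega]
  · rintro σ' ⟨ht, hI', e5, h2', hr, hm⟩
    have e2 : σ'.reg 2 = n := by rw [hr _ (by norm_num), h2]
    exact ⟨by simp [Cmp.eval, e2, hI'.reg_node], by simp; omega,
      hI'.congr (by simp) (by simp), fun v => h2' v v.isLt, hr, hm⟩

theorem below_self : below n n = Finset.univ := by
  ext v
  simp [mem_below]

theorem init_spec (hF : Fits ω adj w B) {d : ℕ} (hd : ∀ u, (ω u : ℕ) ≤ (n + 1) ^ d) {σ : Env}
    (hin : HasInput ω adj w σ) :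
    wp w init.compile (fun σ' => Core ω adj w Finset.univ (fun _ => 0) (initPos ω) σ' ∧
      σ'.reg 11 = 2 * total ω Finset.univ + 1 ∧
      σ'.time ≤ σ.time + (500 + 40 * d) * n + 200) σ := by
  have hB := hF.lt_pow
  have hR := hF.le_region
  have hT := hF.total_lt
  have hw := hF.word_ne_zero
  suffices H : ∀ Φ : Env → Prop, (∀ σ', Core ω adj w Finset.univ (fun _ => 0) (initPos ω) σ' →
      σ'.reg 11 = 2 * total ω Finset.univ + 1 →
      σ'.time ≤ σ.time + (500 + 40 * d) * n + 200 → Φ σ') → init.vc w Φ σ from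
    Stmt.wp_of_vc (H _ fun σ' h1 h2 h3 => ⟨h1, h2, h3⟩)
  intro Φ hΦ
  simp [init, Stmt.vc, Expr.Ok, Expr.eval, Op.Ok, Op.natEval, Expr.cost, hin.nodes, hw]
  refine ⟨by omega, by omega, by omega, ?_⟩
  refine (powersLoop_spec hF ?_ ?_ ?_).mono ?_
  · simp
  · simp
  · simp
  · rintro σ₁ ⟨ht₁, hr₁, hm₁, hp₁⟩
    have e2 : σ₁.reg 2 = n := by simp [hr₁]
    have e3 : σ₁.reg 3 = n + 1 := by simp [hr₁]
    have e30 : σ₁.reg 30 = 2 ^ w - 1 := by simp [hr₁, hin.reg_max]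
    have e31 : σ₁.reg 31 = 0 := by simp [hr₁, hin.reg_zero]
    have hm : ∀ k i, k ≠ 1 → σ₁.mem k i = σ.mem k i := fun k i hk => by simp [hm₁ k i hk, hk]
    simp [e2]
    refine ⟨by omega, ?_⟩
    refine (nodesLoop_spec hF hd ?_ ?_ ?_ ?_ ?_ ?_ ?_).mono ?_
    · simp [hm, hin.weight]
    · simp [hm, hin.degree]
    · simpa using hp₁
    · simp [e2]
    · simp [e3]
    · simp [listStart]
      ring
    · refine ⟨?_, ?_, ?_, ?_, ?_, ?_⟩ <;> simp [below, total, bucketSize, hm, hin.mem]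
    · rintro σ₂ ⟨ht₂, hI₂, hl₂, hr₂, hm₂⟩
      have e6 := hI₂.reg_total
      rw [below_self] at e6
      simp [e6]
      refine ⟨⟨by omega, by omega⟩, hΦ _ ?_ ?_ ?_⟩
      · have hr : ∀ y, 17 < y → σ₂.reg y = σ₁.reg y := fun y hy => by
          rw [hr₂ y (Or.inr hy)]
          simp [show y ≠ 4 by omega, show y ≠ 5 by omega, show y ≠ 6 by omega, show y ≠ 7 by omega]
        have hm' : ∀ k i, k = 0 ∨ k = 8 → σ₂.mem k i = σ.mem k i := fun k i hk => by
          rw [hm₂ k i (by omega)]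
          simp [hm k i (by omega)]
        have hbl := hI₂.bucketSize
        rw [below_self] at hbl
        refine ⟨?_, ?_, ?_, ?_, ?_, ?_, ?_, ?_, ?_, ?_, ?_, ?_, ?_, ?_, ?_, ?_⟩
        · simp [hr₂, e2]
        · simp [hr₂, e3]
        · simp [hr, e30]
        · simp [hr, e31]
        · simp [e6]
        · have := hI₂.reg_buckets
          rw [below_self] at this
          simpa [capacities] using this
        · simp [hm', hin.weight]
        · simp [hm', hin.degree]
        · simpa [hm'] using hin.neighbor
        · simp [hl₂]
        · have := hI₂.capacities
          rw [below_self] at this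
          exact this
        · simpa using hbl
        · intro v _
          have := initPos_lt (ω := ω) v.isLt
          rwa [below_self] at this
        · intro v _
          simpa using hI₂.bucket v v.isLt
        · intro c j hj
          rw [← below_self] at hj
          obtain ⟨v, h1, h2⟩ := exists_initPos le_rfl hj
          exact ⟨v, Finset.mem_univ v, h1, h2⟩
        · simp [hm', hin.mem]
      · simp
        ring
      · simp only [Env.tick_time, Env.setReg_time, Env.setMem_time] at ht₁ ht₂ ⊢
        rw [add_mul] at ht₂ ⊢
        omega

theorem output_spec (hF : Fits ω adj w B) {D : Finset (Fin n)} {lab pos : Fin n → ℕ} {σ : Env}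
    (hC : Core ω adj w D lab pos σ) :
    wp w output.compile (fun σ' => (∀ u : Fin n, σ'.mem 0 u = lab u) ∧
      σ'.time ≤ σ.time + 50 * n + 20) σ := by
  have hB := hF.lt_pow
  have hR := hF.le_region
  have hT := hF.total_lt
  have hw := hF.word_ne_zero
  refine Stmt.wp_of_vc ?_
  simp only [output, Stmt.vc, Expr.Ok, Expr.eval, Expr.cost]
  refine ⟨by norm_num, by omega, ?_⟩
  refine wp_loop n (fun i σ' => σ'.time ≤ σ.time + 50 * i + 10 ∧ σ'.reg 4 = i ∧ σ'.reg 2 = n ∧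
      (∀ u : Fin n, σ'.mem 8 u = lab u) ∧ ∀ u : Fin n, u.val < i → σ'.mem 0 u = lab u)
      (by norm_num) (by norm_num) ?_ ?_ ?_
  · simp [hC.reg_n, hC.label]
  · rintro i hi σ' ⟨ht, e4, e2, h8, h0⟩
    have h8i := h8 ⟨i, hi⟩
    simp only at h8i
    refine ⟨by simp [Cmp.eval, e2, e4, hi], Stmt.wp_of_vc ?_⟩
    simp [Stmt.vc, Expr.Ok, Expr.eval, Op.Ok, Op.natEval, Expr.cost, e4, h8i, hw, e2, h8]
    refine ⟨by omega, by omega, by omega, fun u hu => ?_⟩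
    by_cases h : u.val = i
    · have : u = ⟨i, hi⟩ := Fin.ext h
      simp [this]
    · simp [h, h0 u (by omega)]
  · rintro σ' ⟨ht, e4, e2, h8, h0⟩
    refine ⟨by simp [Cmp.eval, e2, e4], fun u => h0 u u.isLt, ?_⟩
    simp
    omega

end Init

end WordRAM

namespace WordRAM

/-! ### One iteration of the main loop as a weighted draw. -/

section Iteration

variable {n w B : ℕ} {ω : Fin n → ℕ+} {adj : Fin n → List (Fin n)}

open PivotProgram

/-- The situation at the head of the main loop; `D` are the nodes in the buckets, and `U` is the
total capacity at the time when the slots have been made. -/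
def AtHead (ω : Fin n → ℕ+) (adj : Fin n → List (Fin n)) (w : ℕ) (D : Finset (Fin n))
    (lab : Fin n → ℕ) (U : ℕ) (s : State) : Prop :=
  ∃ σ pos, Rep w s σ ∧ Core ω adj w D lab pos σ ∧ σ.reg 11 = U ∧ U ≤ 2 * total ω Finset.univ + 1 ∧
    (2 * total ω D < U ∨ (U ≤ total ω Finset.univ ∧ ∃ start, Slots ω w D U start σ))

/-- The labels after `v` has been taken out of its bucket. -/
def nextLab (adj : Fin n → List (Fin n)) (lab : Fin n → ℕ) (v : Fin n) : Fin n → ℕ :=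
  if lab v = 0 then pivotLab adj lab v else lab

/-- The total weight. -/
def weightSum (ω : Fin n → ℕ+) (D : Finset (Fin n)) : ℕ := ∑ v ∈ D, (ω v : ℕ)

theorem total_le_two_mul (D : Finset (Fin n)) : total ω D ≤ 2 * weightSum ω D := by
  rw [total, weightSum, Finset.mul_sum]
  exact Finset.sum_le_sum fun v _ => capacity_le n (ω v).pos.ne'

theorem Hits.unique {D : Finset (Fin n)} {lab pos : Fin n → ℕ} {σ : Env} {U : ℕ}
    {start : ℕ → ℕ} (hC : Core ω adj w D lab pos σ) (hS : Slots ω w D U start σ) {v v' : Fin n}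
    (hv : v ∈ D) (hv' : v' ∈ D) {z : ℕ} (hz : Hits ω (σ.reg 12) start pos v z)
    (hz' : Hits ω (σ.reg 12) start pos v' z) : v = v' := by
  obtain ⟨_, h2, _, h4, _⟩ := Slots.of_hits hC hS hv hz
  obtain ⟨_, h2', _, h4', _⟩ := Slots.of_hits hC hS hv' hz'
  have hc : cap ω v = cap ω v' := h2.symm.trans h2'
  rw [← hc, h4] at h4'
  have := hC.bucket v hv
  rw [hc, h4', hC.bucket v' hv'] at this
  exact Fin.ext this.symm

-- The accepted positions of `v` form an interval of length `ω v`, and each position is the quotient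
-- of `σ.reg 18` words. All these words are below `2 ^ w` because the interval ends within the last
-- slot; hence the sampling is exact.
open Classical in
theorem card_filter_hits {D : Finset (Fin n)} {lab pos : Fin n → ℕ} {σ : Env} {U : ℕ}
    {start : ℕ → ℕ} (hC : Core ω adj w D lab pos σ) (hS : Slots ω w D U start σ)
    (hg : 0 < σ.reg 18) {v : Fin n} (hv : v ∈ D) :
    ((Finset.range (2 ^ w)).filter fun r => Hits ω (σ.reg 12) start pos v (r / σ.reg 18)).card =
      σ.reg 18 * ω v := by
  have hωp := (ω v).pos
  have hlast : Hits ω (σ.reg 12) start pos v (nodePos ω (σ.reg 12) start pos v + (ω v - 1)) :=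
    ⟨by omega, by omega⟩
  have h1 := (Slots.of_hits hC hS hv hlast).1
  rw [Nat.div_lt_iff_lt_mul hS.width_pos] at h1
  have h2 : (nodePos ω (σ.reg 12) start pos v + ω v) * σ.reg 18 ≤ 2 ^ w := by
    calc _ ≤ (σ.reg 13 * σ.reg 12) * σ.reg 18 := Nat.mul_le_mul_right _ (by omega)
      _ ≤ 2 ^ w - 1 := by
          rw [hS.words]
          exact Nat.mul_div_le _ _
      _ ≤ _ := Nat.sub_le _ _
  have : ((Finset.range (2 ^ w)).filter fun r => Hits ω (σ.reg 12) start pos v (r / σ.reg 18)) =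
      Finset.Ico (nodePos ω (σ.reg 12) start pos v * σ.reg 18)
        ((nodePos ω (σ.reg 12) start pos v + ω v) * σ.reg 18) := by
    ext r
    rw [Finset.mem_filter, Finset.mem_range, Finset.mem_Ico, Hits, Nat.le_div_iff_mul_le hg,
      Nat.div_lt_iff_lt_mul hg]
    constructor
    · exact fun h => h.2
    · exact fun h => ⟨by omega, h⟩
  rw [this, Nat.card_Ico, ← Nat.sub_mul, Nat.add_sub_cancel_left, mul_comm]

/-- The node that the random word `r` selects, if any. -/
structure IsSelection (ω : Fin n → ℕ+) (w : ℕ) (D : Finset (Fin n)) (out : ℕ → Option (Fin n))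
    (g : ℕ) : Prop where
  mem : ∀ r v, out r = some v → v ∈ D
  card : ∀ v ∈ D, ((Finset.range (2 ^ w)).filter fun r => out r = some v).card = g * ω v
  le : 2 ^ w ≤ 16 * (g * weightSum ω D)

/-- The constant `16` is a product of four factors of two: rounding in the number of words per
position, waste by slots, slots up to a factor of two out of date, and capacities above the weights.
-/
theorem exists_isSelection (hF : Fits ω adj w B) {D : Finset (Fin n)} {lab pos : Fin n → ℕ}
    {σ : Env} {U : ℕ} {start : ℕ → ℕ} (hC : Core ω adj w D lab pos σ)
    (hS : Slots ω w D U start σ) (hU : U ≤ 2 * total ω D) (hD : D.Nonempty) :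
    ∃ out, IsSelection ω w D out (σ.reg 18) ∧
      (∀ r v, out r = some v → Hits ω (σ.reg 12) start pos v (r / σ.reg 18)) ∧
      ∀ r, out r = none → ∀ v ∈ D, ¬ Hits ω (σ.reg 12) start pos v (r / σ.reg 18) := by
  classical
  have hB := hF.lt_pow
  have hT := hF.total_lt
  have hTu := total_mono (ω := ω) (Finset.subset_univ D)
  have hmul := hS.mul_le
  have hNpos : 0 < σ.reg 13 * σ.reg 12 := by
    obtain ⟨v, hv⟩ := hD
    have hpv := hC.pos_lt v hv
    have := (hS.slot (cap ω v) 0 (Nat.mul_pos (by omega) (cap_pos ω v))).1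
    rw [Nat.zero_div] at this
    exact Nat.mul_pos (by omega) hS.width_pos
  have hg : 0 < σ.reg 18 := by
    rw [hS.words]
    exact Nat.div_pos (by omega) hNpos
  -- Since `σ.reg 18` is positive, the words lost by rounding are at most as many as those in use.
  have hgN : 2 ^ w ≤ 2 * (σ.reg 18 * (σ.reg 13 * σ.reg 12)) := by
    have := Nat.lt_div_mul_add hNpos (a := 2 ^ w - 1)
    rw [← hS.words] at this
    omega
  refine ⟨fun r => if h : ∃ v ∈ D, Hits ω (σ.reg 12) start pos v (r / σ.reg 18) then
    some h.choose else none, ⟨?_, ?_, ?_⟩, ?_, ?_⟩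
  · intro r v h
    split_ifs at h with h'
    cases h
    exact h'.choose_spec.1
  · intro v hv
    rw [← card_filter_hits hC hS hg hv]
    congr 1
    ext r
    simp only [Finset.mem_filter, and_congr_right_iff]
    intro _
    constructor
    · intro h
      split_ifs at h with h'
      cases h
      exact h'.choose_spec.2
    · intro h
      have h' : ∃ v ∈ D, Hits ω (σ.reg 12) start pos v (r / σ.reg 18) := ⟨v, hv, h⟩
      rw [dif_pos h', Option.some_inj]
      exact Hits.unique hC hS h'.choose_spec.1 hv h'.choose_spec.2 h
  · have h1 := total_le_two_mul (ω := ω) D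
    have h2 : σ.reg 13 * σ.reg 12 ≤ 8 * weightSum ω D := by omega
    have h3 := Nat.mul_le_mul_left (σ.reg 18) h2
    have h4 : σ.reg 18 * (8 * weightSum ω D) = 8 * (σ.reg 18 * weightSum ω D) := by ring
    omega
  · intro r v h
    dsimp only at h
    split_ifs at h with h'
    cases h
    exact h'.choose_spec.2
  · intro r h v hv hh
    dsimp only at h
    split_ifs at h with h'
    exact h' ⟨v, hv, hh⟩

/-- The body of the main loop, up to the choice of the random word and after it. -/
theorem exists_iteration (hF : Fits ω adj w B) {D : Finset (Fin n)} {lab : Fin n → ℕ} {U : ℕ}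
    {s : State} (hs : AtHead ω adj w D lab U s) (hD : D.Nonempty) (l : List Prog) :
    ∃ s₁ t₁ U' out g, IsSelection ω w D out g ∧
      Reach w ⟨.seq refresh.compile (.seq (.rand 19) attempt.compile) :: l, s⟩
        ⟨.rand 19 :: attempt.compile :: l, s₁⟩ t₁ ∧
      ((U' = U ∧ t₁ ≤ 202) ∨
        (U' = total ω D ∧ 2 * total ω D < U ∧ t₁ ≤ 202 + 300 * (capacities ω).card)) ∧
      ∀ r < 2 ^ w, ∃ s₂ t₂, Exec w attempt.compile (s₁.setReg 19 r) s₂ t₂ ∧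
        (∀ v, out r = some v → AtHead ω adj w (D.erase v) (nextLab adj lab v) U' s₂ ∧
          t₂ ≤ 400 + 60 * (adj v).length) ∧
        (out r = none → AtHead ω adj w D lab U' s₂ ∧ t₂ ≤ 400) := by
  obtain ⟨σ, pos, hR, hC, h11, hU, hS⟩ := hs
  have hTu := total_mono (ω := ω) (Finset.subset_univ D)
  obtain ⟨s₁, σ₁, t₁, e₁, hR₁, ht₁, U', start, hC₁, hS₁, hU', hcase⟩ :=
    refresh_spec hF hC hD h11 (hS.imp_right And.right) s hR
  obtain ⟨out, hout, hhit, hmiss⟩ := exists_isSelection hF hC₁ hS₁ hU' hD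
  have hU'' : U' ≤ total ω Finset.univ := by
    rcases hcase with ⟨rfl, _⟩ | ⟨rfl, _⟩
    · rcases hS with hS | ⟨h, _⟩
      · omega
      · exact h
    · exact hTu
  refine ⟨s₁, 1 + (t₁ + 1), U', out, σ₁.reg 18, hout, ?_, ?_, ?_⟩
  · have h1 : Reach w ⟨.seq refresh.compile (.seq (.rand 19) attempt.compile) :: l, s⟩
        ⟨refresh.compile :: .seq (.rand 19) attempt.compile :: l, s⟩ 1 := .single (by simp) rfl
    exact h1.trans ((e₁ _).trans (.single (by simp) rfl))
  · rcases hcase with ⟨h1, h2⟩ | ⟨h1, h2, h3⟩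
    · exact Or.inl ⟨h1, by omega⟩
    · exact Or.inr ⟨h1, h2, by omega⟩
  · intro r hr
    have hR₂ := hR₁.setReg (show (19 : ℕ) ≠ 0 by norm_num) r 0
    have hC₂ : Core ω adj w D lab pos (σ₁.setReg 19 r 0) :=
      hC₁.congr (by rintro y (rfl | rfl | rfl | rfl | rfl | rfl) <;> simp) (by simp)
        (by simp [hC₁.label])
    have hS₂ : Slots ω w D U' start (σ₁.setReg 19 r 0) :=
      hS₁.congr subset_rfl (by rintro y (rfl | rfl | rfl | rfl) <;> simp) (by simp)
    cases ho : out r with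
    | some v =>
      have hv := hout.mem r v ho
      obtain ⟨s₂, σ₂, t₂, e₂, hR₃, ht₂, pos', hC₃, hS₃, ht₂'⟩ :=
        attempt_hit hF hU'' hC₂ hS₂ (by simpa using hr) hv (by simpa using hhit r v ho) _ hR₂
      refine ⟨s₂, t₂, e₂, fun v' hv' => ?_, fun h => by simp at h⟩
      cases hv'
      exact ⟨⟨σ₂, pos', hR₃, hC₃, hS₃.reg_total, by omega, Or.inr ⟨hU'', start, hS₃⟩⟩, by omega⟩
    | none =>
      obtain ⟨s₂, σ₂, t₂, e₂, hR₃, ht₂, hC₃, hS₃, ht₂'⟩ :=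
        attempt_miss hF hU'' hC₂ hS₂ (by simpa using hr) (by simpa using hmiss r ho) _ hR₂
      refine ⟨s₂, t₂, e₂, fun v' hv' => by simp at hv', fun _ => ?_⟩
      exact ⟨⟨σ₂, pos, hR₃, hC₃, hS₃.reg_total, by omega, Or.inr ⟨hU'', start, hS₃⟩⟩, by omega⟩

/-- The words are sorted by the node that they select; `N` counts the rejected ones. -/
theorem IsSelection.sum_eq {D : Finset (Fin n)} {out : ℕ → Option (Fin n)} {g : ℕ}
    (h : IsSelection ω w D out g) (f : Option (Fin n) → ℝ≥0∞) :
    ∃ N, g * weightSum ω D + N = 2 ^ w ∧ ∑ r ∈ Finset.range (2 ^ w), f (out r) =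
      ∑ v ∈ D, ((g * ω v : ℕ) : ℝ≥0∞) * f (some v) + N * f none := by
  classical
  have hmaps : ∀ r ∈ Finset.range (2 ^ w), out r ∈ Finset.insertNone D := fun r _ => by
    cases ho : out r with
    | none => exact Finset.none_mem_insertNone
    | some v => exact Finset.some_mem_insertNone.2 (h.mem r v ho)
  refine ⟨((Finset.range (2 ^ w)).filter fun r => out r = none).card, ?_, ?_⟩
  · have := Finset.card_eq_sum_card_fiberwise hmaps
    rw [Finset.card_range, Finset.sum_insertNone, Finset.sum_congr rfl h.card] at this
    rw [weightSum, Finset.mul_sum]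
    omega
  · rw [← Finset.sum_fiberwise_of_maps_to hmaps, Finset.sum_insertNone, add_comm]
    have hconst : ∀ o, ∑ r ∈ Finset.range (2 ^ w) with out r = o, f (out r) =
        ((Finset.range (2 ^ w)).filter fun r => out r = o).card * f o := fun o => by
      rw [Finset.sum_congr rfl fun r hr => by rw [(Finset.mem_filter.1 hr).2], Finset.sum_const,
        nsmul_eq_mul]
    simp only [hconst]
    congr 1
    exact Finset.sum_congr rfl fun v hv => by rw [h.card v hv]

theorem AtHead.reg_six {D : Finset (Fin n)} {lab : Fin n → ℕ} {U : ℕ} {s : State}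
    (hs : AtHead ω adj w D lab U s) : s.reg 6 = total ω D ∧ s.reg 31 = 0 := by
  obtain ⟨σ, pos, hR, hC, _⟩ := hs
  rw [hR.reg 6 (by norm_num), hR.reg 31 (by norm_num)]
  exact ⟨hC.reg_total, hC.reg_zero⟩

theorem total_pos {D : Finset (Fin n)} (hD : D.Nonempty) : total ω D ≠ 0 := by
  obtain ⟨v, hv⟩ := hD
  have h1 : cap ω v ≤ total ω D :=
    Finset.single_le_sum (f := cap ω) (fun _ _ => Nat.zero_le _) hv
  have := cap_pos ω v
  omega

theorem AtHead.step_mainLoop {D : Finset (Fin n)} {lab : Fin n → ℕ} {U : ℕ} {s : State}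
    (hs : AtHead ω adj w D lab U s) (hD : D.Nonempty) (l : List Prog) :
    step w ⟨mainLoop :: l, s⟩ = PMF.pure
      ⟨.seq refresh.compile (.seq (.rand 19) attempt.compile) :: mainLoop :: l, s⟩ := by
  obtain ⟨h6, h31⟩ := hs.reg_six
  simp [mainLoop, step, Cmp.eval, h6, h31, total_pos hD]

theorem AtHead.exists_halted (hF : Fits ω adj w B) {lab : Fin n → ℕ} {U : ℕ} {s : State}
    (hs : AtHead ω adj w ∅ lab U s) : ∃ s' t, Reach w ⟨[mainLoop, output.compile], s⟩ ⟨[], s'⟩ t ∧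
      t ≤ 50 * n + 21 ∧ ∀ u : Fin n, s'.mem u = lab u := by
  obtain ⟨h6, h31⟩ := hs.reg_six
  obtain ⟨σ, pos, hR, hC, _⟩ := hs
  obtain ⟨s', σ', t, e, hR', ht, hl, ht'⟩ := output_spec hF hC s hR
  refine ⟨s', 1 + t, Reach.trans (.single (by simp) ?_) (e []), by omega, fun u => ?_⟩
  · simp [mainLoop, step, Cmp.eval, h6, h31, total]
  · have hle := hF.le_region
    have := hF.total_lt
    have hu := u.isLt
    have := hR'.mem 0 (by norm_num) u (by omega)
    rw [zero_mul, zero_add] at this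
    rw [this, hl]

end Iteration

end WordRAM

namespace WordRAM

open NodeWeightedCC PivotProgram

/-! ### The output law dominates the pivot law. -/

section Correctness

variable {n w B : ℕ} {ω : Fin n → ℕ+} {adj : Fin n → List (Fin n)} {G : SimpleGraph (Fin n)}

/-- The nodes without a label. -/
def unlabelled (lab : Fin n → ℕ) : Finset (Fin n) := Finset.univ.filter fun u => lab u = 0

theorem mem_unlabelled {lab : Fin n → ℕ} {u : Fin n} : u ∈ unlabelled lab ↔ lab u = 0 := by
  simp [unlabelled]

/-- Label the nodes without a label by their pivots. -/
def complete (lab : Fin n → ℕ) (f : Fin n → Fin n) (u : Fin n) : ℕ :=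
  if lab u = 0 then (f u : ℕ) + 1 else lab u

/-- The expectation of `h` when the labels `lab` are completed by the pivot procedure. -/
noncomputable def completion (G : SimpleGraph (Fin n)) (ω : Fin n → ℕ+)
    (h : (Fin n → ℕ) → ℝ≥0∞) (lab : Fin n → ℕ) : ℝ≥0∞ :=
  pivotExpect G ω (unlabelled lab) fun f => h (complete lab f)

open Classical in
theorem unlabelled_pivotLab (hadj : IsAdjList G adj) (lab : Fin n → ℕ) (v : Fin n) :
    unlabelled (pivotLab adj lab v) =
      unlabelled lab \ pivotCluster G (unlabelled lab) v := by
  ext u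
  rw [Finset.mem_sdiff, mem_pivotCluster, mem_unlabelled, mem_unlabelled, pivotLab, ← (hadj v).2 u]
  split_ifs with h
  · simp [h]
  · tauto

open Classical in
theorem complete_pivotLab (hadj : IsAdjList G adj) (lab : Fin n → ℕ) (v : Fin n)
    (f : Fin n → Fin n) : complete (pivotLab adj lab v) f =
      complete lab fun u => if u ∈ pivotCluster G (unlabelled lab) v then v else f u := by
  ext u
  simp only [complete, pivotLab, mem_pivotCluster, mem_unlabelled, (hadj v).2 u]
  by_cases h : lab u = 0 <;> by_cases h' : u = v ∨ G.Adj v u <;> simp [h, h']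

theorem weight_mul_completion (hadj : IsAdjList G adj) (h : (Fin n → ℕ) → ℝ≥0∞)
    (lab : Fin n → ℕ) : weight ω (unlabelled lab) * completion G ω h lab =
      ∑ v ∈ unlabelled lab, (ω v : ℕ) * completion G ω h (pivotLab adj lab v) := by
  classical
  rw [completion, weight_mul_pivotExpect]
  refine Finset.sum_congr rfl fun v _ => ?_
  simp only [completion, unlabelled_pivotLab hadj, complete_pivotLab hadj]
  congr!

/-- Why lazy removal is harmless: a labelled node leaves `lab` as it is, and the unlabelled ones are
drawn with the proportions of the pivot procedure. So `completion` is preserved on average, whatever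
labelled nodes `D` still contains. -/
theorem sum_completion_nextLab (hadj : IsAdjList G adj) (h : (Fin n → ℕ) → ℝ≥0∞)
    {lab : Fin n → ℕ} {D : Finset (Fin n)} (hD : unlabelled lab ⊆ D) :
    ∑ v ∈ D, ((ω v : ℕ) : ℝ≥0∞) * completion G ω h (nextLab adj lab v) =
      weightSum ω D * completion G ω h lab := by
  have h1 : ∀ v ∈ unlabelled lab, ((ω v : ℕ) : ℝ≥0∞) * completion G ω h (nextLab adj lab v) =
      (ω v : ℕ) * completion G ω h (pivotLab adj lab v) := fun v hv => by
    rw [nextLab, if_pos (mem_unlabelled.1 hv)]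
  have h2 : ∀ v ∈ D \ unlabelled lab,
      ((ω v : ℕ) : ℝ≥0∞) * completion G ω h (nextLab adj lab v) =
        (ω v : ℕ) * completion G ω h lab := fun v hv => by
    rw [nextLab, if_neg (mem_unlabelled.not.1 (Finset.mem_sdiff.1 hv).2)]
  rw [← Finset.sum_sdiff hD, Finset.sum_congr rfl h1, Finset.sum_congr rfl h2,
    ← weight_mul_completion hadj, ← Finset.sum_mul, ← add_mul, weightSum, Nat.cast_sum,
    ← Finset.sum_sdiff hD, weight]

theorem unlabelled_nextLab_subset (hadj : IsAdjList G adj) {lab : Fin n → ℕ}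
    {D : Finset (Fin n)} (hD : unlabelled lab ⊆ D) (v : Fin n) :
    unlabelled (nextLab adj lab v) ⊆ D.erase v := by
  classical
  intro u hu
  rw [Finset.mem_erase]
  rw [nextLab] at hu
  split_ifs at hu with hv
  · rw [unlabelled_pivotLab hadj, Finset.mem_sdiff, mem_pivotCluster] at hu
    exact ⟨fun h => hu.2 ⟨hu.1, Or.inl h⟩, hD hu.1⟩
  · exact ⟨fun h => hv (h ▸ mem_unlabelled.1 hu), hD hu⟩

/-- Rejections do not matter, since they do not occur forever. -/
theorem AtHead.completion_le_haltLim (hF : Fits ω adj w B) (hadj : IsAdjList G adj)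
    (F : Set (Fin n → ℕ)) {D : Finset (Fin n)} {lab : Fin n → ℕ} (hD : unlabelled lab ⊆ D)
    {U : ℕ} {s : State} (hs : AtHead ω adj w D lab U s) :
    completion G ω (F.indicator 1) lab ≤
      haltLim w {mem | (fun u : Fin n => mem u) ∈ F} ⟨[mainLoop, output.compile], s⟩ := by
  induction hk : D.card generalizing D lab U s with
  | zero =>
    obtain rfl := Finset.card_eq_zero.1 hk
    have hemp : unlabelled lab = ∅ := Finset.subset_empty.1 hD
    have hc : complete lab id = lab := by
      ext u
      have : u ∉ unlabelled lab := by simp [hemp]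
      rw [complete, if_neg (mem_unlabelled.not.1 this)]
    rw [completion, hemp, pivotExpect_empty, hc]
    by_cases hl : lab ∈ F
    · rw [Set.indicator_of_mem hl]
      obtain ⟨s', t, hr, _, hm⟩ := hs.exists_halted hF
      refine le_trans (haltLim_halted w ?_) (haltLim_le_of_reach hr)
      have : (fun u : Fin n => s'.mem u) = lab := funext hm
      rwa [Set.mem_ofPred_eq, this]
    · rw [Set.indicator_of_notMem hl]
      exact zero_le
  | succ k ih =>
    have hne : D.Nonempty := Finset.card_pos.1 (by omega)
    set E : Set (ℕ → ℕ) := {mem | (fun u : Fin n => mem u) ∈ F}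
    set W := completion G ω (F.indicator 1) lab
    -- A rejection returns to the same `D` and `lab`, but possibly to another state. The infimum
    -- over all such states is a lower bound that survives rejections.
    set i := ⨅ p : {p : ℕ × State // AtHead ω adj w D lab p.1 p.2},
      haltLim w E ⟨[mainLoop, output.compile], p.1.2⟩ with hi
    have hle : ∀ {U s}, AtHead ω adj w D lab U s →
        i ≤ haltLim w E ⟨[mainLoop, output.compile], s⟩ := fun {U s} h => iInf_le _ (⟨(U, s), h⟩ :
      {p : ℕ × State // AtHead ω adj w D lab p.1 p.2})
    refine le_trans ?_ (hle hs)
    have hfin : i ≠ ∞ := ne_top_of_le_ne_top ENNReal.one_ne_top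
      ((hle hs).trans (haltLim_le_one _ _ _))
    by_contra hlt
    rw [not_le] at hlt
    -- `e` is the deficit of the infimum against the desired bound `W`.
    obtain ⟨e, he⟩ := exists_add_of_le hlt.le
    have hM0 : ((2 : ℝ≥0∞) ^ w) ≠ 0 := by simp
    have hMt : ((2 : ℝ≥0∞) ^ w) ≠ ∞ := by simp
    -- Accepted words, at least one in sixteen, contribute `W` on average by the induction
    -- hypothesis, and rejected ones at least `i`. Hence every state exceeds the infimum by `e /
    -- 16`, which forces `e = 0`.
    have hstep : ∀ {U s}, AtHead ω adj w D lab U s →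
        i + e / 16 ≤ haltLim w E ⟨[mainLoop, output.compile], s⟩ := fun {U s} hs => by
      obtain ⟨s₁, t₁, U', out, g, hsel, hr, _, hex⟩ :=
        exists_iteration hF hs hne [mainLoop, output.compile]
      refine le_trans ?_ (haltLim_le_of_reach
        (Reach.trans (.single (by simp) (hs.step_mainLoop hne _)) hr))
      refine le_trans ?_ (expect_haltLim_le _ _ _)
      rw [expect_step_rand, ENNReal.le_div_iff_mul_le (Or.inl hM0) (Or.inl hMt)]
      obtain ⟨N, hN, hsum⟩ := hsel.sum_eq fun o => o.elim i fun v =>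
        completion G ω (F.indicator 1) (nextLab adj lab v)
      calc (i + e / 16) * 2 ^ w
          ≤ ((g * weightSum ω D : ℕ) : ℝ≥0∞) * W + N * i := ?_
        _ = ∑ v ∈ D, ((g * ω v : ℕ) : ℝ≥0∞) *
              completion G ω (F.indicator 1) (nextLab adj lab v) + N * i := by
            congr 1
            rw [Nat.cast_mul, mul_assoc, ← sum_completion_nextLab hadj _ hD, Finset.mul_sum]
            simp only [Nat.cast_mul, mul_assoc]
        _ = _ := hsum.symm
        _ ≤ _ := Finset.sum_le_sum fun r hr => ?_
      · have hN' : (2 : ℝ≥0∞) ^ w = ((g * weightSum ω D : ℕ) : ℝ≥0∞) + N := by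
          exact_mod_cast hN.symm
        have h16 : (2 : ℝ≥0∞) ^ w ≤ 16 * ((g * weightSum ω D : ℕ) : ℝ≥0∞) := by
          exact_mod_cast hsel.le
        have h3 : e / 16 * 2 ^ w ≤ ((g * weightSum ω D : ℕ) : ℝ≥0∞) * e := by
          calc e / 16 * 2 ^ w ≤ e / 16 * (16 * ((g * weightSum ω D : ℕ) : ℝ≥0∞)) := by gcongr
            _ = (e / 16 * 16) * ((g * weightSum ω D : ℕ) : ℝ≥0∞) := by ring
            _ = _ := by rw [ENNReal.div_mul_cancel (by norm_num) (by norm_num), mul_comm]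
        calc (i + e / 16) * 2 ^ w = i * 2 ^ w + e / 16 * 2 ^ w := add_mul _ _ _
          _ ≤ i * 2 ^ w + ((g * weightSum ω D : ℕ) : ℝ≥0∞) * e := by gcongr
          _ = _ := by rw [he, hN']; ring
      · obtain ⟨s₂, t₂, hx, hsome, hnone⟩ := hex r (Finset.mem_range.1 hr)
        refine le_trans ?_ (haltLim_le_of_reach (hx _))
        cases ho : out r with
        | none => exact hle (hnone ho).1
        | some v =>
          have hv := hsel.mem r v ho
          exact ih (unlabelled_nextLab_subset hadj hD v) (hsome v ho).1
            (by rw [Finset.card_erase_of_mem hv, hk]; rfl)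
    have h4 : i + e / 16 ≤ i + 0 := by
      rw [add_zero]
      conv_rhs => rw [hi]
      exact le_iInf fun p => hstep p.2
    have h5 := (ENNReal.add_le_add_iff_left hfin).1 h4
    have h6 : e = 0 := by
      simpa using h5
    rw [he, h6, add_zero] at hlt
    exact hlt.false

end Correctness

end WordRAM

namespace WordRAM

open NodeWeightedCC PivotProgram

/-! ### The encoded input, the start of the program and the word length. -/

section Start

variable {n w B : ℕ} {ω : Fin n → ℕ+} {adj : Fin n → List (Fin n)}

theorem length_flatMap_take_finRange (adj : Fin n → List (Fin n)) {u : ℕ} (hu : u ≤ n) :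
    2 * n + 1 + (((List.finRange n).take u).flatMap fun v => (adj v).map Fin.val).length =
      listStart adj u := by
  induction u with
  | zero => simp [listStart]
  | succ u ih =>
    have hu' : u < (List.finRange n).length := by simpa using hu
    have := listStart_succ adj ⟨u, hu⟩
    rw [← List.take_append_getElem hu', List.flatMap_append, List.length_append, ← add_assoc,
      ih (by omega)]
    simpa using this.symm

theorem length_encode (ω : Fin n → ℕ+) (adj : Fin n → List (Fin n)) :
    (encode ω adj).length = listStart adj n := by
  rw [← length_flatMap_take_finRange adj le_rfl, List.take_of_length_le (by simp), encode]
  simp only [List.length_append, List.length_ofFn, List.length_singleton]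
  omega

theorem encode_getD_zero (ω : Fin n → ℕ+) (adj : Fin n → List (Fin n)) :
    (encode ω adj).getD 0 0 = n := by
  simp [encode]

theorem encode_getD_weight (ω : Fin n → ℕ+) (adj : Fin n → List (Fin n)) (u : Fin n) :
    (encode ω adj).getD (1 + u) 0 = ω u := by
  have hu := u.isLt
  rw [encode, List.append_assoc, List.append_assoc, List.getD_append_right _ _ _ _ (by simp),
    List.getD_append _ _ _ _ (by simp), List.getD_eq_getElem _ _ (by simp)]
  simp

theorem encode_getD_degree (ω : Fin n → ℕ+) (adj : Fin n → List (Fin n)) (u : Fin n) :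
    (encode ω adj).getD (n + 1 + u) 0 = (adj u).length := by
  have hu := u.isLt
  rw [encode, List.append_assoc, List.getD_append_right _ _ _ _ (by simp),
    List.getD_append _ _ _ _ (by simp), List.getD_eq_getElem _ _ (by simp)]
  have : n + 1 + (u : ℕ) - (n + 1) = u := by omega
  simp [this]

theorem encode_getD_neighbor (ω : Fin n → ℕ+) (adj : Fin n → List (Fin n)) (u : Fin n) {j : ℕ}
    (hj : j < (adj u).length) : (encode ω adj).getD (listStart adj u + j) 0 = (adj u)[j] := by
  have hu := u.isLt
  have hu' : (u : ℕ) < (List.finRange n).length := by simp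
  have h1 := length_flatMap_take_finRange adj hu.le
  rw [encode, List.getD_append_right _ _ _ _ (by simp; omega)]
  conv_lhs => rw [← List.take_append_drop u (List.finRange n), List.flatMap_append]
  rw [List.getD_append_right _ _ _ _ (by
    simp only [List.length_append, List.length_ofFn, List.length_singleton]; omega), List.drop_eq_getElem_cons hu', List.flatMap_cons,
    List.getElem_finRange]
  have h2 : listStart adj u + j - (([n] ++ List.ofFn fun u => (ω u : ℕ)) ++
      List.ofFn fun u => (adj u).length).length - (((List.finRange n).take u).flatMap
        fun v => (adj v).map Fin.val).length = j := by
    simp only [List.length_append, List.length_ofFn, List.length_singleton]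
    omega
  rw [h2, List.getD_append _ _ _ _ (by simpa using hj), List.getD_eq_getElem _ _ (by simpa using hj)]
  simp

/-- The state after the setup. -/
theorem exists_start (hF : Fits ω adj w B) {d : ℕ} (hd : ∀ u, (ω u : ℕ) ≤ (n + 1) ^ d) :
    ∃ s t, Reach w (start w pivotProgram (encode ω adj)) ⟨[mainLoop, output.compile], s⟩ t ∧
      t ≤ (500 + 40 * d) * n + 220 ∧
      AtHead ω adj w Finset.univ (fun _ => 0) (2 * total ω Finset.univ + 1) s := by
  have hB := hF.lt_pow
  have hR := hF.le_region
  have hT := hF.total_lt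
  have hL := hF.listStart_le
  set s₀ : State := ⟨fun _ => 0, fun i => (encode ω adj).getD i 0 % 2 ^ w⟩ with hs₀
  have e := (Exec.const w (x := 1) (k := 1) s₀).seq <| (Exec.op w 30 .sub 31 1 _).seq <|
    (Exec.const w (x := 1) (k := 16) _).seq (Exec.op w 0 .div 30 1 _)
  set s₁ : State := State.setReg (State.setReg _ 1 (16 % 2 ^ w)) 0 _ with hs₁
  have r30 : s₁.reg 30 = 2 ^ w - 1 := by
    simp [hs₁, hs₀, Op.eval, Nat.mod_eq_of_lt (show 1 < 2 ^ w by omega)]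
  have r31 : s₁.reg 31 = 0 := by
    simp [hs₁, hs₀]
  have r0 : s₁.reg 0 = regionSize w := by
    simp [hs₁, hs₀, Op.eval, regionSize, Nat.mod_eq_of_lt (show 1 < 2 ^ w by omega),
      Nat.mod_eq_of_lt (show 16 < 2 ^ w by omega)]
  have hmem : s₁.mem = s₀.mem := rfl
  have hrep : Rep w s₁ ⟨s₁.reg, fun k i => if k = 0 then (encode ω adj).getD i 0 % 2 ^ w else 0,
      0⟩ := by
    refine ⟨r0, fun _ _ => rfl, fun k hk i hi => ?_⟩
    rw [hmem]
    by_cases h0 : k = 0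
    · simp [h0, hs₀]
    · have : regionSize w ≤ k * regionSize w := Nat.le_mul_of_pos_left _ (by omega)
      simp only [hs₀, h0, if_false]
      rw [List.getD_eq_default _ _ (by rw [length_encode]; omega), Nat.zero_mod]
  have hin : HasInput ω adj w ⟨s₁.reg,
      fun k i => if k = 0 then (encode ω adj).getD i 0 % 2 ^ w else 0, 0⟩ := by
    refine ⟨r30, r31, ?_, fun u => ?_, fun u => ?_, fun u j hj => ?_, fun k i hk => if_neg hk⟩
    · simp only [if_true]
      rw [encode_getD_zero, Nat.mod_eq_of_lt (by omega)]
    · simp only [if_true]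
      have h1 := lt_capacity n (ω u)
      have h2 := cap_le_total ω u
      rw [cap] at h2
      rw [encode_getD_weight, Nat.mod_eq_of_lt (by omega)]
    · simp only [if_true]
      have h1 := listStart_add_le adj u
      rw [encode_getD_degree, Nat.mod_eq_of_lt (by omega)]
    · simp only [if_true]
      have := ((adj u)[j]).isLt
      rw [encode_getD_neighbor ω adj u hj, Nat.mod_eq_of_lt (by omega)]
  obtain ⟨s₂, σ₂, t, e₂, hR₂, ht, hC, h11, ht'⟩ := init_spec hF hd hin s₁ hrep
  refine ⟨s₂, _, .head (by simp [start]) rfl <| (e _).trans <| .head (by simp) rfl <|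
    (e₂ _).trans <| .single (by simp) rfl, ?_,
    ⟨σ₂, _, hR₂, hC, h11, le_rfl, Or.inl (Nat.lt_succ_self _)⟩⟩
  dsimp only at ht ht'
  omega

theorem sum_length_eq {G : SimpleGraph (Fin n)} (hadj : IsAdjList G adj) :
    ∑ v, (adj v).length = 2 * G.edgeSet.ncard := by
  classical
  rw [← SimpleGraph.coe_edgeFinset, Set.ncard_coe_finset, ← G.sum_degrees_eq_twice_card_edges]
  refine Finset.sum_congr rfl fun v _ => ?_
  rw [← List.toFinset_card_of_nodup (hadj v).1, ← G.card_neighborFinset_eq_degree]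
  congr 1
  ext u
  simp [(hadj v).2 u]

theorem total_le_of_le {d : ℕ} (hd : ∀ u, (ω u : ℕ) ≤ (n + 1) ^ d) :
    total ω Finset.univ ≤ 2 * (n * (n + 1) ^ d) := by
  refine (total_le_two_mul _).trans (Nat.mul_le_mul_left _ ?_)
  calc weightSum ω Finset.univ ≤ ∑ _u : Fin n, (n + 1) ^ d := Finset.sum_le_sum fun u _ => hd u
    _ = _ := by simp

/-- All addresses and values stay below a fixed multiple of `(n + 1) ^ (d + 3)`. The ten further
powers of `n + 1 ≥ 2` give a factor `1024`, enough for sixteen regions of size `4 * B + 20`. -/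
theorem fits_of_le (hn : 1 ≤ n) {G : SimpleGraph (Fin n)} (hadj : IsAdjList G adj) {d : ℕ}
    (hd : ∀ u, (ω u : ℕ) ≤ (n + 1) ^ d) (hw : (n + 1) ^ (d + 13) ≤ 2 ^ w) :
    Fits ω adj w ((n + 1) ^ (d + 3)) := by
  have h1 : 1 ≤ (n + 1) ^ d := Nat.one_le_pow _ _ (by omega)
  have h8 : 2 ^ 3 ≤ (n + 1) ^ 3 := Nat.pow_le_pow_left (by omega) 3
  have h10 : 2 ^ 10 ≤ (n + 1) ^ 10 := Nat.pow_le_pow_left (by omega) 10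
  refine ⟨hn, ?_, ?_, ?_⟩
  · calc total ω Finset.univ * (n + 1) ≤ 2 * (n * (n + 1) ^ d) * (n + 1) :=
          Nat.mul_le_mul_right _ (total_le_of_le hd)
      _ = (n + 1) ^ d * (2 * n * (n + 1)) := by ring
      _ ≤ (n + 1) ^ d * (n + 1) ^ 3 := Nat.mul_le_mul_left _ (by nlinarith)
      _ = _ := (pow_add _ _ _).symm
  · have hlen : ∀ u, (adj u).length ≤ n := fun u => by
      simpa using (hadj u).1.length_le_card
    have : ∑ v : Fin n with v.val < n, (adj v).length ≤ n * n := by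
      calc _ ≤ ∑ _v : Fin n, n := by
            refine (Finset.sum_le_sum_of_subset (Finset.filter_subset _ _)).trans ?_
            exact Finset.sum_le_sum fun u _ => hlen u
        _ = _ := by simp
    rw [listStart, pow_add]
    nlinarith
  · have h2 : (n + 1) ^ (d + 13) = (n + 1) ^ (d + 3) * (n + 1) ^ 10 := by ring
    have h3 : 8 ≤ (n + 1) ^ (d + 3) := by
      rw [pow_add]
      nlinarith
    rw [regionSize, Nat.le_div_iff_mul_le (by norm_num)]
    have : (n + 1) ^ (d + 3) * 1024 ≤ 2 ^ w := by
      rw [h2] at hw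
      exact (Nat.mul_le_mul_left _ h10).trans hw
    omega

end Start

end WordRAM

/-! ### The exact output distribution. -/

namespace WordRAM

open NodeWeightedCC PivotProgram

/-- At each fixed time different outputs are disjoint events; monotonicity in time lets the supremum
pass through finite sums. -/
theorem tsum_haltLim_le_one {α : Type*} (w : ℕ) (φ : (ℕ → ℕ) → α) (c : Config) :
    ∑' a, haltLim w {m | φ m = a} c ≤ 1 := by
  classical
  have h1 : ∀ T a, haltIn w {m | φ m = a} T c =
      ((run w T c).map fun c => if c.todo = [] then some (φ c.state.mem) else none) (some a) := by
    intro T a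
    rw [← PMF.toOuterMeasure_apply_singleton, PMF.toOuterMeasure_map_apply, haltIn]
    congr 1
    ext c
    by_cases h : c.todo = [] <;> simp [h]
  have h2 : ∀ T, ∑' a, haltIn w {m | φ m = a} T c ≤ 1 := fun T => by
    simp only [h1]
    refine (ENNReal.tsum_comp_le_tsum_of_injective (Option.some_injective α) _).trans ?_
    rw [PMF.tsum_coe]
  rw [ENNReal.tsum_eq_iSup_sum]
  refine iSup_le fun s => ?_
  simp only [haltLim]
  rw [ENNReal.finsetSum_iSup_of_monotone (f := fun a T => haltIn w {m | φ m = a} T c)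
    fun a _ _ h => haltIn_mono w _ h c]
  exact iSup_le fun T => (ENNReal.sum_le_tsum s).trans (h2 T)

section Output

variable {n w B : ℕ} {ω : Fin n → ℕ+} {adj : Fin n → List (Fin n)} {G : SimpleGraph (Fin n)}

theorem completion_zero_eq_pivotClustering (G : SimpleGraph (Fin n)) (ω : Fin n → ℕ+)
    (C : Setoid (Fin n)) :
    completion G ω (Set.indicator {lab | Setoid.ker lab = C} 1) (fun _ => 0) =
      pivotClustering G ω C := by
  have h : unlabelled (fun _ : Fin n => 0) = Finset.univ := by simp [unlabelled]
  rw [← PMF.toOuterMeasure_apply_singleton, PMF.toOuterMeasure_eq_expect, pivotClustering,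
    PMF.expect_map, completion, h, pivotExpect]
  congr 1
  ext f
  have hk : Setoid.ker (complete (fun _ => 0) f) = Setoid.ker f := by
    ext u v
    simp [Setoid.ker_def, complete, Fin.ext_iff]
  by_cases hC : Setoid.ker f = C <;> simp [Set.indicator, hk, hC]

/-- A probability distribution that lies pointwise below a function of total mass at most `1` equals
it. -/
theorem outputProb_pivotProgram (hF : Fits ω adj w B) (hadj : IsAdjList G adj) {d : ℕ}
    (hd : ∀ u, (ω u : ℕ) ≤ (n + 1) ^ d) (C : Setoid (Fin n)) :
    outputProb w pivotProgram (encode ω adj) (decode n) C = pivotClustering G ω C := by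
  obtain ⟨s, t, hr, _, hs⟩ := exists_start hF hd
  have hle : ∀ C, pivotClustering G ω C ≤
      outputProb w pivotProgram (encode ω adj) (decode n) C := fun C => by
    rw [← completion_zero_eq_pivotClustering]
    exact (hs.completion_le_haltLim hF hadj _ (Finset.subset_univ _)).trans
      (haltLim_le_of_reach hr)
  by_contra hne
  have hlt : pivotClustering G ω C < outputProb w pivotProgram (encode ω adj) (decode n) C :=
    lt_of_le_of_ne (hle C) (Ne.symm hne)
  have h1 := ENNReal.tsum_lt_tsum (by rw [PMF.tsum_coe]; exact ENNReal.one_ne_top) hle hlt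
  rw [PMF.tsum_coe] at h1
  exact (tsum_haltLim_le_one w (decode n) _).not_gt h1

end Output

/-! ### The tail of the running time. -/

section Time

variable {n w B : ℕ} {ω : Fin n → ℕ+} {adj : Fin n → List (Fin n)}

/-- The potential that bounds the running time from the head of the main loop on. -/
def potential (ω : Fin n → ℕ+) (adj : Fin n → List (Fin n)) (D : Finset (Fin n)) (U : ℕ) : ℕ :=
  -- An iteration without rebuild and scan of neighbors takes at most `604 = 2 + 202 + 400` steps.
  -- Each node holds `31` such units, one for its own draw and `30` to offset rejections; the bit
  -- length of `U` pays for rebuilds and the last summand for the output.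
  ∑ v ∈ D, (31 * 604 + 60 * (adj v).length) + 300 * (capacities ω).card * Nat.size U +
    (60 * n + 30)

/-- A rebuild lowers the bit length of `U` by at least one, which bounds the number of rebuilds. -/
theorem size_lt_size {a b : ℕ} (h : 2 * a < b) : a.size < b.size := by
  rw [Nat.lt_size]
  rcases Nat.eq_zero_or_pos a with rfl | ha
  · simp; omega
  · have h1 : 2 ^ (a.size - 1) ≤ a := Nat.lt_size.1 (by have := Nat.size_pos.2 ha; omega)
    have h2 : a.size = a.size - 1 + 1 := by have := Nat.size_pos.2 ha; omega
    rw [h2, pow_succ]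
    omega

/-- Acceptance halves the moment and rejection raises it by `1 / 30`. As `N ≤ 15 * a`, the loss `N /
30` is at most the gain `a / 2`. -/
theorem mul_add_le_of_two_mul_le {a N M : ℕ} (h : a + N = M) (h16 : M ≤ 16 * a) {x z : ℝ≥0∞}
    (hx : 2 * x ≤ z) : (a : ℝ≥0∞) * x + N * (31 / 30 * z) ≤ z * M := by
  have hN : (N : ℝ≥0∞) ≤ 15 * a := by
    have : N ≤ 15 * a := by omega
    exact_mod_cast this
  have h30 : (30 : ℝ≥0∞) * (31 / 30) = 31 := ENNReal.mul_div_cancel (by norm_num) (by norm_num)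
  have key : 30 * ((a : ℝ≥0∞) * x + N * (31 / 30 * z)) ≤ 30 * (z * M) := by
    calc 30 * ((a : ℝ≥0∞) * x + N * (31 / 30 * z))
        = 15 * a * (2 * x) + 30 * (31 / 30) * (N * z) := by ring
      _ = 15 * a * (2 * x) + 30 * (N * z) + N * z := by rw [h30]; ring
      _ ≤ 15 * a * z + 30 * (N * z) + 15 * a * z := by gcongr
      _ = 30 * (z * ((a + N : ℕ) : ℝ≥0∞)) := by push_cast; ring
      _ = 30 * (z * M) := by rw [h]
  exact (ENNReal.mul_le_mul_iff_right (by norm_num) (by norm_num)).1 key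

/-- The product of `y ^ elapsed time` and `y ^ potential` does not grow on average in an iteration.
-/
theorem AtHead.expTime_le (hF : Fits ω adj w B) {y : ℝ≥0∞} (hy : 1 ≤ y) (hyA : y ^ 604 = 31 / 30)
    (hy2 : 2 ≤ y ^ (30 * 604)) (T : ℕ) {D : Finset (Fin n)} {lab : Fin n → ℕ} {U : ℕ} {s : State}
    (hs : AtHead ω adj w D lab U s) :
    expTime w y T ⟨[mainLoop, output.compile], s⟩ ≤ y ^ potential ω adj D U := by
  induction T generalizing D lab U s with
  | zero => exact one_le_pow₀ hy
  | succ T ih =>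
    rcases D.eq_empty_or_nonempty with rfl | hne
    · obtain ⟨s', t, hr, ht, _⟩ := hs.exists_halted hF
      refine (expTime_le_of_reach hr _ hy).trans ?_
      rw [expTime_halted _ _ _ rfl, mul_one]
      refine pow_le_pow_right₀ hy ?_
      rw [potential]
      omega
    · obtain ⟨s₁, t₁, U', out, g, hsel, hr, ht, hex⟩ :=
        exists_iteration hF hs hne [mainLoop, output.compile]
      -- The drop of the bit length pays for the rebuild, so it costs nothing in the balance.
      have hpot : t₁ + potential ω adj D U' ≤ 202 + potential ω adj D U := by
        rcases ht with ⟨rfl, ht⟩ | ⟨rfl, hlt, ht⟩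
        · omega
        · have := Nat.mul_le_mul_left (300 * (capacities ω).card) (size_lt_size hlt)
          rw [Nat.succ_eq_add_one, mul_add, mul_one] at this
          rw [potential, potential]
          omega
      have herase : ∀ v ∈ D, potential ω adj (D.erase v) U' + (31 * 604 + 60 * (adj v).length) =
          potential ω adj D U' := fun v hv => by
        rw [potential, potential, ← Finset.sum_erase_add _ _ hv]
        omega
      have hbig : 30 * 604 ≤ potential ω adj D U := by
        obtain ⟨v, hv⟩ := hne
        rw [potential, ← Finset.sum_erase_add _ _ hv]
        omega
      set z := y ^ potential ω adj D U with hz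
      set x := y ^ (potential ω adj D U - 30 * 604) with hx
      have hxz : 2 * x ≤ z := by
        calc 2 * x ≤ y ^ (30 * 604) * x := by gcongr
          _ = z := by rw [hx, hz, ← pow_add, Nat.add_sub_cancel' hbig]
      have hM0 : ((2 : ℝ≥0∞) ^ w) ≠ 0 := by simp
      have hMt : ((2 : ℝ≥0∞) ^ w) ≠ ∞ := by simp
      -- The loop test uses up the one unit of the budget that the induction needs.
      rw [expTime_succ_of_step T (by simp) (hs.step_mainLoop hne _)]
      have h1 := expTime_le_of_reach hr T hy
      have h2 := expTime_le_step w T hy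
        (c := ⟨[.rand 19, attempt.compile, mainLoop, output.compile], s₁⟩) (by simp)
      rw [expect_step_rand] at h2
      refine le_trans (mul_le_mul_right (h1.trans (mul_le_mul_right h2 _)) _) ?_
      rw [← mul_div_assoc, ← mul_div_assoc, ← mul_div_assoc,
        ENNReal.div_le_iff_le_mul (Or.inl hM0) (Or.inl hMt), Finset.mul_sum, Finset.mul_sum,
        Finset.mul_sum]
      obtain ⟨N, hN, hsum⟩ := hsel.sum_eq fun o => o.elim (31 / 30 * z) fun _ => x
      calc _ ≤ ∑ r ∈ Finset.range (2 ^ w), (out r).elim (31 / 30 * z) fun _ => x :=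
            Finset.sum_le_sum fun r hr => ?_
        _ = _ := hsum
        _ = ((g * weightSum ω D : ℕ) : ℝ≥0∞) * x + N * (31 / 30 * z) := by
            simp only [Option.elim, ← Finset.sum_mul, weightSum, Finset.mul_sum, Nat.cast_sum]
        _ ≤ z * (2 ^ w : ℕ) := mul_add_le_of_two_mul_le hN hsel.le hxz
        _ = _ := by push_cast; rfl
      obtain ⟨s₂, t₂, he, hsome, hnone⟩ := hex r (Finset.mem_range.1 hr)
      have h3 := expTime_le_of_reach (he [mainLoop, output.compile]) T hy
      cases ho : out r with
      | none =>
        obtain ⟨hs₂, ht₂⟩ := hnone ho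
        calc _ ≤ y * (y ^ t₁ * (y * (y ^ t₂ * y ^ potential ω adj D U'))) := by
              gcongr
              exact h3.trans (mul_le_mul_right (ih hs₂) _)
          _ = y ^ (2 + t₁ + t₂ + potential ω adj D U') := by ring
          _ ≤ y ^ (604 + potential ω adj D U) := pow_le_pow_right₀ hy (by omega)
          _ = 31 / 30 * z := by rw [pow_add, hyA]
      | some v =>
        obtain ⟨hs₂, ht₂⟩ := hsome v ho
        have hv := herase v (hsel.mem r v ho)
        calc _ ≤ y * (y ^ t₁ * (y * (y ^ t₂ * y ^ potential ω adj (D.erase v) U'))) := by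
              gcongr
              exact h3.trans (mul_le_mul_right (ih hs₂) _)
          _ = y ^ (2 + t₁ + t₂ + potential ω adj (D.erase v) U') := by ring
          _ ≤ x := pow_le_pow_right₀ hy (by omega)

theorem exists_pow_eq : ∃ y : ℝ≥0∞, 1 ≤ y ∧ y ^ 604 = 31 / 30 ∧ 2 ≤ y ^ (30 * 604) := by
  have hc : ((31 / 30 : NNReal) : ℝ≥0∞) = 31 / 30 := by
    rw [ENNReal.coe_div (by norm_num)]
    rfl
  have hpow : ((31 / 30 : NNReal) ^ ((604 : ℕ) : ℝ)⁻¹) ^ 604 = 31 / 30 :=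
    NNReal.rpow_inv_natCast_pow _ (by norm_num)
  have h1 : (1 : NNReal) ≤ 31 / 30 := by
    rw [one_le_div (by norm_num)]
    norm_num
  have h2 : (2 : NNReal) ≤ (31 / 30) ^ 30 := by
    rw [div_pow, le_div_iff₀ (by positivity)]
    norm_num
  refine ⟨((31 / 30 : NNReal) ^ ((604 : ℕ) : ℝ)⁻¹ : NNReal), ?_, ?_, ?_⟩
  · exact_mod_cast NNReal.one_le_rpow h1 (by positivity)
  · rw [← ENNReal.coe_pow, hpow, hc]
  · rw [← ENNReal.coe_pow, mul_comm, pow_mul, hpow]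
    exact_mod_cast h2

/-- A capacity is determined by two exponents: that of `n + 1` is at most `d`, and the other comes
from the logarithm of a leading digit. -/
theorem card_capacities_le_log (hn : 1 ≤ n) {d : ℕ} (hd : ∀ u, (ω u : ℕ) ≤ (n + 1) ^ d) :
    (capacities ω).card ≤ (d + 1) * (Nat.log 2 n + 1) := by
  have hsub : capacities ω ⊆ (Finset.range (d + 1) ×ˢ Finset.range (Nat.log 2 n + 1)).image
      fun p => 2 ^ (p.2 + 1) * (n + 1) ^ p.1 := by
    intro c hc
    obtain ⟨u, _, rfl⟩ := Finset.mem_image.1 hc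
    refine Finset.mem_image.2 ⟨(Nat.log (n + 1) (ω u),
      Nat.log 2 (ω u / (n + 1) ^ Nat.log (n + 1) (ω u))), ?_, rfl⟩
    rw [Finset.mem_product, Finset.mem_range, Finset.mem_range, Nat.lt_succ_iff, Nat.lt_succ_iff]
    constructor
    · calc _ ≤ Nat.log (n + 1) ((n + 1) ^ d) := Nat.log_mono_right (hd u)
        _ = d := Nat.log_pow (by omega) d
    · dsimp only
      refine Nat.log_mono_right (Nat.lt_succ_iff.1 ?_)
      rw [Nat.div_lt_iff_lt_mul (by positivity), ← pow_succ']
      exact Nat.lt_pow_succ_log_self (by omega) _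
  refine (Finset.card_le_card hsub).trans (Finset.card_image_le.trans ?_)
  simp

theorem size_total_le (hn : 1 ≤ n) {d : ℕ} (hd : ∀ u, (ω u : ℕ) ≤ (n + 1) ^ d) :
    Nat.size (2 * total ω Finset.univ + 1) ≤ (d + 3) * (Nat.log 2 n + 1) := by
  have h1 := total_le_of_le hd
  have h2 : n + 1 ≤ 2 ^ (Nat.log 2 n + 1) := Nat.lt_pow_succ_log_self (by norm_num) n
  have h3 : 1 ≤ (n + 1) ^ d := Nat.one_le_pow _ _ (by omega)
  rw [Nat.size_le]
  calc 2 * total ω Finset.univ + 1 < 4 * (n + 1) ^ (d + 1) := by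
        rw [pow_succ]
        nlinarith
    _ ≤ 2 ^ (2 * (Nat.log 2 n + 1)) * (2 ^ (Nat.log 2 n + 1)) ^ (d + 1) := by
        gcongr
        calc 4 = 2 ^ (2 * 1) := rfl
          _ ≤ _ := Nat.pow_le_pow_right (by norm_num) (by omega)
    _ = 2 ^ ((d + 3) * (Nat.log 2 n + 1)) := by ring

/-- With `k = Nat.log 2 n` this makes the product of the numbers of buckets and of rebuilds linear
in `n`. -/
theorem sq_succ_le (k : ℕ) : (k + 1) * (k + 1) ≤ 4 * 2 ^ k := by
  induction k with
  | zero => norm_num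
  | succ k ih =>
    -- The ratio of consecutive squares is below `2` only from here on, hence the two separate
    -- cases.
    rcases k with _ | _ | k
    · norm_num
    · norm_num
    · rw [pow_succ]
      nlinarith

theorem potential_univ_le (hn : 1 ≤ n) {G : SimpleGraph (Fin n)} (hadj : IsAdjList G adj) {d : ℕ}
    (hd : ∀ u, (ω u : ℕ) ≤ (n + 1) ^ d) :
    potential ω adj Finset.univ (2 * total ω Finset.univ + 1) ≤
      (20000 + 1200 * ((d + 1) * (d + 3))) * (n + G.edgeSet.ncard) := by
  have h1 := Nat.mul_le_mul (card_capacities_le_log hn hd) (size_total_le (ω := ω) hn hd)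
  have h2 : (Nat.log 2 n + 1) * (Nat.log 2 n + 1) ≤ 4 * n :=
    (sq_succ_le _).trans (Nat.mul_le_mul_left _ (Nat.pow_log_le_self 2 (by omega)))
  have h3 : (capacities ω).card * Nat.size (2 * total ω Finset.univ + 1) ≤
      (d + 1) * (d + 3) * (4 * n) := by
    calc _ ≤ _ := h1
      _ = (d + 1) * (d + 3) * ((Nat.log 2 n + 1) * (Nat.log 2 n + 1)) := by ring
      _ ≤ _ := Nat.mul_le_mul_left _ h2
  have h5 : ∑ v, (31 * 604 + 60 * (adj v).length) =
      n * (31 * 604) + 60 * (2 * G.edgeSet.ncard) := by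
    rw [Finset.sum_add_distrib, ← Finset.mul_sum Finset.univ fun v => (adj v).length,
      sum_length_eq hadj, Finset.sum_const, Finset.card_univ, Fintype.card_fin, smul_eq_mul]
  rw [potential, h5]
  have h4 := Nat.zero_le ((d + 1) * (d + 3) * G.edgeSet.ncard)
  nlinarith

/-- The time bound exceeds setup and potential by `30 * 604 * (c * n)` steps. As `2 ≤ y ^ (30 *
604)`, Markov's inequality bounds the failure probability by `2 ^ (-c n)`, and `n ≤ 2 ^ n`. -/
theorem haltProb_pivotProgram (hn : 1 ≤ n) (hF : Fits ω adj w B) {G : SimpleGraph (Fin n)}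
    (hadj : IsAdjList G adj) {d : ℕ} (hd : ∀ u, (ω u : ℕ) ≤ (n + 1) ^ d) (c : ℕ) :
    1 - ((n : ℝ≥0∞) ^ c)⁻¹ ≤ haltProb w pivotProgram (encode ω adj)
      ((20720 + 40 * d + 1200 * ((d + 1) * (d + 3)) + 30 * 604 * c) *
        (n + G.edgeSet.ncard)) := by
  obtain ⟨s, t, hr, ht, hs⟩ := exists_start hF hd
  obtain ⟨y, hy, hyA, hy2⟩ := exists_pow_eq
  set T := (20720 + 40 * d + 1200 * ((d + 1) * (d + 3)) + 30 * 604 * c) * (n + G.edgeSet.ncard)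
  set Φ := potential ω adj Finset.univ (2 * total ω Finset.univ + 1)
  set S := surv w T (start w pivotProgram (encode ω adj))
  have hT : t + Φ + 30 * 604 * (c * n) ≤ T := by
    have h1 : Φ ≤ _ := potential_univ_le hn hadj hd
    have h2 : T = (20000 + 1200 * ((d + 1) * (d + 3))) * (n + G.edgeSet.ncard) +
      ((500 + 40 * d) * n + 220 * n) + 30 * 604 * (c * n) +
      (720 + 40 * d + 30 * 604 * c) * G.edgeSet.ncard := by ring
    omega
  have h1 : S * y ^ T ≤ y ^ (t + Φ) := by
    refine (surv_mul_pow_le w T y _).trans ((expTime_le_of_reach hr T hy).trans ?_)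
    rw [pow_add]
    gcongr
    exact hs.expTime_le hF hy hyA hy2 T
  have hyt : y ≠ ∞ := by
    rintro rfl
    rw [ENNReal.top_pow (by norm_num)] at hyA
    exact ENNReal.div_ne_top (by norm_num) (by norm_num) hyA.symm
  have h2 : S * 2 ^ (c * n) ≤ 1 := by
    refine (ENNReal.mul_le_mul_iff_right (a := y ^ (t + Φ)) ?_ (ENNReal.pow_ne_top hyt)).1 ?_
    · exact pow_ne_zero _ (zero_lt_one.trans_le hy).ne'
    · calc y ^ (t + Φ) * (S * 2 ^ (c * n)) ≤ y ^ (t + Φ) * (S * (y ^ (30 * 604)) ^ (c * n)) := by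
            gcongr
        _ = S * y ^ (t + Φ + 30 * 604 * (c * n)) := by rw [pow_add, pow_mul]; ring
        _ ≤ S * y ^ T := by gcongr
        _ ≤ y ^ (t + Φ) * 1 := by rwa [mul_one]
  have hnle : (n : ℝ≥0∞) ≤ 2 ^ n := by exact_mod_cast n.lt_two_pow_self.le
  have h3 : S ≤ ((n : ℝ≥0∞) ^ c)⁻¹ := by
    rw [ENNReal.le_inv_iff_mul_le]
    refine le_trans ?_ h2
    rw [mul_comm c n, pow_mul]
    gcongr
  rw [tsub_le_iff_left, ← surv_add_halt w T (start w pivotProgram (encode ω adj))]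
  exact add_le_add_left h3 _

end Time

end WordRAM

/-- There is one randomized word RAM program which, on every node-weighted graph with `n ≥ 1` nodes,
`m` edges and weights at most `(n + 1) ^ d`, on words of at least `κ * log₂ (n + 1)` bits
(`κ` depends only on `d`), halts almost surely, outputs the clustering of the pivot procedure with
weight-proportional pivots, has expected cost at most three times the optimum, and halts within
`K * (n + m)` steps with probability at least `1 - 1 / n ^ c` (`K` depends only on `d` and `c`). -/
theorem theorem5 :
    ∃ P : WordRAM.Prog, ∀ d : ℕ, ∃ κ : ℕ, ∀ c : ℕ, ∃ K : ℕ,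
      ∀ (n : ℕ) (_ : 1 ≤ n) (G : SimpleGraph (Fin n)) (ω : Fin n → ℕ+)
        (_ : ∀ u, (ω u : ℕ) ≤ (n + 1) ^ d)
        (adj : Fin n → List (Fin n)) (_ : NodeWeightedCC.IsAdjList G adj)
        (w : ℕ) (_ : (n + 1) ^ κ ≤ 2 ^ w),
        (∑' C : Setoid (Fin n), WordRAM.outputProb w P (NodeWeightedCC.encode ω adj)
            (NodeWeightedCC.decode n) C = 1) ∧
        (∀ C : Setoid (Fin n), WordRAM.outputProb w P (NodeWeightedCC.encode ω adj)
            (NodeWeightedCC.decode n) C = NodeWeightedCC.pivotClustering G ω C) ∧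
        (∑' C : Setoid (Fin n), WordRAM.outputProb w P (NodeWeightedCC.encode ω adj)
            (NodeWeightedCC.decode n) C * (NodeWeightedCC.cost G ω C : ℝ≥0∞)
          ≤ 3 * (NodeWeightedCC.opt G ω : ℝ≥0∞)) ∧
        1 - ((n : ℝ≥0∞) ^ c)⁻¹ ≤ WordRAM.haltProb w P (NodeWeightedCC.encode ω adj)
            (K * (n + G.edgeSet.ncard)) := by
  refine ⟨WordRAM.pivotProgram, fun d => ⟨d + 13, fun c =>
    ⟨20720 + 40 * d + 1200 * ((d + 1) * (d + 3)) + 30 * 604 * c, fun n hn G ω hd adj hadj w hw => ?_⟩⟩⟩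
  have hF := WordRAM.fits_of_le hn hadj hd hw
  have hout := fun C => WordRAM.outputProb_pivotProgram hF hadj hd C
  refine ⟨?_, hout, ?_, WordRAM.haltProb_pivotProgram hn hF hadj hd c⟩
  · simp only [hout]
    exact PMF.tsum_coe _
  · simp only [hout]
    exact NodeWeightedCC.expect_cost_pivotClustering_le G ω
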